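/- Let $0<\gamma\le 1$ and let $B(|V|,\theta)\ge 0$ be a measurable cross-section satisfying Grad's angular cut-off $B(|V|,\theta)\le C_B|V|^{\gamma}\cos\theta\sin\theta$ ($0\le\theta\le\frac\pi2$). Let $w(\zeta)=\pi^{-3/2}e^{-|\zeta|^2}$ on $\mathbb R^3$, let $$L(f)=2w^{-\frac12}Q(w,w^{\frac12}f)=-\nu f+K(f),\qquad 2Q(F,G)=\int\!\!\int_0^{2\pi}\!\!\int_0^{\frac\pi2}(F'G'_*+F'_*G'-FG_*-F_*G)\,B(|\zeta_*-\zeta|,\theta)\,d\theta\,d\varepsilon\,d\zeta_*,$$ where $\zeta'=\zeta+(a\cdot V)a$, $\zeta'_*=\zeta_*-(a\cdot V)a$, $V=\zeta_*-\zeta$, and the unit vector $a$, with $a\cdot V=|V|\cos\theta$, is parametrized by $\theta$ and the azimuth $\varepsilon$ about $V$; here $\nu(\zeta)=\int\!\int_0^{2\pi}\!\int_0^{\pi/2} w(\zeta_*)B\,d\theta\,d\varepsilon\,d\zeta_*$ and $K(f)=w^{-\frac12}\int\!\int_0^{2\pi}\!\int_0^{\pi/2}(w'h'_*+w'_*h'-wh_*)B\,d\theta\,d\varepsilon\,d\zeta_*$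 with $h=w^{\frac12}f$. Assume that $\nu(\zeta)\ge\nu_0(1+|\zeta|)^\gamma$ for some $\nu_0>0$. Let $l>0$, $\Vert g\Vert_*=(\int g^2\nu\,d\zeta)^{1/2}$ and $|||f|||=\sup_{0\le x\le l}\Vert f(x,\cdot)\Vert_*$. A (measurable) function $f$ with $|||f|||<\infty$ is a solution of $\zeta_1\partial_xf=L(f)$ on $[0,l]$ if for every $x\in[0,l]$ and almost every $\zeta$ $$f(x,\zeta)=\begin{cases}e^{-\frac{\nu(\zeta)}{|\zeta_1|}x}f(0,\zeta)+\int_0^x\frac1{|\zeta_1|}e^{-\frac{\nu(\zeta)}{|\zeta_1|}(x-s)}K(f)(s,\zeta)\,ds,&\zeta_1>0,\\ e^{-\frac{\nu(\zeta)}{|\zeta_1|}(l-x)}f(l,\zeta)+\int_x^l\frac1{|\zeta_1|}e^{-\frac{\nu(\zeta)}{|\zeta_1|}(s-x)}K(f)(s,\zeta)\,ds,&\zeta_1<0.\end{cases}$$ For $\alpha\in\mathbb Z_{\ge0}^3$ let $\phi_\alpha(\zeta)=\pi^{-\frac34}\zeta_1^{\alpha_1}\zeta_2^{\alpha_2}\zeta_3^{\alpha_3}e^{-|\zeta|^2/2}$,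 $A_\alpha=\prod_{i=1}^3(2\alpha_i)^{\alpha_i/2}e^{-\alpha_i/2}$ (with $0^0=1$), and $$\sigma^+_\alpha(x)=\int_{\zeta_1>0}\phi_\alpha f(x,\zeta)\,d\zeta,\qquad \sigma^-_\alpha(x)=\int_{\zeta_1<0}\phi_\alpha f(x,\zeta)\,d\zeta .$$ **Lemma.** There is a constant $C$, depending only on $B$, $\gamma$ and $l$, such that for every solution $f$ with $f(0,\cdot)\in L^\infty(\{\zeta_1>0\})$ and $f(l,\cdot)\in L^\infty(\{\zeta_1<0\})$ and every $\alpha$, the function $\sigma^+_\alpha$ is differentiable on $(0,l]$, $\sigma^-_\alpha$ is differentiable on $[0,l)$ (one-sidedly at the included endpoint), and $$|\partial_x\sigma^+_\alpha(x)|\le C A_\alpha\langle f\rangle\,(|\ln x|+1)\quad(0<x\le l),\qquad |\partial_x\sigma^-_\alpha(x)|\le C A_\alpha\langle f\rangle\,(|\ln(l-x)|+1)\quad(0\le x<l),$$ where $\langle f\rangle=|||f|||+\Vert f(0,\cdot)\Vert_{L^\infty(\zeta_1>0)}+\Vert f(l,\cdot)\Vert_{L^\infty(\zeta_1<0)}$.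 -/

import Mathlib

open MeasureTheory
open scoped ENNReal

noncomputable section

namespace Boltzmann

/-- Velocity space `ℝ³` with its Euclidean norm; the coordinate `ζ₁` is `ζ 0`. -/
abbrev Vel : Type := EuclideanSpace ℝ (Fin 3)

/-- The standard Maxwellian `w(ζ) = π^(-3/2) exp(-|ζ|²)`. -/
def maxwellian (ζ : Vel) : ℝ :=
  (Real.sqrt Real.pi ^ 3)⁻¹ * Real.exp (-‖ζ‖ ^ 2)

/-- Post-collisional velocity `ζ + (a · V) a`, where `V = ζs - ζ`. -/
def post (ζ ζs a : Vel) : Vel :=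
  ζ + inner ℝ a (ζs - ζ) • a

/-- Post-collisional velocity `ζs - (a · V) a` of the partner, where `V = ζs - ζ`. -/
def postStar (ζ ζs a : Vel) : Vel :=
  ζs - inner ℝ a (ζs - ζ) • a

/-- The cross-section as a density with respect to the surface measure on the unit sphere.
The unit vector `a` runs over the hemisphere `a · V > 0` and is parametrized by the angle `θ`
between `a` and `V` and the azimuth `ε` about `V`, so that the surface measure is
`da = sin θ dθ dε`. Hence `B(|V|, θ) dθ dε` is `(B(|V|, θ) / sin θ) da`. -/
def crossDensity (B : ℝ → ℝ → ℝ) (V a : Vel) : ℝ :=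
  if 0 < inner ℝ a V then
    B ‖V‖ (InnerProductGeometry.angle a V) / Real.sin (InnerProductGeometry.angle a V)
  else 0

/-- The collisional integral `∫ ∫₀^{2π} ∫₀^{π/2} Ψ(ζs, a) B(|ζs - ζ|, θ) dθ dε dζs`. -/
def collisionIntegral (B : ℝ → ℝ → ℝ) (Ψ : Vel → Vel → ℝ) (ζ : Vel) : ℝ :=
  ∫ p : Vel × Metric.sphere (0 : Vel) 1,
    Ψ p.1 (p.2 : Vel) * crossDensity B (p.1 - ζ) (p.2 : Vel)
      ∂((volume : Measure Vel).prod (volume : Measure Vel).toSphere)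

/-- The collision frequency `ν(ζ) = ∫∫∫ w(ζs) B dθ dε dζs`. -/
def collisionFreq (B : ℝ → ℝ → ℝ) (ζ : Vel) : ℝ :=
  collisionIntegral B (fun ζs _ => maxwellian ζs) ζ

/-- The integral part `K` of the linearized collision operator
`L(f) = 2 w^(-1/2) Q(w, w^(1/2) f) = -ν f + K(f)`, where `Q` is the symmetric bilinear form of the
collision operator, `2 Q(F, G) = ∫∫∫ (F' G'_* + F'_* G' - F G_* - F_* G) B dθ dε dζs`. With
`h = w^(1/2) f`, this is `K(f) = w^(-1/2) ∫∫∫ (w' h'_* + w'_* h' - w h_*) B dθ dε dζs`; the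
remaining term `-w^(-1/2) ∫∫∫ w_* h B dθ dε dζs` of `L(f)` is `-ν f`. -/
def collisionK (B : ℝ → ℝ → ℝ) (f : Vel → ℝ) (ζ : Vel) : ℝ :=
  let h : Vel → ℝ := fun η => Real.sqrt (maxwellian η) * f η
  (Real.sqrt (maxwellian ζ))⁻¹ *
    collisionIntegral B (fun ζs a =>
      maxwellian (post ζ ζs a) * h (postStar ζ ζs a)
        + maxwellian (postStar ζ ζs a) * h (post ζ ζs a)
        - maxwellian ζ * h ζs) ζ

/-- Grad's angular cut-off with exponent `γ`: a nonnegative measurable cross-section with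
`B(|V|, θ) ≤ C |V|^γ cos θ sin θ`, whose collision frequency is nondegenerate,
`ν₀ (1 + |ζ|)^γ ≤ ν(ζ)` with `ν₀ > 0`. (The matching upper bound on `ν` follows from `bound`.
The lower bound does not follow from it, as `B = 0` shows.) -/
structure IsGradCutoff (B : ℝ → ℝ → ℝ) (γ : ℝ) : Prop where
  measurable : Measurable (Function.uncurry B)
  nonneg : ∀ r θ : ℝ, 0 ≤ r → θ ∈ Set.Icc 0 (Real.pi / 2) → 0 ≤ B r θ
  bound : ∃ C : ℝ, ∀ r θ : ℝ, 0 ≤ r → θ ∈ Set.Icc 0 (Real.pi / 2) →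
    B r θ ≤ C * r ^ γ * Real.cos θ * Real.sin θ
  freq_lower : ∃ ν₀ : ℝ, 0 < ν₀ ∧ ∀ ζ : Vel, ν₀ * (1 + ‖ζ‖) ^ γ ≤ collisionFreq B ζ

/-- `‖g‖_* = (∫ g² ν dζ)^(1/2)`, with values in `[0, ∞]`. -/
def starNorm (B : ℝ → ℝ → ℝ) (g : Vel → ℝ) : ℝ≥0∞ :=
  (∫⁻ ζ, ‖g ζ‖ₑ ^ 2 * ENNReal.ofReal (collisionFreq B ζ)) ^ (1 / 2 : ℝ)

/-- `|||f||| = sup_{0 ≤ x ≤ l} ‖f(x, ·)‖_*`, with values in `[0, ∞]`. -/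
def tripleNorm (B : ℝ → ℝ → ℝ) (l : ℝ) (f : ℝ → Vel → ℝ) : ℝ≥0∞ :=
  ⨆ x ∈ Set.Icc (0 : ℝ) l, starNorm B (f x)

/-- The half-space `ζ₁ > 0`. -/
def posHalf : Set Vel := {ζ | 0 < ζ 0}

/-- The half-space `ζ₁ < 0`. -/
def negHalf : Set Vel := {ζ | ζ 0 < 0}

/-- `f ∈ L^∞_x([0,l], L^*_ζ(ℝ³))` is a solution of the stationary linearized Boltzmann equation
`ζ₁ ∂_x f = L(f)` on `[0,l]`: it satisfies the integrated equation along characteristics. -/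
structure IsSolution (B : ℝ → ℝ → ℝ) (l : ℝ) (f : ℝ → Vel → ℝ) : Prop where
  measurable_joint : AEStronglyMeasurable (Function.uncurry f)
    (((volume : Measure ℝ).restrict (Set.Icc 0 l)).prod (volume : Measure Vel))
  measurable_slice : ∀ x ∈ Set.Icc (0 : ℝ) l, AEStronglyMeasurable (f x) volume
  bounded : tripleNorm B l f < ∞
  eq_pos : ∀ x ∈ Set.Icc (0 : ℝ) l, ∀ᵐ ζ : Vel, 0 < ζ 0 →
    f x ζ = Real.exp (-(collisionFreq B ζ / |ζ 0|) * x) * f 0 ζ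
      + ∫ s in (0 : ℝ)..x,
          1 / |ζ 0| * Real.exp (-(collisionFreq B ζ / |ζ 0|) * (x - s)) * collisionK B (f s) ζ
  eq_neg : ∀ x ∈ Set.Icc (0 : ℝ) l, ∀ᵐ ζ : Vel, ζ 0 < 0 →
    f x ζ = Real.exp (-(collisionFreq B ζ / |ζ 0|) * (l - x)) * f l ζ
      + ∫ s in x..l,
          1 / |ζ 0| * Real.exp (-(collisionFreq B ζ / |ζ 0|) * (s - x)) * collisionK B (f s) ζ

/-- `⟨f⟩ = |||f||| + ‖f(0,·)‖_{L^∞(ζ₁ > 0)} + ‖f(l,·)‖_{L^∞(ζ₁ < 0)}`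
(each summand is finite wherever this is used). -/
def dataNorm (B : ℝ → ℝ → ℝ) (l : ℝ) (f : ℝ → Vel → ℝ) : ℝ :=
  (tripleNorm B l f + eLpNorm (f 0) ∞ (volume.restrict posHalf)
    + eLpNorm (f l) ∞ (volume.restrict negHalf)).toReal

/-- `φ_α(ζ) = π^(-3/4) ζ₁^α₁ ζ₂^α₂ ζ₃^α₃ exp(-|ζ|²/2)`. -/
def momentWeight (α : Fin 3 → ℕ) (ζ : Vel) : ℝ :=
  Real.pi ^ (-(3 / 4) : ℝ) * (∏ i, ζ i ^ α i) * Real.exp (-‖ζ‖ ^ 2 / 2)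

/-- `A_α = (2α₁)^(α₁/2) (2α₂)^(α₂/2) (2α₃)^(α₃/2) exp(-(α₁+α₂+α₃)/2)`, with `0⁰ = 1`. -/
def momentConst (α : Fin 3 → ℕ) : ℝ :=
  (∏ i, (2 * (α i : ℝ)) ^ ((α i : ℝ) / 2)) * Real.exp (-(∑ i, (α i : ℝ)) / 2)

/-- `σ⁺_α(x)`, the integral of `φ_α f(x, ·)` over `ζ₁ > 0`. -/
def sigmaPlus (f : ℝ → Vel → ℝ) (α : Fin 3 → ℕ) (x : ℝ) : ℝ :=
  ∫ ζ in posHalf, momentWeight α ζ * f x ζ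

/-- `σ⁻_α(x)`, the integral of `φ_α f(x, ·)` over `ζ₁ < 0`. -/
def sigmaMinus (f : ℝ → Vel → ℝ) (α : Fin 3 → ℕ) (x : ℝ) : ℝ :=
  ∫ ζ in negHalf, momentWeight α ζ * f x ζ

end Boltzmann

end

noncomputable section

namespace Boltzmann

/-! Along a characteristic, `f` solves `y' = -κ y + c g` with `κ = ν/|ζ₁|`, `c = 1/|ζ₁|` and `g =
K(f)`. Boundedness of `g` alone controls `∂ₓf` only by a multiple of `1/|ζ₁|`, which is not
integrable across `ζ₁ = 0`. The remedy is Hölder continuity of `g` in `x`. Since `κ ∫₀ˣ exp(-κ(x-s))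
ds = 1 - exp(-κx)`, the two large terms of `y'` cancel up to a boundary layer `exp(-κx)(κ|a| +
c|g(x)|)` and an integral of `g(x) - g(s)`. With Hölder exponent `1/4` the latter is of order `c
κ^(-1/4)`, that is `|ζ₁|^(-3/4)`, which is integrable. The boundary layer is at most of order `(1 +
|ζ|)|ζ₁|⁻¹ exp(-ν₀x/|ζ₁|)`, and its Gaussian integral is of order `|ln x| + 1` (`exists_log_bound`,
`abs_deriv_charSol_le`).

The Hölder continuity comes from smoothing by `K`. Its kernel is dominated by `|u|⁻¹ exp(-|u|²/8)`,
where `u` is the velocity increment (`lintegral_gainMajorant_le`, `collisionK_bound`). This kernel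
is square integrable on `ℝ³`, so by Cauchy–Schwarz `K(f)` is bounded by `|||f|||`
(`abs_collisionK_le_starNorm`). The integrated equation then makes `f` itself Hölder in `x`, but
with the singular weight `(ν/|ζ₁|)^(1/4)` (`IsSolution.ae_abs_sub_le`). Convolution with the kernel
replaces that weight by `1 + |ζ|` (`abs_collisionK_le_of_le_rpow`), which gives
`exists_collisionK_holder`.

Differentiation under the integral over a half-space finishes the proof
(`exists_moment_deriv_bound`). Half of the Gaussian in `φ_α` absorbs the monomial and produces
`A_α`; the other half supplies decay in `ζ`. The half-space `ζ₁ < 0` reduces to the other one by `x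
↦ l - x`. -/

/-! ### Integration in polar, orthonormal and cylindrical coordinates. -/

theorem lintegral_polar (Φ : Vel → ℝ≥0∞) (hΦ : Measurable Φ) :
    ∫⁻ x, Φ x = ∫⁻ a, (∫⁻ r in Set.Ioi (0 : ℝ), ENNReal.ofReal (r ^ 2) * Φ (r • (a : Vel)))
      ∂(volume : Measure Vel).toSphere := by
  have hmp := (volume : Measure Vel).measurePreserving_homeomorphUnitSphereProd
  have hd : Module.finrank ℝ Vel - 1 = 2 := by simp
  rw [hd] at hmp
  have h1 : ∫⁻ x, Φ x = ∫⁻ x : ({0}ᶜ : Set Vel), Φ x ∂((volume : Measure Vel).comap (↑)) := by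
    rw [lintegral_subtype_comap (measurableSet_singleton _).compl, restrict_compl_singleton]
  have hm : Measurable fun p : Metric.sphere (0 : Vel) 1 × Set.Ioi (0 : ℝ) =>
      Φ (p.2.1 • (p.1 : Vel)) := by
    apply hΦ.comp
    fun_prop
  have h2 : ∫⁻ x : ({0}ᶜ : Set Vel), Φ x ∂((volume : Measure Vel).comap (↑))
      = ∫⁻ p : Metric.sphere (0 : Vel) 1 × Set.Ioi (0 : ℝ), Φ (p.2.1 • (p.1 : Vel))
        ∂((volume : Measure Vel).toSphere.prod (Measure.volumeIoiPow 2)) := by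
    rw [← hmp.lintegral_comp hm]
    refine lintegral_congr fun x => ?_
    have := (homeomorphUnitSphereProd Vel).symm_apply_apply x
    congr 1
    conv_lhs => rw [← this]
    rfl
  rw [h1, h2, lintegral_prod _ hm.aemeasurable]
  refine lintegral_congr fun a => ?_
  have hma : Measurable fun r : ℝ => Φ (r • (a : Vel)) := hΦ.comp (by fun_prop)
  rw [Measure.volumeIoiPow, lintegral_withDensity_eq_lintegral_mul _ (by fun_prop)
    (by exact hma.comp measurable_subtype_coe)]
  exact lintegral_subtype_comap (measurableSet_Ioi (a := (0 : ℝ)))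
    (fun r : ℝ => ENNReal.ofReal (r ^ 2) * Φ (r • (a : Vel)))

theorem lintegral_coords (b : OrthonormalBasis (Fin 3) ℝ Vel) (Φ : Vel → ℝ≥0∞)
    (hΦ : Measurable Φ) :
    ∫⁻ x, Φ x = ∫⁻ z : ℝ, ∫⁻ y : ℝ × ℝ, Φ (z • b 0 + y.1 • b 1 + y.2 • b 2) := by
  have e1 := b.measurePreserving_repr_symm
  have e2 := PiLp.volume_preserving_toLp (Fin 3)
  have e3 := (volume_preserving_piFinSuccAbove (fun _ : Fin 3 => ℝ) 0).symm
  have e4 := (MeasurePreserving.id (volume : Measure ℝ)).prod (volume_preserving_finTwoArrow ℝ).symm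
  rw [← e1.lintegral_comp hΦ, ← e2.lintegral_comp (by exact hΦ.comp (by fun_prop)),
    ← e3.lintegral_comp (by exact hΦ.comp (by fun_prop)),
    Measure.volume_eq_prod]
  have hm : Measurable fun x : ℝ × (Fin 2 → ℝ) => Φ (b.repr.symm (WithLp.toLp 2
      ((MeasurableEquiv.piFinSuccAbove (fun _ : Fin 3 => ℝ) 0).symm x))) :=
    hΦ.comp (by fun_prop)
  have e4' : MeasurePreserving (Prod.map id (MeasurableEquiv.finTwoArrow (α := ℝ)).symm)
     ((volume : Measure ℝ).prod (volume : Measure (ℝ × ℝ)))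
     ((volume : Measure ℝ).prod (volume : Measure (Fin 2 → ℝ))) := e4
  refine (e4'.lintegral_comp hm).symm.trans ?_
  rw [lintegral_prod]
  · refine lintegral_congr fun z => lintegral_congr fun y => ?_
    congr 1
    rw [← b.sum_repr_symm, Fin.sum_univ_three]
    rfl
  · exact (hm.comp (by fun_prop)).aemeasurable

theorem exists_basis_of_unit (a : Vel) (ha : ‖a‖ = 1) :
    ∃ b : OrthonormalBasis (Fin 3) ℝ Vel, b 0 = a := by
  have h : Orthonormal ℝ (({0} : Set (Fin 3)).domRestrict (fun _ : Fin 3 => a)) := by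
    constructor
    · rintro ⟨i, hi⟩; exact ha
    · rintro ⟨i, hi⟩ ⟨j, hj⟩ hij
      simp at hi hj
      subst hi; subst hj; exact absurd rfl hij
  obtain ⟨b, hb⟩ := h.exists_orthonormalBasis_extension_of_card_eq (by simp)
  exact ⟨b, hb 0 rfl⟩

theorem norm_sq_coords (b : OrthonormalBasis (Fin 3) ℝ Vel) (z y₁ y₂ : ℝ) :
    ‖z • b 0 + y₁ • b 1 + y₂ • b 2‖ ^ 2 = z ^ 2 + y₁ ^ 2 + y₂ ^ 2 := by
  have h := b.orthonormal
  have h01 : inner ℝ (b 0) (b 1) = 0 := h.2 (by decide)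
  have h02 : inner ℝ (b 0) (b 2) = 0 := h.2 (by decide)
  have h12 : inner ℝ (b 1) (b 2) = 0 := h.2 (by decide)
  have h10 : inner ℝ (b 1) (b 0) = 0 := h.2 (by decide)
  have h20 : inner ℝ (b 2) (b 0) = 0 := h.2 (by decide)
  have h21 : inner ℝ (b 2) (b 1) = 0 := h.2 (by decide)
  rw [← real_inner_self_eq_norm_sq]
  simp only [inner_add_left, inner_add_right, real_inner_smul_left, real_inner_smul_right, h01, h02,
    h12, h10, h20, h21, real_inner_self_eq_norm_sq, norm_smul, b.norm_eq_one,
    Real.norm_eq_abs, mul_one, sq_abs, mul_zero, add_zero, zero_add]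

theorem inner_coords (b : OrthonormalBasis (Fin 3) ℝ Vel) (z y₁ y₂ : ℝ) :
    inner ℝ (z • b 0 + y₁ • b 1 + y₂ • b 2) (b 0) = z := by
  have h := b.orthonormal
  have h10 : inner ℝ (b 1) (b 0) = 0 := h.2 (by decide)
  have h20 : inner ℝ (b 2) (b 0) = 0 := h.2 (by decide)
  simp [inner_add_left, real_inner_smul_left, h10, h20]

theorem lintegral_cylindrical (H : ℝ → ℝ × ℝ → ℝ≥0∞) :
    ∫⁻ z : ℝ, ∫⁻ y : ℝ × ℝ, ENNReal.ofReal z * H z y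
      = ∫⁻ z in Set.Ioi (0 : ℝ), ∫⁻ y : ℝ × ℝ, ENNReal.ofReal z * H z y := by
  rw [← lintegral_indicator measurableSet_Ioi]
  refine lintegral_congr fun z => ?_
  by_cases hz : 0 < z
  · simp [hz]
  · simp [hz, ENNReal.ofReal_of_nonpos (not_lt.1 hz)]

theorem lintegral_polar_plane (f : ℝ × ℝ → ℝ≥0∞) (hf : Measurable f) :
    ∫⁻ y, f y = ∫⁻ ρ in Set.Ioi (0 : ℝ), ∫⁻ θ in Set.Ioo (-Real.pi) Real.pi,
      ENNReal.ofReal ρ * f (ρ * Real.cos θ, ρ * Real.sin θ) := by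
  rw [← lintegral_comp_polarCoord_symm, polarCoord_target, Measure.volume_eq_prod,
    ← Measure.prod_restrict, lintegral_prod]
  · rfl
  · have := continuous_polarCoord_symm.measurable
    exact (Measurable.mul (by fun_prop) (hf.comp this)).aemeasurable

/-- In cylindrical coordinates `z, ρ, θ` about an axis, interchanging `z` and `ρ` preserves
`z ρ dz dρ dθ` on the quarter plane. -/
theorem lintegral_swap_cylindrical (H H' : ℝ → ℝ × ℝ → ℝ≥0∞)
    (hH : Measurable (Function.uncurry H)) (hH' : Measurable (Function.uncurry H'))
    (h : ∀ z ρ θ : ℝ, 0 < z → 0 < ρ → H' z (ρ * Real.cos θ, ρ * Real.sin θ)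
      = H ρ (z * Real.cos θ, z * Real.sin θ)) :
    ∫⁻ z : ℝ, ∫⁻ y : ℝ × ℝ, ENNReal.ofReal z * H' z y
      = ∫⁻ z : ℝ, ∫⁻ y : ℝ × ℝ, ENNReal.ofReal z * H z y := by
  have key : ∀ G : ℝ → ℝ × ℝ → ℝ≥0∞, Measurable (Function.uncurry G) →
      ∫⁻ z : ℝ, ∫⁻ y : ℝ × ℝ, ENNReal.ofReal z * G z y
      = ∫⁻ z in Set.Ioi (0 : ℝ), ∫⁻ ρ in Set.Ioi (0 : ℝ), ∫⁻ θ in Set.Ioo (-Real.pi) Real.pi,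
        ENNReal.ofReal ρ * (ENNReal.ofReal z * G z (ρ * Real.cos θ, ρ * Real.sin θ)) := by
    intro G hG
    rw [lintegral_cylindrical]
    refine lintegral_congr fun z => ?_
    have hGz : Measurable (G z) := hG.comp measurable_prodMk_left
    rw [lintegral_polar_plane]
    exact Measurable.mul (by fun_prop) hGz
  rw [key H' hH', key H hH, lintegral_lintegral_swap]
  · refine setLIntegral_congr_fun measurableSet_Ioi fun ρ hρ => ?_
    refine setLIntegral_congr_fun measurableSet_Ioi fun z hz => ?_
    refine lintegral_congr fun θ => ?_
    rw [h z ρ θ hz hρ]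
    ring
  · refine Measurable.aemeasurable ?_
    refine Measurable.lintegral_prod_right'
      (f := fun p : (ℝ × ℝ) × ℝ => ENNReal.ofReal p.1.2 * (ENNReal.ofReal p.1.1 *
        H' p.1.1 (p.1.2 * Real.cos p.2, p.1.2 * Real.sin p.2))) ?_
    have : Measurable fun p : (ℝ × ℝ) × ℝ =>
        H' p.1.1 (p.1.2 * Real.cos p.2, p.1.2 * Real.sin p.2) :=
      hH'.comp (g := Function.uncurry H')
        (f := fun p : (ℝ × ℝ) × ℝ => (p.1.1, (p.1.2 * Real.cos p.2, p.1.2 * Real.sin p.2)))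
        (by fun_prop)
    fun_prop

/-! ### The symmetry of `(a · V)₊ da` that exchanges the two outgoing velocities. -/

/-- A function on the sphere is extended to space with degree zero and weighted by a radial profile.
Identities on the sphere thereby become identities of Lebesgue integrals, where Cartesian and
cylindrical coordinates are available. -/
theorem sphere_lift (e : Vel) (Θ : Vel → ℝ≥0∞) (hΘ : Measurable Θ) (q : ℝ → ℝ≥0∞)
    (hq : Measurable q) :
    ∫⁻ x, q ‖x‖ * ENNReal.ofReal (inner ℝ x e) * Θ (‖x‖⁻¹ • x)
      = (∫⁻ r in Set.Ioi (0 : ℝ), ENNReal.ofReal (r ^ 2) * (q r * ENNReal.ofReal r)) *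
        ∫⁻ a, ENNReal.ofReal (inner ℝ (a : Vel) e) * Θ a ∂(volume : Measure Vel).toSphere := by
  rw [lintegral_polar _ (by fun_prop), ← lintegral_const_mul _ (by fun_prop)]
  refine lintegral_congr fun a => ?_
  rw [← lintegral_mul_const _ (by fun_prop)]
  refine setLIntegral_congr_fun measurableSet_Ioi fun r hr => ?_
  have hr' : (0 : ℝ) < r := hr
  have ha : ‖(a : Vel)‖ = 1 := by simp
  rw [norm_smul, ha, mul_one, Real.norm_of_nonneg hr'.le, smul_smul, inv_mul_cancel₀ hr'.ne',
    one_smul, real_inner_smul_left, ENNReal.ofReal_mul hr'.le]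
  ring

/-- If `a` makes the angle `θ` with `e`, then `(a · e) a` and `e - (a · e) a` are antipodal on the
sphere with diameter `e`. The second point belongs to the angle `π/2 - θ` and the opposite azimuth,
and `cos θ sin θ dθ dε` is invariant under this change. After lifting to space, `θ ↦ π/2 - θ` is the
interchange of the height `z` and the radius `ρ`. -/
theorem sphere_swap_unit (e : Vel) (he : ‖e‖ = 1) (Ψ : Vel → ℝ≥0∞) (hΨ : Measurable Ψ) :
    ∫⁻ a, ENNReal.ofReal (inner ℝ (a : Vel) e) * Ψ (e - inner ℝ (a : Vel) e • (a : Vel))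
        ∂(volume : Measure Vel).toSphere
      = ∫⁻ a, ENNReal.ofReal (inner ℝ (a : Vel) e) * Ψ (inner ℝ (a : Vel) e • (a : Vel))
        ∂(volume : Measure Vel).toSphere := by
  obtain ⟨b, rfl⟩ := exists_basis_of_unit e he
  -- Any radial profile of nonzero finite mass `c` would do: the factor `c` is cancelled from both
  -- sides.
  set q : ℝ → ℝ≥0∞ := Set.indicator (Set.Ioo 1 2) 1 with hq
  have hqm : Measurable q := measurable_one.indicator measurableSet_Ioo
  set c := ∫⁻ r in Set.Ioi (0 : ℝ), ENNReal.ofReal (r ^ 2) * (q r * ENNReal.ofReal r) with hc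
  have hc' : c = ∫⁻ r in Set.Ioo (1 : ℝ) 2, ENNReal.ofReal (r ^ 2) * ENNReal.ofReal r := by
    rw [hc, ← lintegral_indicator measurableSet_Ioi, ← lintegral_indicator measurableSet_Ioo]
    refine lintegral_congr fun r => ?_
    by_cases hr : r ∈ Set.Ioo (1 : ℝ) 2
    · have : r ∈ Set.Ioi (0 : ℝ) := lt_trans one_pos hr.1
      simp [hr, this, q]
    · simp [hr, q]
  have hc0 : c ≠ 0 := by
    have : (1 : ℝ≥0∞) ≤ c := by
      rw [hc']
      calc (1 : ℝ≥0∞) = ∫⁻ r in Set.Ioo (1 : ℝ) 2, 1 := by simp; norm_num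
        _ ≤ _ := by
          refine setLIntegral_mono (by fun_prop) fun r hr => ?_
          rw [← ENNReal.ofReal_mul (by positivity), ← ENNReal.ofReal_one]
          exact ENNReal.ofReal_le_ofReal (by nlinarith [hr.1, sq_nonneg (r - 1)])
    exact (lt_of_lt_of_le one_pos this).ne'
  have hct : c ≠ ∞ := by
    have : c ≤ 8 := by
      rw [hc']
      calc _ ≤ ∫⁻ r in Set.Ioo (1 : ℝ) 2, 8 := by
            refine setLIntegral_mono (by fun_prop) fun r hr => ?_
            rw [← ENNReal.ofReal_mul (by positivity)]
            rw [show (8 : ℝ≥0∞) = ENNReal.ofReal 8 by simp]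
            refine ENNReal.ofReal_le_ofReal ?_
            have h1 := hr.1; have h2 := hr.2
            calc r ^ 2 * r ≤ 2 ^ 2 * 2 := by gcongr
              _ = 8 := by norm_num
        _ = 8 := by simp; norm_num
    exact ne_top_of_le_ne_top (by simp) this
  refine (ENNReal.mul_right_inj hc0 hct).1 ?_
  rw [hc, ← sphere_lift (b 0) (fun a => Ψ (b 0 - inner ℝ a (b 0) • a)) (by fun_prop) q hqm,
    ← sphere_lift (b 0) (fun a => Ψ (inner ℝ a (b 0) • a)) (by fun_prop) q hqm,
    lintegral_coords b _ (by fun_prop), lintegral_coords b _ (by fun_prop)]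
  have hn : ∀ z y₁ y₂ : ℝ, ‖z • b 0 + y₁ • b 1 + y₂ • b 2‖ = √(z ^ 2 + y₁ ^ 2 + y₂ ^ 2) := by
    intro z y₁ y₂
    rw [← norm_sq_coords b, Real.sqrt_sq (norm_nonneg _)]
  have hnn : ∀ z y₁ y₂ : ℝ, 0 ≤ z ^ 2 + y₁ ^ 2 + y₂ ^ 2 := by intros; positivity
  -- `H` is the right-hand integrand without the factor `z`. `H'` is the left-hand one with `y`
  -- replaced by `-y`: this half turn of the azimuth makes the interchange of `z` and `ρ` hold
  -- pointwise.
  let H : ℝ → ℝ × ℝ → ℝ≥0∞ := fun z y => q √(z ^ 2 + y.1 ^ 2 + y.2 ^ 2) *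
    Ψ ((z / (z ^ 2 + y.1 ^ 2 + y.2 ^ 2)) • (z • b 0 + y.1 • b 1 + y.2 • b 2))
  let H' : ℝ → ℝ × ℝ → ℝ≥0∞ := fun z y => q √(z ^ 2 + y.1 ^ 2 + y.2 ^ 2) *
    Ψ (b 0 - (z / (z ^ 2 + y.1 ^ 2 + y.2 ^ 2)) • (z • b 0 - y.1 • b 1 - y.2 • b 2))
  have hHm : Measurable (Function.uncurry H) := by
    simp only [H, Function.uncurry_def]; fun_prop
  have hHm' : Measurable (Function.uncurry H') := by
    simp only [H', Function.uncurry_def]; fun_prop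
  have key := lintegral_swap_cylindrical H H' hHm hHm' (by
    intro z ρ θ hz hρ
    have e1 : z ^ 2 + (ρ * Real.cos θ) ^ 2 + (ρ * Real.sin θ) ^ 2 = z ^ 2 + ρ ^ 2 := by
      linear_combination ρ ^ 2 * Real.cos_sq_add_sin_sq θ
    have e2 : ρ ^ 2 + (z * Real.cos θ) ^ 2 + (z * Real.sin θ) ^ 2 = z ^ 2 + ρ ^ 2 := by
      linear_combination z ^ 2 * Real.cos_sq_add_sin_sq θ
    simp only [H, H', e1, e2]
    congr 2
    have hne : z ^ 2 + ρ ^ 2 ≠ 0 := by positivity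
    have e3 : b 0 = ((z ^ 2 + ρ ^ 2) / (z ^ 2 + ρ ^ 2)) • b 0 := by rw [div_self hne, one_smul]
    conv_lhs => rw [e3]
    match_scalars <;> (simp; try field_simp; try ring))
  have r1 : ∀ z : ℝ, ∫⁻ y : ℝ × ℝ, ENNReal.ofReal z * H' z y
      = ∫⁻ y : ℝ × ℝ, ENNReal.ofReal z * H' z (-y) := fun z =>
    (((Measure.measurePreserving_neg (volume : Measure (ℝ × ℝ))).lintegral_comp
      ((hHm'.comp measurable_prodMk_left).const_mul (ENNReal.ofReal z)))).symm
  calc _ = ∫⁻ z : ℝ, ∫⁻ y : ℝ × ℝ, ENNReal.ofReal z * H' z y := by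
        refine lintegral_congr fun z => ?_
        rw [r1]
        refine lintegral_congr fun y => ?_
        rw [inner_coords, hn]
        simp only [H', Prod.fst_neg, Prod.snd_neg, neg_sq, neg_smul, sub_neg_eq_add]
        rw [real_inner_smul_left, inner_coords, smul_smul,
          show (√(z ^ 2 + y.1 ^ 2 + y.2 ^ 2))⁻¹ * z * (√(z ^ 2 + y.1 ^ 2 + y.2 ^ 2))⁻¹
            = z / (z ^ 2 + y.1 ^ 2 + y.2 ^ 2) by
            conv_rhs => rw [← Real.sq_sqrt (hnn z y.1 y.2)]
            rw [div_eq_mul_inv]; ring]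
        ring
    _ = ∫⁻ z : ℝ, ∫⁻ y : ℝ × ℝ, ENNReal.ofReal z * H z y := key
    _ = _ := by
        refine lintegral_congr fun z => ?_
        refine lintegral_congr fun y => ?_
        rw [inner_coords, hn]
        simp only [H]
        rw [real_inner_smul_left, inner_coords, smul_smul,
          show (√(z ^ 2 + y.1 ^ 2 + y.2 ^ 2))⁻¹ * z * (√(z ^ 2 + y.1 ^ 2 + y.2 ^ 2))⁻¹
            = z / (z ^ 2 + y.1 ^ 2 + y.2 ^ 2) by
            conv_rhs => rw [← Real.sq_sqrt (hnn z y.1 y.2)]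
            rw [div_eq_mul_inv]; ring]
        ring

/-- The reflection `u = (a · V) a ↔ V - u` on the sphere of diameter `V` preserves the image of
`(a · V) da`. -/
theorem sphere_swap (V : Vel) (Ψ : Vel → ℝ≥0∞) (hΨ : Measurable Ψ) :
    ∫⁻ a, ENNReal.ofReal (inner ℝ (a : Vel) V) * Ψ (V - inner ℝ (a : Vel) V • (a : Vel))
        ∂(volume : Measure Vel).toSphere
      = ∫⁻ a, ENNReal.ofReal (inner ℝ (a : Vel) V) * Ψ (inner ℝ (a : Vel) V • (a : Vel))
        ∂(volume : Measure Vel).toSphere := by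
  rcases eq_or_ne V 0 with rfl | hV
  · simp
  have hV' : 0 < ‖V‖ := norm_pos_iff.2 hV
  have hVe : V = ‖V‖ • (‖V‖⁻¹ • V) := by rw [smul_smul, mul_inv_cancel₀ hV'.ne', one_smul]
  set e := ‖V‖⁻¹ • V with he
  have hen : ‖e‖ = 1 := by rw [he, norm_smul, norm_inv, norm_norm, inv_mul_cancel₀ hV'.ne']
  have := sphere_swap_unit e hen (fun x => Ψ (‖V‖ • x)) (by fun_prop)
  have h1 : ∀ a : Metric.sphere (0 : Vel) 1, inner ℝ (a : Vel) V = ‖V‖ * inner ℝ (a : Vel) e := by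
    intro a
    conv_lhs => rw [hVe]
    rw [real_inner_smul_right]
  simp only [h1, ENNReal.ofReal_mul hV'.le, mul_assoc]
  rw [lintegral_const_mul _ (by fun_prop), lintegral_const_mul _ (by fun_prop)]
  congr 1
  simp only [mul_smul]
  rw [← this]
  refine lintegral_congr fun a => ?_
  rw [smul_sub, ← hVe]

/-! ### One-dimensional Gaussian integrals with a singularity at the origin. -/

theorem lintegral_comp_abs (f : ℝ → ℝ≥0∞) :
    ∫⁻ t, f |t| = 2 * ∫⁻ t in Set.Ioi (0 : ℝ), f t := by
  rw [← lintegral_add_compl _ (measurableSet_Ioi (a := (0 : ℝ))), Set.compl_Ioi,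
    Measure.restrict_congr_set Iio_ae_eq_Iic.symm, two_mul]
  congr 1
  · exact setLIntegral_congr_fun measurableSet_Ioi fun t ht => by
      rw [abs_of_pos (show (0 : ℝ) < t from ht)]
  · have hp := (Measure.measurePreserving_neg (volume : Measure ℝ)).restrict_preimage
      (measurableSet_Ioi (a := (0 : ℝ)))
    have h2 := hp.lintegral_comp_emb (MeasurableEquiv.neg ℝ).measurableEmbedding f
    rw [← h2]
    simp only [Set.neg_preimage, Set.neg_Ioi, neg_zero]
    exact setLIntegral_congr_fun measurableSet_Iio fun t ht => by
      rw [abs_of_neg (show t < (0 : ℝ) from ht)]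

theorem lintegral_gaussian_lt_top {c : ℝ} (hc : 0 < c) :
    ∫⁻ t : ℝ, ENNReal.ofReal (Real.exp (-c * t ^ 2)) < ∞ := by
  have := (integrable_exp_neg_mul_sq hc).lintegral_lt_top
  exact this

theorem lintegral_rpow_Ioc_lt_top {s : ℝ} (hs : s < 1) :
    ∫⁻ t in Set.Ioc (0 : ℝ) 1, ‖t‖ₑ ^ (-s) < ∞ := by
  have h := intervalIntegral.intervalIntegrable_rpow' (a := 0) (b := 1) (r := -s) (by linarith)
  rw [intervalIntegrable_iff_integrableOn_Ioc_of_le zero_le_one] at h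
  have h2 := h.lintegral_lt_top
  refine lt_of_eq_of_lt (setLIntegral_congr_fun measurableSet_Ioc fun t ht => ?_) h2
  rw [Real.enorm_of_nonneg ht.1.le, ENNReal.ofReal_rpow_of_pos ht.1]

/-- Uniformity in the centre `p`: for `|t| ≤ 1` the Gaussian is at most `1` and leaves the
integrable power, while for `|t| > 1` the power is at most `1` and the Gaussian integral is
translation invariant. -/
theorem exists_gaussian_mul_rpow_bound {c s : ℝ} (hc : 0 < c) (hs0 : 0 ≤ s) (hs : s < 1) :
    ∃ J : ℝ≥0∞, J < ∞ ∧ ∀ p : ℝ,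
      ∫⁻ t : ℝ, ENNReal.ofReal (Real.exp (-c * (t - p) ^ 2)) * (1 + ‖t‖ₑ ^ (-s)) ≤ J := by
  refine ⟨2 * (∫⁻ t in Set.Ioc (0 : ℝ) 1, ‖t‖ₑ ^ (-s))
    + 2 * ∫⁻ t : ℝ, ENNReal.ofReal (Real.exp (-c * t ^ 2)), ?_, fun p => ?_⟩
  · have h1 := lintegral_rpow_Ioc_lt_top hs
    have h2 := lintegral_gaussian_lt_top hc
    exact ENNReal.add_lt_top.2 ⟨ENNReal.mul_lt_top ENNReal.ofNat_lt_top h1,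
      ENNReal.mul_lt_top ENNReal.ofNat_lt_top h2⟩
  -- The extended power may be infinite at `t = 0`; the indicator of the null set `{0}` with value
  -- `∞` covers that point.
  · have hb : ∀ t : ℝ, ENNReal.ofReal (Real.exp (-c * (t - p) ^ 2)) * (1 + ‖t‖ₑ ^ (-s))
        ≤ (Set.Ioc (0 : ℝ) 1).indicator (fun t => ‖t‖ₑ ^ (-s)) |t|
          + (Set.indicator {0} (fun _ => ∞) t
          + 2 * ENNReal.ofReal (Real.exp (-c * (t - p) ^ 2))) := by
      intro t
      have he : ENNReal.ofReal (Real.exp (-c * (t - p) ^ 2)) ≤ 1 := by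
        rw [ENNReal.ofReal_le_one, Real.exp_le_one_iff]
        have := mul_nonneg hc.le (sq_nonneg (t - p)); linarith
      rcases eq_or_ne t 0 with rfl | ht
      · simp
      by_cases h1 : |t| ≤ 1
      · have : |t| ∈ Set.Ioc (0 : ℝ) 1 := ⟨abs_pos.2 ht, h1⟩
        rw [Set.indicator_of_mem this, mul_add, mul_one, add_comm, ← Real.norm_eq_abs, enorm_norm]
        gcongr
        · exact mul_le_of_le_one_left (by positivity) he
        · refine le_add_left ?_
          rw [two_mul]; exact le_add_self
      · have h2 : ‖t‖ₑ ^ (-s) ≤ 1 := by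
          rw [ENNReal.rpow_neg, ENNReal.inv_le_one]
          refine (ENNReal.one_rpow s).symm.le.trans (ENNReal.rpow_le_rpow ?_ hs0)
          rw [Real.enorm_eq_ofReal_abs, ENNReal.one_le_ofReal]
          exact (not_le.1 h1).le
        refine le_add_left (le_add_left ?_)
        rw [mul_comm]
        gcongr
        calc 1 + ‖t‖ₑ ^ (-s) ≤ 1 + 1 := by gcongr
          _ = 2 := by norm_num
    refine (lintegral_mono hb).trans ?_
    have hA := lintegral_comp_abs ((Set.Ioc (0 : ℝ) 1).indicator (fun t => ‖t‖ₑ ^ (-s)))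
    rw [setLIntegral_indicator measurableSet_Ioc, Set.inter_eq_left.2 (fun t ht => ht.1)] at hA
    have hM : Measurable fun t : ℝ => (Set.Ioc (0 : ℝ) 1).indicator (fun t => ‖t‖ₑ ^ (-s)) |t| :=
      (Measurable.indicator (by fun_prop) measurableSet_Ioc).comp (measurable_id.norm)
    rw [lintegral_add_left hM, hA, lintegral_add_left
        (measurable_const.indicator (measurableSet_singleton _)),
      lintegral_indicator_const (measurableSet_singleton _), lintegral_const_mul _ (by fun_prop),
      lintegral_sub_right_eq_self (fun t => ENNReal.ofReal (Real.exp (-c * t ^ 2))) p]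
    simp

/-- For `0 < z ≤ x`, the inequality `exp(-t) ≤ 1/t` bounds the integrand by `1/(ν₀x)`, of total mass
`1/ν₀`. For `x < z ≤ 1` it is at most `1/z`, which integrates to at most `|ln x|`. For `z > max x 1`
the Gaussian suffices. -/
theorem exists_log_bound {ν₀ : ℝ} (hν : 0 < ν₀) :
    ∃ C : ℝ, 0 ≤ C ∧ ∀ x : ℝ, 0 < x →
      ∫⁻ z : ℝ, ENNReal.ofReal (Real.exp (-(1 / 8) * z ^ 2)
          * (|z|⁻¹ * Real.exp (-(ν₀ / |z|) * x)))
        ≤ ENNReal.ofReal (C * (|Real.log x| + 1)) := by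
  have hG := lintegral_gaussian_lt_top (c := 1 / 8) (by norm_num)
  set G := ∫⁻ z : ℝ, ENNReal.ofReal (Real.exp (-(1 / 8) * z ^ 2))
  refine ⟨2 * (1 / ν₀ + 1 + G.toReal), by positivity, fun x hx => ?_⟩
  have hev : ∀ z : ℝ, Real.exp (-(1 / 8) * z ^ 2) * (|z|⁻¹ * Real.exp (-(ν₀ / |z|) * x))
      = Real.exp (-(1 / 8) * |z| ^ 2) * (|z|⁻¹ * Real.exp (-(ν₀ / |z|) * x)) := by
    intro z; rw [sq_abs]
  simp_rw [hev]
  rw [lintegral_comp_abs (fun z => ENNReal.ofReal (Real.exp (-(1 / 8) * z ^ 2)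
          * (z⁻¹ * Real.exp (-(ν₀ / z) * x))))]
  have hb : ∀ z ∈ Set.Ioi (0 : ℝ), ENNReal.ofReal (Real.exp (-(1 / 8) * z ^ 2)
          * (z⁻¹ * Real.exp (-(ν₀ / z) * x))) ≤
      (Set.Ioc 0 x).indicator (fun _ => ENNReal.ofReal (1 / (ν₀ * x))) z
      + ((Set.Ioc x 1).indicator (fun z => ENNReal.ofReal z⁻¹) z
      + ENNReal.ofReal (Real.exp (-(1 / 8) * z ^ 2))) := by
    intro z hz
    have hz' : (0 : ℝ) < z := hz
    have hg : Real.exp (-(1 / 8) * z ^ 2) ≤ 1 := by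
      rw [Real.exp_le_one_iff]; nlinarith [sq_nonneg z]
    have hpos : 0 < ν₀ / z * x := by positivity
    have he1 : Real.exp (-(ν₀ / z) * x) ≤ 1 := by
      rw [Real.exp_le_one_iff]; linarith
    by_cases h1 : z ≤ x
    · rw [Set.indicator_of_mem (show z ∈ Set.Ioc 0 x from ⟨hz', h1⟩)]
      refine le_add_right (ENNReal.ofReal_le_ofReal ?_)
      have he : Real.exp (-(ν₀ / z) * x) ≤ 1 / (ν₀ / z * x) := by
        rw [neg_mul, Real.exp_neg, ← one_div]
        exact one_div_le_one_div_of_le hpos (by linarith [Real.add_one_le_exp (ν₀ / z * x)])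
      calc _ ≤ 1 * (z⁻¹ * (1 / (ν₀ / z * x))) := by gcongr
        _ = 1 / (ν₀ * x) := by field_simp
    · refine le_add_left ?_
      by_cases h2 : z ≤ 1
      · rw [Set.indicator_of_mem (show z ∈ Set.Ioc x 1 from ⟨not_le.1 h1, h2⟩)]
        refine le_add_right (ENNReal.ofReal_le_ofReal ?_)
        calc _ ≤ 1 * (z⁻¹ * 1) := by gcongr
          _ = z⁻¹ := by ring
      · refine le_add_left (ENNReal.ofReal_le_ofReal ?_)
        calc _ ≤ Real.exp (-(1 / 8) * z ^ 2) * (1 * 1) := by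
              gcongr
              exact inv_le_one_of_one_le₀ (not_le.1 h2).le
          _ = _ := by ring
  have hlog : ∫⁻ z in Set.Ioc x 1, ENNReal.ofReal z⁻¹ ≤ ENNReal.ofReal |Real.log x| := by
    rcases le_or_gt 1 x with h1 | h1
    · rw [Set.Ioc_eq_empty (not_lt.2 h1)]; simp
    · have hi : IntervalIntegrable (fun z : ℝ => z⁻¹) volume x 1 := by
        refine (ContinuousOn.inv₀ continuousOn_id fun z hz => ?_).intervalIntegrable
        rw [Set.uIcc_of_le h1.le] at hz
        exact (lt_of_lt_of_le hx hz.1).ne'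
      rw [intervalIntegrable_iff_integrableOn_Ioc_of_le h1.le] at hi
      rw [← ofReal_integral_eq_lintegral_ofReal hi, ← intervalIntegral.integral_of_le h1.le,
        integral_inv_of_pos hx one_pos, one_div, Real.log_inv]
      · exact ENNReal.ofReal_le_ofReal (neg_le_abs _)
      · filter_upwards [ae_restrict_mem measurableSet_Ioc] with z hz
        exact inv_nonneg.2 (hx.trans hz.1).le
  have hsub : Set.Ioc x 1 ⊆ Set.Ioi 0 := fun z hz => hx.trans hz.1
  calc _ ≤ 2 * (ENNReal.ofReal (1 / ν₀) + (ENNReal.ofReal |Real.log x| + G)) := by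
        gcongr
        refine (setLIntegral_mono (by
          refine Measurable.add (measurable_const.indicator measurableSet_Ioc)
            (Measurable.add (Measurable.indicator (by fun_prop) measurableSet_Ioc)
              (by fun_prop))) hb).trans ?_
        rw [lintegral_add_left (measurable_const.indicator measurableSet_Ioc),
          lintegral_add_left (Measurable.indicator (by fun_prop) measurableSet_Ioc),
          setLIntegral_indicator measurableSet_Ioc, setLIntegral_indicator measurableSet_Ioc,
          Set.inter_eq_left.2 (fun t ht => ht.1), Set.inter_eq_left.2 hsub]
        gcongr
        · rw [setLIntegral_const, Real.volume_Ioc, sub_zero, ← ENNReal.ofReal_mul (by positivity)]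
          refine ENNReal.ofReal_le_ofReal (le_of_eq ?_)
          field_simp
        · exact setLIntegral_le_lintegral _ _
    _ = ENNReal.ofReal (2 * (1 / ν₀ + (|Real.log x| + G.toReal))) := by
        rw [ENNReal.ofReal_mul (by norm_num), ENNReal.ofReal_add (by positivity) (by positivity),
          ENNReal.ofReal_add (by positivity) (by positivity), ENNReal.ofReal_toReal hG.ne]
        simp
    _ ≤ _ := by
        refine ENNReal.ofReal_le_ofReal ?_
        have h1 : 0 ≤ 1 / ν₀ * |Real.log x| := by positivity
        have h2 : 0 ≤ G.toReal * |Real.log x| := by positivity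
        nlinarith [abs_nonneg (Real.log x)]

/-! ### Grad's bound for the kernel of `K`. -/

theorem maxwellian_pos (ζ : Vel) : 0 < maxwellian ζ := by
  have := Real.pi_pos
  unfold maxwellian; positivity

@[fun_prop]
theorem measurable_maxwellian : Measurable maxwellian := by
  unfold maxwellian; fun_prop

theorem sqrt_maxwellian_le (ζ : Vel) : √(maxwellian ζ) ≤ Real.exp (-‖ζ‖ ^ 2 / 2) := by
  have h1 : (1 : ℝ) ≤ √Real.pi ^ 3 :=
    one_le_pow₀ (Real.one_le_sqrt.2 (by linarith [Real.pi_gt_three]))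
  have h2 : maxwellian ζ ≤ Real.exp (-‖ζ‖ ^ 2) :=
    mul_le_of_le_one_left (Real.exp_pos _).le (inv_le_one_of_one_le₀ h1)
  refine (Real.sqrt_le_sqrt h2).trans (le_of_eq ?_)
  rw [Real.exp_half]

/-- Up to a constant, the density `(a · V)₊ (1 + |V|⁻¹)` dominates every cut-off cross-section with
exponent in `(0, 1]`. -/
def hemiDensity (V a : Vel) : ℝ≥0∞ := ENNReal.ofReal (inner ℝ a V) * (1 + ‖V‖ₑ⁻¹)

/-- The majorant of the integrand of `K(f)(ζ)` when `|f| ≤ F`. -/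
def gainMajorant (F : Vel → ℝ≥0∞) (ζ : Vel) (p : Vel × Metric.sphere (0 : Vel) 1) : ℝ≥0∞ :=
  hemiDensity (p.1 - ζ) p.2 * (ENNReal.ofReal √(maxwellian p.1) *
    (ENNReal.ofReal √(maxwellian (post ζ p.1 p.2)) * F (postStar ζ p.1 p.2)
      + ENNReal.ofReal √(maxwellian (postStar ζ p.1 p.2)) * F (post ζ p.1 p.2)
      + ENNReal.ofReal √(maxwellian ζ) * F p.1))

/-- The singular Gaussian kernel `|u|⁻¹ exp(-|u|²/8)`. -/
def gradKernel (u : Vel) : ℝ≥0∞ := ‖u‖ₑ⁻¹ * ENNReal.ofReal (Real.exp (-(1 / 8) * ‖u‖ ^ 2))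

@[fun_prop]
theorem measurable_gradKernel : Measurable gradKernel := by
  unfold gradKernel; fun_prop

/-- Integration over collisions with fixed `a` leaves the weight `r`, whereas the polar Jacobian is
`r²`. The quotient is the singularity `|u|⁻¹` of the kernel. -/
theorem lintegral_gradKernel_mul (F : Vel → ℝ≥0∞) (hF : Measurable F) (ζ : Vel) :
    ∫⁻ a, (∫⁻ r in Set.Ioi (0 : ℝ), ENNReal.ofReal r * (ENNReal.ofReal (Real.exp (-(1 / 8) * r ^ 2))
        * F (ζ + r • (a : Vel)))) ∂(volume : Measure Vel).toSphere
      = ∫⁻ u, gradKernel u * F (ζ + u) := by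
  rw [lintegral_polar _ (by fun_prop)]
  refine lintegral_congr fun a => setLIntegral_congr_fun measurableSet_Ioi fun r hr => ?_
  have hr' : (0 : ℝ) < r := hr
  have ha : ‖(a : Vel)‖ = 1 := by simp
  have ha' : ‖(a : Vel)‖ₑ = 1 := by rw [← ofReal_norm, ha, ENNReal.ofReal_one]
  have e1 : ENNReal.ofReal (r ^ 2) * (ENNReal.ofReal r)⁻¹ = ENNReal.ofReal r := by
    rw [← ENNReal.ofReal_inv_of_pos hr', ← ENNReal.ofReal_mul (by positivity)]
    congr 1; field_simp
  simp only [gradKernel]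
  rw [norm_smul, ha, mul_one, Real.norm_of_nonneg hr'.le, enorm_smul, ha', mul_one,
    Real.enorm_of_nonneg hr'.le]
  conv_lhs => rw [← e1]
  ring

/-- Since `(z + r)² + z² ≥ r²/2`, decay in the increment `r` remains whatever the longitudinal
component `z` is. The two transverse half-Gaussians combine into a full one. -/
theorem exp_coords_le (z z₁ z₂ r y₁ y₂ : ℝ) :
    Real.exp (-((z + r) ^ 2 + (z₁ + y₁) ^ 2 + (z₂ + y₂) ^ 2) / 2)
      * Real.exp (-(z ^ 2 + (z₁ + y₁) ^ 2 + (z₂ + y₂) ^ 2) / 2)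
      ≤ Real.exp (-(1 / 8) * r ^ 2) * (Real.exp (-1 * (y₁ - -z₁) ^ 2)
        * Real.exp (-1 * (y₂ - -z₂) ^ 2)) := by
  rw [← Real.exp_add, ← Real.exp_add, ← Real.exp_add, Real.exp_le_exp]
  nlinarith [sq_nonneg (2 * z + r), sq_nonneg r]

/-- From `|V|² ≥ |y₁||y₂|`, the singularity `|V|⁻¹` is shared between the transverse coordinates as
two powers `-1/2`. The transverse integral then factors into one-dimensional convergent ones. -/
theorem inv_enorm_coords_le (b : OrthonormalBasis (Fin 3) ℝ Vel) (z y₁ y₂ : ℝ) :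
    1 + ‖z • b 0 + y₁ • b 1 + y₂ • b 2‖ₑ⁻¹
      ≤ (1 + ‖y₁‖ₑ ^ (-(1 / 2) : ℝ)) * (1 + ‖y₂‖ₑ ^ (-(1 / 2) : ℝ)) := by
  have h1 : ‖y₁‖ₑ ^ (1 / 2 : ℝ) * ‖y₂‖ₑ ^ (1 / 2 : ℝ) ≤ ‖z • b 0 + y₁ • b 1 + y₂ • b 2‖ₑ := by
    rw [← ENNReal.mul_rpow_of_nonneg _ _ (by norm_num), ← enorm_mul, ← ofReal_norm,
      ← ofReal_norm, ENNReal.ofReal_rpow_of_nonneg (norm_nonneg _) (by norm_num),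
      ← Real.sqrt_eq_rpow]
    refine ENNReal.ofReal_le_ofReal ?_
    rw [Real.sqrt_le_left (norm_nonneg _), norm_sq_coords, Real.norm_eq_abs, abs_mul]
    nlinarith [sq_nonneg (|y₁| - |y₂|), sq_abs y₁, sq_abs y₂, sq_nonneg z, sq_nonneg y₁,
      sq_nonneg y₂]
  have h2 : ‖z • b 0 + y₁ • b 1 + y₂ • b 2‖ₑ⁻¹
      ≤ ‖y₁‖ₑ ^ (-(1 / 2) : ℝ) * ‖y₂‖ₑ ^ (-(1 / 2) : ℝ) := by
    rw [ENNReal.rpow_neg, ENNReal.rpow_neg, ← ENNReal.mul_inv]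
    · exact ENNReal.inv_le_inv.2 h1
    · right; exact ENNReal.rpow_ne_top_of_nonneg (by norm_num) enorm_ne_top
    · left; exact ENNReal.rpow_ne_top_of_nonneg (by norm_num) enorm_ne_top
  calc _ ≤ 1 + ‖y₁‖ₑ ^ (-(1 / 2) : ℝ) * ‖y₂‖ₑ ^ (-(1 / 2) : ℝ) := by gcongr
    _ ≤ 1 + ‖y₁‖ₑ ^ (-(1 / 2) : ℝ) * ‖y₂‖ₑ ^ (-(1 / 2) : ℝ)
        + (‖y₁‖ₑ ^ (-(1 / 2) : ℝ) + ‖y₂‖ₑ ^ (-(1 / 2) : ℝ)) := le_self_add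
    _ = _ := by ring

/-- With `V = r a + y` and `y ⊥ a`, the argument of `F` depends on `r` only. The Maxwellians are
evaluated at `ζ + r a + y` and `ζ + y`, so the transverse integral is bounded uniformly in `ζ`. -/
theorem lintegral_fiber_le {J : ℝ≥0∞} (hJ : ∀ p : ℝ, ∫⁻ t : ℝ,
      ENNReal.ofReal (Real.exp (-1 * (t - p) ^ 2)) * (1 + ‖t‖ₑ ^ (-(1 / 2) : ℝ)) ≤ J)
    (F : Vel → ℝ≥0∞) (hF : Measurable F) (ζ a : Vel) (ha : ‖a‖ = 1) :
    ∫⁻ V : Vel, hemiDensity V a * (ENNReal.ofReal √(maxwellian (ζ + V)) *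
        (ENNReal.ofReal √(maxwellian (ζ + V - inner ℝ a V • a)) * F (ζ + inner ℝ a V • a)))
      ≤ J ^ 2 * ∫⁻ r in Set.Ioi (0 : ℝ), ENNReal.ofReal r *
          (ENNReal.ofReal (Real.exp (-(1 / 8) * r ^ 2)) * F (ζ + r • a)) := by
  obtain ⟨b, rfl⟩ := exists_basis_of_unit a ha
  have hm : Measurable fun V => hemiDensity V (b 0) := by
    unfold hemiDensity; fun_prop
  rw [lintegral_coords b _ (by fun_prop), ← lintegral_const_mul _ (by fun_prop),
    ← lintegral_indicator measurableSet_Ioi]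
  refine lintegral_mono fun r => ?_
  by_cases hr : r ∈ Set.Ioi (0 : ℝ)
  swap
  · have : ∀ y : ℝ × ℝ, hemiDensity (r • b 0 + y.1 • b 1 + y.2 • b 2) (b 0) = 0 := by
      intro y
      rw [hemiDensity, real_inner_comm, inner_coords, ENNReal.ofReal_of_nonpos (not_lt.1 hr),
        zero_mul]
    simp [this]
  rw [Set.indicator_of_mem hr]
  set g : ℝ → ℝ → ℝ≥0∞ := fun p t => ENNReal.ofReal (Real.exp (-1 * (t - p) ^ 2))
    * (1 + ‖t‖ₑ ^ (-(1 / 2) : ℝ)) with hg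
  obtain ⟨z, z₁, z₂, hz⟩ : ∃ z z₁ z₂ : ℝ, ζ = z • b 0 + z₁ • b 1 + z₂ • b 2 :=
    ⟨_, _, _, by rw [← b.sum_repr ζ, Fin.sum_univ_three]⟩
  have hpt : ∀ y : ℝ × ℝ, hemiDensity (r • b 0 + y.1 • b 1 + y.2 • b 2) (b 0) *
      (ENNReal.ofReal √(maxwellian (ζ + (r • b 0 + y.1 • b 1 + y.2 • b 2))) *
        (ENNReal.ofReal √(maxwellian (ζ + (r • b 0 + y.1 • b 1 + y.2 • b 2)
          - inner ℝ (b 0) (r • b 0 + y.1 • b 1 + y.2 • b 2) • b 0))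
          * F (ζ + inner ℝ (b 0) (r • b 0 + y.1 • b 1 + y.2 • b 2) • b 0)))
      ≤ ENNReal.ofReal r * (ENNReal.ofReal (Real.exp (-(1 / 8) * r ^ 2)) * F (ζ + r • b 0)) *
        (g (-z₁) y.1 * g (-z₂) y.2) := by
    rintro ⟨y₁, y₂⟩
    simp only
    rw [hemiDensity, real_inner_comm, inner_coords]
    have e1 : ζ + (r • b 0 + y₁ • b 1 + y₂ • b 2)
        = (z + r) • b 0 + (z₁ + y₁) • b 1 + (z₂ + y₂) • b 2 := by rw [hz]; module
    have e2 : ζ + (r • b 0 + y₁ • b 1 + y₂ • b 2) - r • b 0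
        = z • b 0 + (z₁ + y₁) • b 1 + (z₂ + y₂) • b 2 := by rw [hz]; module
    have hexp : ENNReal.ofReal √(maxwellian (ζ + (r • b 0 + y₁ • b 1 + y₂ • b 2)))
        * ENNReal.ofReal √(maxwellian (ζ + (r • b 0 + y₁ • b 1 + y₂ • b 2) - r • b 0))
        ≤ ENNReal.ofReal (Real.exp (-(1 / 8) * r ^ 2))
          * (ENNReal.ofReal (Real.exp (-1 * (y₁ - -z₁) ^ 2))
            * ENNReal.ofReal (Real.exp (-1 * (y₂ - -z₂) ^ 2))) := by
      rw [← ENNReal.ofReal_mul (by positivity), ← ENNReal.ofReal_mul (by positivity),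
        ← ENNReal.ofReal_mul (by positivity)]
      refine ENNReal.ofReal_le_ofReal (le_trans ?_ (exp_coords_le z z₁ z₂ r y₁ y₂))
      rw [e2, e1]
      refine mul_le_mul ((sqrt_maxwellian_le _).trans ?_) ((sqrt_maxwellian_le _).trans ?_)
        (by positivity) (by positivity) <;> rw [norm_sq_coords]
    calc _ = ENNReal.ofReal r * F (ζ + r • b 0) * (1 + ‖r • b 0 + y₁ • b 1 + y₂ • b 2‖ₑ⁻¹) *
          (ENNReal.ofReal √(maxwellian (ζ + (r • b 0 + y₁ • b 1 + y₂ • b 2)))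
          * ENNReal.ofReal √(maxwellian (ζ + (r • b 0 + y₁ • b 1 + y₂ • b 2) - r • b 0))) := by
          ring
      _ ≤ ENNReal.ofReal r * F (ζ + r • b 0) *
          ((1 + ‖y₁‖ₑ ^ (-(1 / 2) : ℝ)) * (1 + ‖y₂‖ₑ ^ (-(1 / 2) : ℝ))) *
          (ENNReal.ofReal (Real.exp (-(1 / 8) * r ^ 2))
          * (ENNReal.ofReal (Real.exp (-1 * (y₁ - -z₁) ^ 2))
            * ENNReal.ofReal (Real.exp (-1 * (y₂ - -z₂) ^ 2)))) := by
          gcongr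
          exact inv_enorm_coords_le b r y₁ y₂
      _ = _ := by simp only [hg]; ring
  refine (lintegral_mono hpt).trans ?_
  rw [lintegral_const_mul _ (by fun_prop), Measure.volume_eq_prod,
    lintegral_prod_mul (f := g (-z₁)) (g := g (-z₂)) (by fun_prop) (by fun_prop), mul_comm, pow_two J]
  exact mul_le_mul_left (mul_le_mul' (hJ _) (hJ _)) _

/-- Half of the exponent pays for `(|V| + 1)|V|`, leaving the kernel itself; this serves the loss
term. -/
theorem enorm_mul_hemiDensity_le (V : Vel) :
    (‖V‖ₑ + 1) * ENNReal.ofReal (Real.exp (-(1 / 4) * ‖V‖ ^ 2)) ≤ 16 * gradKernel V := by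
  rcases eq_or_ne V 0 with rfl | hV
  · simp [gradKernel]
  have hV' : 0 < ‖V‖ := norm_pos_iff.2 hV
  rw [gradKernel, ← ofReal_norm, ← ENNReal.ofReal_inv_of_pos hV',
    ← ENNReal.ofReal_mul (by positivity), ← ENNReal.ofReal_one, ← ENNReal.ofReal_add hV'.le one_pos.le,
    ← ENNReal.ofReal_mul (by positivity), show (16 : ℝ≥0∞) = ENNReal.ofReal 16 by simp,
    ← ENNReal.ofReal_mul (by positivity)]
  refine ENNReal.ofReal_le_ofReal ?_
  have e1 : Real.exp (-(1 / 4) * ‖V‖ ^ 2)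
      = Real.exp (-(1 / 8) * ‖V‖ ^ 2) * Real.exp (-(1 / 8) * ‖V‖ ^ 2) := by
    rw [← Real.exp_add]; congr 1; ring
  have e2 : (‖V‖ + 1) * ‖V‖ * Real.exp (-(1 / 8) * ‖V‖ ^ 2) ≤ 16 := by
    have := Real.add_one_le_exp ((1 / 8) * ‖V‖ ^ 2)
    have e3 : Real.exp (-(1 / 8) * ‖V‖ ^ 2) * Real.exp ((1 / 8) * ‖V‖ ^ 2) = 1 := by
      rw [← Real.exp_add, ← Real.exp_zero]; congr 1; ring
    calc (‖V‖ + 1) * ‖V‖ * Real.exp (-(1 / 8) * ‖V‖ ^ 2)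
        ≤ (16 * Real.exp ((1 / 8) * ‖V‖ ^ 2)) * Real.exp (-(1 / 8) * ‖V‖ ^ 2) := by
          refine mul_le_mul_of_nonneg_right ?_ (Real.exp_pos _).le
          nlinarith [sq_nonneg (‖V‖ - 1)]
      _ = 16 := by rw [mul_assoc, mul_comm (Real.exp _), e3, mul_one]
  calc (‖V‖ + 1) * Real.exp (-(1 / 4) * ‖V‖ ^ 2)
      = ((‖V‖ + 1) * ‖V‖ * Real.exp (-(1 / 8) * ‖V‖ ^ 2))
        * (‖V‖⁻¹ * Real.exp (-(1 / 8) * ‖V‖ ^ 2)) := by rw [e1]; field_simp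
    _ ≤ _ := by gcongr

theorem hemiDensity_le (V a : Vel) (ha : ‖a‖ = 1) : hemiDensity V a ≤ ‖V‖ₑ + 1 := by
  rcases eq_or_ne V 0 with rfl | hV
  · simp [hemiDensity]
  have h1 : ENNReal.ofReal (inner ℝ a V) ≤ ‖V‖ₑ := by
    rw [← ofReal_norm]
    refine ENNReal.ofReal_le_ofReal ((real_inner_le_norm a V).trans ?_)
    rw [ha, one_mul]
  calc hemiDensity V a ≤ ‖V‖ₑ * (1 + ‖V‖ₑ⁻¹) := by unfold hemiDensity; gcongr
    _ = _ := by rw [mul_add, mul_one, ENNReal.mul_inv_cancel (by simpa using hV) enorm_ne_top]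

/-- The gain term with `F` at `ζ'` is integrated over `ζs` at fixed `a`, and `r a` is then read as
polar coordinates of the increment. The other gain term has the same integral, by the symmetry
exchanging `ζ'` and `ζ'_*`. The loss term is already a convolution in `V`. -/
theorem lintegral_gainMajorant_le : ∃ C : ℝ≥0∞, C < ∞ ∧ ∀ F : Vel → ℝ≥0∞, Measurable F → ∀ ζ : Vel,
    ∫⁻ p, gainMajorant F ζ p ∂((volume : Measure Vel).prod (volume : Measure Vel).toSphere)
      ≤ C * ∫⁻ u, gradKernel u * F (ζ + u) := by
  obtain ⟨J, hJt, hJ⟩ := exists_gaussian_mul_rpow_bound (c := 1) (s := 1 / 2) one_pos (by norm_num)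
    (by norm_num)
  set S := (volume : Measure Vel).toSphere Set.univ with hS
  have hSt : S < ∞ := measure_lt_top _ _
  refine ⟨J ^ 2 + J ^ 2 + S * 16, ?_, fun F hF ζ => ?_⟩
  · exact ENNReal.add_lt_top.2 ⟨ENNReal.add_lt_top.2 ⟨ENNReal.pow_lt_top hJt, ENNReal.pow_lt_top hJt⟩,
      ENNReal.mul_lt_top hSt (by simp)⟩
  set I := ∫⁻ u, gradKernel u * F (ζ + u) with hI
  have mh : Measurable fun p : Vel × Metric.sphere (0 : Vel) 1 => hemiDensity (p.1 - ζ) p.2 := by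
    unfold hemiDensity; fun_prop
  have mpost : Measurable fun p : Vel × Metric.sphere (0 : Vel) 1 => post ζ p.1 p.2 := by
    unfold post; fun_prop
  have mpostS : Measurable fun p : Vel × Metric.sphere (0 : Vel) 1 => postStar ζ p.1 p.2 := by
    unfold postStar; fun_prop
  set T₁ : Vel × Metric.sphere (0 : Vel) 1 → ℝ≥0∞ := fun p => hemiDensity (p.1 - ζ) p.2 *
    (ENNReal.ofReal √(maxwellian p.1) *
      (ENNReal.ofReal √(maxwellian (post ζ p.1 p.2)) * F (postStar ζ p.1 p.2)))
  set T₂ : Vel × Metric.sphere (0 : Vel) 1 → ℝ≥0∞ := fun p => hemiDensity (p.1 - ζ) p.2 *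
    (ENNReal.ofReal √(maxwellian p.1) *
      (ENNReal.ofReal √(maxwellian (postStar ζ p.1 p.2)) * F (post ζ p.1 p.2)))
  set T₃ : Vel × Metric.sphere (0 : Vel) 1 → ℝ≥0∞ := fun p => hemiDensity (p.1 - ζ) p.2 *
    (ENNReal.ofReal √(maxwellian p.1) * (ENNReal.ofReal √(maxwellian ζ) * F p.1))
  have mT₁ : Measurable T₁ := by
    have h1 := measurable_maxwellian.comp mpost
    have h2 := hF.comp mpostS
    simp only [Function.comp_def] at h1 h2
    simp only [T₁]
    fun_prop
  have mT₂ : Measurable T₂ := by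
    have h1 := measurable_maxwellian.comp mpostS
    have h2 := hF.comp mpost
    simp only [Function.comp_def] at h1 h2
    simp only [T₂]
    fun_prop
  have mT₃ : Measurable T₃ := by simp only [T₃]; fun_prop
  have hsum : ∀ p, gainMajorant F ζ p = T₁ p + T₂ p + T₃ p := by
    intro p; simp only [gainMajorant, T₁, T₂, T₃]; ring
  simp_rw [hsum]
  have b2 : ∫⁻ p, T₂ p ∂((volume : Measure Vel).prod (volume : Measure Vel).toSphere)
      ≤ J ^ 2 * I := by
    rw [lintegral_prod_symm' _ mT₂, hI, ← lintegral_gradKernel_mul F hF ζ,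
      ← lintegral_const_mul _ (by
        refine Measurable.lintegral_prod_right' (f := fun p : Metric.sphere (0 : Vel) 1 × ℝ =>
          ENNReal.ofReal p.2 * (ENNReal.ofReal (Real.exp (-(1 / 8) * p.2 ^ 2))
            * F (ζ + p.2 • (p.1 : Vel)))) ?_
        fun_prop)]
    refine lintegral_mono fun a => ?_
    rw [← lintegral_add_left_eq_self _ ζ]
    refine le_trans (le_of_eq (lintegral_congr fun V => ?_)) (lintegral_fiber_le hJ F hF ζ a (by simp))
    simp only [T₂, post, postStar, add_sub_cancel_left]
  -- At fixed `ζs`, replacing `u = (a · V) a` by `V - u` exchanges `ζ + u` with `ζs - u`, hence `T₁`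
  -- with `T₂`.
  have b1 : ∫⁻ p, T₁ p ∂((volume : Measure Vel).prod (volume : Measure Vel).toSphere)
      = ∫⁻ p, T₂ p ∂((volume : Measure Vel).prod (volume : Measure Vel).toSphere) := by
    rw [lintegral_prod _ mT₁.aemeasurable, lintegral_prod _ mT₂.aemeasurable]
    refine lintegral_congr fun ζs => ?_
    have hsw := sphere_swap (ζs - ζ)
      (fun x => ENNReal.ofReal √(maxwellian (ζs - x)) * F (ζ + x)) (by fun_prop)
    have e1 : ∀ a : Metric.sphere (0 : Vel) 1, T₁ (ζs, a)
        = ((1 + ‖ζs - ζ‖ₑ⁻¹) * ENNReal.ofReal √(maxwellian ζs)) *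
          (ENNReal.ofReal (inner ℝ (a : Vel) (ζs - ζ)) *
          (ENNReal.ofReal √(maxwellian (ζs - (ζs - ζ - inner ℝ (a : Vel) (ζs - ζ) • (a : Vel))))
            * F (ζ + (ζs - ζ - inner ℝ (a : Vel) (ζs - ζ) • (a : Vel))))) := by
      intro a
      simp only [T₁, hemiDensity, post, postStar]
      rw [show ζs - (ζs - ζ - inner ℝ (a : Vel) (ζs - ζ) • (a : Vel))
        = ζ + inner ℝ (a : Vel) (ζs - ζ) • (a : Vel) by abel,
        show ζ + (ζs - ζ - inner ℝ (a : Vel) (ζs - ζ) • (a : Vel))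
        = ζs - inner ℝ (a : Vel) (ζs - ζ) • (a : Vel) by abel]
      ring
    have e2 : ∀ a : Metric.sphere (0 : Vel) 1, T₂ (ζs, a)
        = ((1 + ‖ζs - ζ‖ₑ⁻¹) * ENNReal.ofReal √(maxwellian ζs)) *
          (ENNReal.ofReal (inner ℝ (a : Vel) (ζs - ζ)) *
          (ENNReal.ofReal √(maxwellian (ζs - inner ℝ (a : Vel) (ζs - ζ) • (a : Vel)))
            * F (ζ + inner ℝ (a : Vel) (ζs - ζ) • (a : Vel)))) := by
      intro a
      simp only [T₂, hemiDensity, post, postStar]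
      ring
    simp_rw [e1, e2]
    rw [lintegral_const_mul _ (by fun_prop), lintegral_const_mul _ (by fun_prop), hsw]
  have b3 : ∫⁻ p, T₃ p ∂((volume : Measure Vel).prod (volume : Measure Vel).toSphere)
      ≤ S * 16 * I := by
    rw [lintegral_prod_symm' _ mT₃]
    have : ∀ a : Metric.sphere (0 : Vel) 1, ∫⁻ ζs, T₃ (ζs, a) ≤ 16 * I := by
      intro a
      rw [← lintegral_add_left_eq_self _ ζ, hI, ← lintegral_const_mul _ (by fun_prop)]
      refine lintegral_mono fun V => ?_
      simp only [T₃, add_sub_cancel_left]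
      -- `|V| ≤ |ζ + V| + |ζ|` gives `|V|²/4 ≤ (|ζ + V|² + |ζ|²)/2`.
      have hexp : ENNReal.ofReal √(maxwellian (ζ + V)) * ENNReal.ofReal √(maxwellian ζ)
          ≤ ENNReal.ofReal (Real.exp (-(1 / 4) * ‖V‖ ^ 2)) := by
        rw [← ENNReal.ofReal_mul (by positivity)]
        refine ENNReal.ofReal_le_ofReal ((mul_le_mul (sqrt_maxwellian_le _) (sqrt_maxwellian_le _)
          (by positivity) (by positivity)).trans ?_)
        rw [← Real.exp_add, Real.exp_le_exp]
        have h1 : ‖V‖ ≤ ‖ζ + V‖ + ‖ζ‖ := by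
          calc ‖V‖ = ‖(ζ + V) - ζ‖ := by rw [add_sub_cancel_left]
            _ ≤ _ := norm_sub_le _ _
        nlinarith [sq_nonneg (‖ζ + V‖ - ‖ζ‖), norm_nonneg V, norm_nonneg ζ, norm_nonneg (ζ + V)]
      calc _ = hemiDensity V a * (ENNReal.ofReal √(maxwellian (ζ + V))
              * ENNReal.ofReal √(maxwellian ζ)) * F (ζ + V) := by ring
        _ ≤ (‖V‖ₑ + 1) * ENNReal.ofReal (Real.exp (-(1 / 4) * ‖V‖ ^ 2)) * F (ζ + V) := by
            gcongr
            exact hemiDensity_le V a (by simp)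
        _ ≤ 16 * gradKernel V * F (ζ + V) := by
            exact mul_le_mul_left (enorm_mul_hemiDensity_le V) _
        _ = _ := by ring
    refine (lintegral_mono this).trans ?_
    rw [lintegral_const, ← hS]
    exact le_of_eq (by ring)
  rw [lintegral_add_right _ mT₃, lintegral_add_right _ mT₂, b1]
  calc _ ≤ J ^ 2 * I + J ^ 2 * I + S * 16 * I := by gcongr
    _ = _ := by ring

/-! ### From the cut-off assumption to a pointwise bound for `K`. -/

@[fun_prop]
theorem measurable_crossDensity {B : ℝ → ℝ → ℝ} (hB : Measurable (Function.uncurry B)) :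
    Measurable fun q : Vel × Vel => crossDensity B q.1 q.2 := by
  unfold crossDensity
  have ha : Measurable fun q : Vel × Vel => InnerProductGeometry.angle q.2 q.1 := by
    unfold InnerProductGeometry.angle; fun_prop
  refine Measurable.ite (measurableSet_lt measurable_const (by fun_prop)) ?_ measurable_const
  exact (hB.comp (measurable_fst.norm.prodMk ha)).div (Real.measurable_sin.comp ha)

/-- The factor `sin θ` of the cut-off cancels the Jacobian of the sphere, and `|V| cos θ = a · V`.
Because `0 < γ ≤ 1`, `|V|^γ ≤ 1 + |V|`, which gives the factor `1 + |V|⁻¹` beside `a · V`. -/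
theorem enorm_crossDensity_le {B : ℝ → ℝ → ℝ} {γ : ℝ} (hγ0 : 0 < γ) (hγ1 : γ ≤ 1)
    (hB : IsGradCutoff B γ) :
    ∃ C : ℝ≥0∞, C < ∞ ∧ ∀ V a : Vel, ‖a‖ = 1 → ‖crossDensity B V a‖ₑ ≤ C * hemiDensity V a := by
  obtain ⟨C, hC⟩ := hB.bound
  refine ⟨ENNReal.ofReal |C|, ENNReal.ofReal_lt_top, fun V a ha => ?_⟩
  unfold crossDensity
  split_ifs with h
  swap
  · simp
  have hV : V ≠ 0 := by rintro rfl; simp at h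
  have hV' : 0 < ‖V‖ := norm_pos_iff.2 hV
  set θ := InnerProductGeometry.angle a V
  have hcos : Real.cos θ * ‖V‖ = inner ℝ a V := by
    have := InnerProductGeometry.cos_angle_mul_norm_mul_norm a V
    rwa [ha, one_mul] at this
  have hθ : θ ∈ Set.Icc 0 (Real.pi / 2) :=
    ⟨InnerProductGeometry.angle_nonneg _ _,
      Real.arccos_le_pi_div_two.2 (by positivity)⟩
  have hsin : 0 ≤ Real.sin θ :=
    Real.sin_nonneg_of_nonneg_of_le_pi hθ.1 (by linarith [hθ.2, Real.pi_pos])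
  have hcos0 : 0 ≤ Real.cos θ := by
    have : 0 < Real.cos θ * ‖V‖ := by rw [hcos]; exact h
    exact (pos_of_mul_pos_left this hV'.le).le
  rw [hemiDensity, ← ofReal_norm, ← ofReal_norm, ← ENNReal.ofReal_inv_of_pos hV',
    ← ENNReal.ofReal_one, ← ENNReal.ofReal_add one_pos.le (by positivity),
    ← ENNReal.ofReal_mul h.le, ← ENNReal.ofReal_mul (abs_nonneg _)]
  refine ENNReal.ofReal_le_ofReal ?_
  rw [Real.norm_of_nonneg (div_nonneg (hB.nonneg _ _ hV'.le hθ) hsin)]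
  -- For `a` parallel to `V`, `sin θ = 0` and the quotient has the value `0` by convention.
  rcases hsin.eq_or_lt with hs | hs
  · rw [← hs, div_zero]; positivity
  have hpow : ‖V‖ ^ γ ≤ 1 + ‖V‖ := by
    rcases le_total ‖V‖ 1 with h1 | h1
    · exact (Real.rpow_le_one hV'.le h1 hγ0.le).trans (by linarith)
    · calc ‖V‖ ^ γ ≤ ‖V‖ ^ (1 : ℝ) := Real.rpow_le_rpow_of_exponent_le h1 hγ1
        _ ≤ _ := by rw [Real.rpow_one]; linarith
  calc B ‖V‖ θ / Real.sin θ ≤ (C * ‖V‖ ^ γ * Real.cos θ * Real.sin θ) / Real.sin θ := by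
        gcongr; exact hC _ _ hV'.le hθ
    _ = C * (‖V‖ ^ γ * Real.cos θ) := by field_simp
    _ ≤ |C| * ((1 + ‖V‖) * Real.cos θ) := by gcongr; exact le_abs_self C
    _ = _ := by rw [← hcos]; field_simp; ring

theorem maxwellian_post_mul (ζ ζs a : Vel) (ha : ‖a‖ = 1) :
    maxwellian (post ζ ζs a) * maxwellian (postStar ζ ζs a) = maxwellian ζ * maxwellian ζs := by
  have h : ‖post ζ ζs a‖ ^ 2 + ‖postStar ζ ζs a‖ ^ 2 = ‖ζ‖ ^ 2 + ‖ζs‖ ^ 2 := by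
    unfold post postStar
    rw [norm_add_sq_real, norm_sub_sq_real, norm_smul, ha, real_inner_smul_right,
      real_inner_smul_right, inner_sub_right, real_inner_comm a ζ, real_inner_comm a ζs]
    simp only [Real.norm_eq_abs, mul_one, sq_abs]
    ring
  unfold maxwellian
  rw [mul_mul_mul_comm, ← Real.exp_add, mul_mul_mul_comm, ← Real.exp_add]
  congr 2
  linarith

/-- The integrand of `K(f)(ζ)`, simplified by the conservation of energy. -/
def kIntegrand (B : ℝ → ℝ → ℝ) (f : Vel → ℝ) (ζ : Vel) (p : Vel × Metric.sphere (0 : Vel) 1) : ℝ :=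
  crossDensity B (p.1 - ζ) p.2 * (√(maxwellian p.1) *
    (√(maxwellian (post ζ p.1 p.2)) * f (postStar ζ p.1 p.2)
      + √(maxwellian (postStar ζ p.1 p.2)) * f (post ζ p.1 p.2)
      - √(maxwellian ζ) * f p.1))

/-- The measure `dζs da` over which collisions are integrated. -/
abbrev collisionMeasure : Measure (Vel × Metric.sphere (0 : Vel) 1) :=
  (volume : Measure Vel).prod (volume : Measure Vel).toSphere

instance : SFinite collisionMeasure := Measure.prod.instSFinite

/-- Because `w' w'_* = w w_*`, the growing prefactor `w^(-1/2)` cancels one factor `w^(1/2)` of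
every term. -/
theorem collisionK_eq (B : ℝ → ℝ → ℝ) (f : Vel → ℝ) (ζ : Vel) :
    collisionK B f ζ = ∫ p, kIntegrand B f ζ p ∂collisionMeasure := by
  simp only [collisionK, collisionIntegral]
  rw [← integral_const_mul]
  refine integral_congr_ae (Filter.Eventually.of_forall fun p => ?_)
  simp only [kIntegrand]
  have hz := Real.sqrt_pos.2 (maxwellian_pos ζ)
  have hs : ∀ η, maxwellian η = √(maxwellian η) * √(maxwellian η) := fun η =>
    (Real.mul_self_sqrt (maxwellian_pos η).le).symm
  have h1 : √(maxwellian (post ζ p.1 p.2)) * √(maxwellian (postStar ζ p.1 p.2))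
      = √(maxwellian ζ) * √(maxwellian p.1) := by
    rw [← Real.sqrt_mul (maxwellian_pos _).le, maxwellian_post_mul _ _ _ (by simp),
      Real.sqrt_mul (maxwellian_pos _).le]
  set m := √(maxwellian ζ)
  set ms := √(maxwellian p.1)
  set m' := √(maxwellian (post ζ p.1 p.2)) with hm'
  set ms' := √(maxwellian (postStar ζ p.1 p.2)) with hms'
  rw [hs (post ζ p.1 p.2), hs (postStar ζ p.1 p.2), hs ζ, ← hm', ← hms']
  calc _ = m⁻¹ * ((m' * ms') * (m' * f (postStar ζ p.1 p.2) + ms' * f (post ζ p.1 p.2))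
          - m * m * (ms * f p.1)) * crossDensity B (p.1 - ζ) p.2 := by ring
    _ = _ := by rw [h1]; field_simp

theorem kIntegrand_sub (B : ℝ → ℝ → ℝ) (f g : Vel → ℝ) (ζ : Vel)
    (p : Vel × Metric.sphere (0 : Vel) 1) :
    kIntegrand B (fun η => f η - g η) ζ p = kIntegrand B f ζ p - kIntegrand B g ζ p := by
  simp only [kIntegrand]; ring

theorem measurable_gainMajorant {F : Vel → ℝ≥0∞} (hF : Measurable F) (ζ : Vel) :
    Measurable (gainMajorant F ζ) := by
  unfold gainMajorant hemiDensity post postStar; fun_prop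

theorem measurable_kIntegrand {B : ℝ → ℝ → ℝ} (hB : Measurable (Function.uncurry B))
    {T : Type*} [MeasurableSpace T] {f : T → Vel → ℝ} (hf : Measurable (Function.uncurry f)) :
    Measurable fun q : (T × Vel) × (Vel × Metric.sphere (0 : Vel) 1) =>
      kIntegrand B (f q.1.1) q.1.2 q.2 := by
  have hc : Measurable fun q : (T × Vel) × (Vel × Metric.sphere (0 : Vel) 1) =>
      crossDensity B (q.2.1 - q.1.2) q.2.2 :=
    (measurable_crossDensity hB).comp
      (f := fun q : (T × Vel) × (Vel × Metric.sphere (0 : Vel) 1) =>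
        (q.2.1 - q.1.2, (q.2.2 : Vel))) (by fun_prop)
  have hp : Measurable fun q : (T × Vel) × (Vel × Metric.sphere (0 : Vel) 1) =>
      post q.1.2 q.2.1 q.2.2 := by unfold post; fun_prop
  have hps : Measurable fun q : (T × Vel) × (Vel × Metric.sphere (0 : Vel) 1) =>
      postStar q.1.2 q.2.1 q.2.2 := by unfold postStar; fun_prop
  have h1 := hf.comp ((measurable_fst.comp measurable_fst).prodMk hp)
  have h2 := hf.comp ((measurable_fst.comp measurable_fst).prodMk hps)
  have h3 := hf.comp (((measurable_fst.comp measurable_fst).prodMk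
    (measurable_fst.comp measurable_snd)) :
    Measurable fun q : (T × Vel) × (Vel × Metric.sphere (0 : Vel) 1) => (q.1.1, q.2.1))
  have h4 := measurable_maxwellian.comp hp
  have h5 := measurable_maxwellian.comp hps
  simp only [Function.comp_def, Function.uncurry] at h1 h2 h3 h4 h5
  unfold kIntegrand
  fun_prop

theorem measurable_kIntegrand_slice {B : ℝ → ℝ → ℝ} (hB : Measurable (Function.uncurry B))
    {f : Vel → ℝ} (hf : Measurable f) (ζ : Vel) : Measurable (kIntegrand B f ζ) :=
  (measurable_kIntegrand hB (T := Unit) (f := fun _ => f) (hf.comp measurable_snd)).comp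
    (f := fun p => (((), ζ), p)) (by fun_prop)

theorem measurable_collisionK {B : ℝ → ℝ → ℝ} (hB : Measurable (Function.uncurry B))
    {T : Type*} [MeasurableSpace T] {f : T → Vel → ℝ} (hf : Measurable (Function.uncurry f)) :
    Measurable fun q : T × Vel => collisionK B (f q.1) q.2 := by
  simp_rw [collisionK_eq]
  exact (measurable_kIntegrand hB hf).stronglyMeasurable.integral_prod_right'.measurable

theorem enorm_kIntegrand_le {B : ℝ → ℝ → ℝ} {C : ℝ≥0∞}
    (hC : ∀ V a : Vel, ‖a‖ = 1 → ‖crossDensity B V a‖ₑ ≤ C * hemiDensity V a)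
    {f : Vel → ℝ} {F : Vel → ℝ≥0∞} (hf : ∀ η, ‖f η‖ₑ ≤ F η) (ζ : Vel)
    (p : Vel × Metric.sphere (0 : Vel) 1) :
    ‖kIntegrand B f ζ p‖ₑ ≤ C * gainMajorant F ζ p := by
  have hm : ∀ η, ‖√(maxwellian η)‖ₑ = ENNReal.ofReal √(maxwellian η) := fun η =>
    Real.enorm_of_nonneg (Real.sqrt_nonneg _)
  unfold kIntegrand gainMajorant
  rw [enorm_mul, enorm_mul, ← mul_assoc C, hm]
  refine mul_le_mul' (hC _ _ (by simp)) (mul_le_mul_right ?_ _)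
  refine (enorm_sub_le).trans (add_le_add ((enorm_add_le _ _).trans (add_le_add ?_ ?_)) ?_) <;>
  · rw [enorm_mul, hm]
    exact mul_le_mul_right (hf _) _

theorem gradKernel_convolution_mono {F G : Vel → ℝ≥0∞} (h : ∀ᵐ η, F η ≤ G η) (ζ : Vel) :
    ∫⁻ u, gradKernel u * F (ζ + u) ≤ ∫⁻ u, gradKernel u * G (ζ + u) := by
  refine lintegral_mono_ae ?_
  filter_upwards [(measurePreserving_add_left (volume : Measure Vel) ζ).quasiMeasurePreserving.ae h]
    with u hu
  exact mul_le_mul_right hu _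

/-- The kernel of `K` is dominated by `C |u|⁻¹ exp(-|u|²/8)`, `u` the increment of velocity. -/
theorem collisionK_bound {B : ℝ → ℝ → ℝ} {γ : ℝ} (hγ0 : 0 < γ) (hγ1 : γ ≤ 1)
    (hB : IsGradCutoff B γ) :
    ∃ C : ℝ≥0∞, C < ∞ ∧
      (∀ f g : Vel → ℝ, (∀ᵐ η, f η = g η) → ∀ ζ, kIntegrand B f ζ =ᵐ[collisionMeasure]
        kIntegrand B g ζ) ∧
      ∀ f : Vel → ℝ, AEStronglyMeasurable f volume → ∀ F : Vel → ℝ≥0∞, (∀ᵐ η, ‖f η‖ₑ ≤ F η) →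
        ∀ ζ, ∫⁻ u, gradKernel u * F (ζ + u) < ∞ →
          Integrable (kIntegrand B f ζ) collisionMeasure ∧
          ‖collisionK B f ζ‖ₑ ≤ C * ∫⁻ u, gradKernel u * F (ζ + u) := by
  obtain ⟨C₁, hC₁t, hC₁⟩ := enorm_crossDensity_le hγ0 hγ1 hB
  obtain ⟨C₂, hC₂t, hC₂⟩ := lintegral_gainMajorant_le
  have hae : ∀ f g : Vel → ℝ, (∀ᵐ η, f η = g η) → ∀ ζ, kIntegrand B f ζ =ᵐ[collisionMeasure]
        kIntegrand B g ζ := by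
    intro f g hfg ζ
    set N := toMeasurable volume {η | ¬ f η = g η} with hN
    have hN0 : volume N = 0 := by rw [hN, measure_toMeasurable]; exact hfg
    have hNm : MeasurableSet N := measurableSet_toMeasurable _ _
    -- A majorant equal to `∞` on a null set has zero convolution with the kernel, hence
    -- `gainMajorant` vanishes almost everywhere. Thus changing `f` on a null set does not affect
    -- the integrand almost everywhere, although it is evaluated at post-collisional velocities.
    set F : Vel → ℝ≥0∞ := N.indicator fun _ => ∞ with hF
    have hFm : Measurable F := measurable_const.indicator hNm
    have hle : ∀ η, ‖f η - g η‖ₑ ≤ F η := by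
      intro η
      by_cases h : f η = g η
      · simp [h]
      · have : η ∈ N := subset_toMeasurable _ _ h
        simp [hF, this]
    have h0 : ∫⁻ u, gradKernel u * F (ζ + u) = 0 := by
      have hz : ∀ᵐ η, F η ≤ (fun _ => (0 : ℝ≥0∞)) η := by
        have : ∀ᵐ η, η ∉ N := measure_eq_zero_iff_ae_notMem.1 hN0
        filter_upwards [this] with η hη
        simp [hF, hη]
      exact le_antisymm ((gradKernel_convolution_mono hz ζ).trans (by simp)) zero_le
    have h1 : ∫⁻ p, gainMajorant F ζ p ∂collisionMeasure = 0 :=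
      le_antisymm ((hC₂ F hFm ζ).trans (by rw [h0, mul_zero])) zero_le
    filter_upwards [(lintegral_eq_zero_iff (measurable_gainMajorant hFm ζ)).1 h1] with p hp
    have h2 := enorm_kIntegrand_le hC₁ hle ζ p
    rw [hp, Pi.zero_apply, mul_zero, kIntegrand_sub, nonpos_iff_eq_zero, enorm_eq_zero] at h2
    exact sub_eq_zero.1 h2
  refine ⟨C₁ * C₂, ENNReal.mul_lt_top hC₁t hC₂t, hae, fun f hf F hfF ζ hI => ?_⟩
  set f' := hf.mk f with hf'
  have hff' : ∀ᵐ η, f η = f' η := hf.ae_eq_mk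
  have hfm : Measurable f' := hf.stronglyMeasurable_mk.measurable
  have hk := hae f f' hff' ζ
  have hbd : ∫⁻ p, ‖kIntegrand B f' ζ p‖ₑ ∂collisionMeasure
      ≤ C₁ * C₂ * ∫⁻ u, gradKernel u * F (ζ + u) := by
    calc _ ≤ ∫⁻ p, C₁ * gainMajorant (fun η => ‖f' η‖ₑ) ζ p ∂collisionMeasure :=
          lintegral_mono fun p => enorm_kIntegrand_le hC₁ (fun _ => le_rfl) ζ p
      _ = C₁ * ∫⁻ p, gainMajorant (fun η => ‖f' η‖ₑ) ζ p ∂collisionMeasure :=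
          lintegral_const_mul _ (measurable_gainMajorant hfm.enorm ζ)
      _ ≤ C₁ * (C₂ * ∫⁻ u, gradKernel u * ‖f' (ζ + u)‖ₑ) := by
          gcongr; exact hC₂ _ hfm.enorm ζ
      _ ≤ C₁ * (C₂ * ∫⁻ u, gradKernel u * F (ζ + u)) := by
          refine mul_le_mul_right (mul_le_mul_right (gradKernel_convolution_mono
            (F := fun η => ‖f' η‖ₑ) ?_ ζ) _) _
          filter_upwards [hff', hfF] with η h1 h2
          rwa [← h1]
      _ = _ := by rw [mul_assoc]
  have hint : Integrable (kIntegrand B f' ζ) collisionMeasure :=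
    ⟨(measurable_kIntegrand_slice hB.measurable hfm ζ).aestronglyMeasurable,
      lt_of_le_of_lt hbd (ENNReal.mul_lt_top (ENNReal.mul_lt_top hC₁t hC₂t) hI)⟩
  refine ⟨hint.congr hk.symm, ?_⟩
  rw [collisionK_eq, integral_congr_ae hk]
  exact (enorm_integral_le_lintegral_enorm _).trans hbd

/-! ### Gaussian integrals over velocity space. -/

theorem lintegral_gaussian_mul_coord (c : ℝ) (g : ℝ → ℝ≥0∞) (hg : Measurable g) :
    ∫⁻ ζ : Vel, ENNReal.ofReal (Real.exp (-c * ‖ζ‖ ^ 2)) * g (ζ 0)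
      = (∫⁻ z : ℝ, ENNReal.ofReal (Real.exp (-c * z ^ 2)) * g z)
        * (∫⁻ z : ℝ, ENNReal.ofReal (Real.exp (-c * z ^ 2))) ^ 2 := by
  set b := EuclideanSpace.basisFun (Fin 3) ℝ
  have h0 : ∀ z y₁ y₂ : ℝ, (z • b 0 + y₁ • b 1 + y₂ • b 2) 0 = z := by
    intro z y₁ y₂; simp [b]
  rw [lintegral_coords b _ (by fun_prop)]
  have hpt : ∀ z : ℝ, ∀ y : ℝ × ℝ,
      ENNReal.ofReal (Real.exp (-c * ‖z • b 0 + y.1 • b 1 + y.2 • b 2‖ ^ 2))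
        * g ((z • b 0 + y.1 • b 1 + y.2 • b 2) 0)
      = (ENNReal.ofReal (Real.exp (-c * z ^ 2)) * g z) *
        (ENNReal.ofReal (Real.exp (-c * y.1 ^ 2)) * ENNReal.ofReal (Real.exp (-c * y.2 ^ 2))) := by
    intro z y
    rw [h0, norm_sq_coords, mul_add, mul_add, Real.exp_add, Real.exp_add,
      ENNReal.ofReal_mul (by positivity), ENNReal.ofReal_mul (by positivity)]
    ring
  simp_rw [hpt]
  have hm : Measurable fun t : ℝ => ENNReal.ofReal (Real.exp (-c * t ^ 2)) := by fun_prop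
  have hin : ∀ z : ℝ, ∫⁻ y : ℝ × ℝ, (ENNReal.ofReal (Real.exp (-c * z ^ 2)) * g z) *
        (ENNReal.ofReal (Real.exp (-c * y.1 ^ 2)) * ENNReal.ofReal (Real.exp (-c * y.2 ^ 2)))
      = (ENNReal.ofReal (Real.exp (-c * z ^ 2)) * g z) *
        (∫⁻ z : ℝ, ENNReal.ofReal (Real.exp (-c * z ^ 2))) ^ 2 := by
    intro z
    rw [lintegral_const_mul _ (by fun_prop), Measure.volume_eq_prod,
      lintegral_prod_mul hm.aemeasurable hm.aemeasurable, pow_two (∫⁻ _, _)]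
  simp_rw [hin]
  rw [lintegral_mul_const _ (by fun_prop)]

theorem lintegral_gaussian_vel_lt_top {c : ℝ} (hc : 0 < c) :
    ∫⁻ ζ : Vel, ENNReal.ofReal (Real.exp (-c * ‖ζ‖ ^ 2)) < ∞ := by
  have h := lintegral_gaussian_mul_coord c (fun _ => 1) measurable_const
  simp only [mul_one] at h
  rw [h]
  exact ENNReal.mul_lt_top (lintegral_gaussian_lt_top hc)
    (ENNReal.pow_lt_top (lintegral_gaussian_lt_top hc))

theorem lintegral_inv_sq_gaussian_lt_top :
    ∫⁻ u : Vel, (‖u‖ₑ⁻¹) ^ 2 * ENNReal.ofReal (Real.exp (-(1 / 8) * ‖u‖ ^ 2)) < ∞ := by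
  rw [lintegral_polar _ (by fun_prop)]
  have hG := lintegral_gaussian_lt_top (c := 1 / 8) (by norm_num)
  set G := ∫⁻ t : ℝ, ENNReal.ofReal (Real.exp (-(1 / 8) * t ^ 2))
  have : ∀ a : Metric.sphere (0 : Vel) 1, ∫⁻ r in Set.Ioi (0 : ℝ), ENNReal.ofReal (r ^ 2) *
      ((‖r • (a : Vel)‖ₑ⁻¹) ^ 2 * ENNReal.ofReal (Real.exp (-(1 / 8) * ‖r • (a : Vel)‖ ^ 2))) ≤ G := by
    intro a
    refine le_trans (le_of_eq (setLIntegral_congr_fun measurableSet_Ioi fun r hr => ?_))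
      (setLIntegral_le_lintegral (Set.Ioi 0) _)
    have hr' : (0 : ℝ) < r := hr
    have ha : ‖(a : Vel)‖ = 1 := by simp
    rw [← ofReal_norm, norm_smul, ha, mul_one, Real.norm_of_nonneg hr'.le,
      ← ENNReal.ofReal_inv_of_pos hr', ← ENNReal.ofReal_pow (by positivity), ← mul_assoc,
      ← ENNReal.ofReal_mul (by positivity), show r ^ 2 * r⁻¹ ^ 2 = 1 by field_simp,
      ENNReal.ofReal_one, one_mul]
  refine lt_of_le_of_lt (lintegral_mono this) ?_
  rw [lintegral_const]
  exact ENNReal.mul_lt_top hG (measure_lt_top _ _)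

theorem one_add_norm_add_le (ζ u : Vel) : 1 + ‖ζ + u‖ ≤ (1 + ‖ζ‖) * (1 + ‖u‖) := by
  nlinarith [norm_add_le ζ u, norm_nonneg ζ, norm_nonneg u,
    mul_nonneg (norm_nonneg ζ) (norm_nonneg u)]

/-- Linear growth costs `1/16` of the exponent: `1 + r ≤ 5(1 + r²/16) ≤ 5 exp(r²/16)`. -/
theorem one_add_mul_exp_le (r c : ℝ) :
    (1 + r) * Real.exp (-c * r ^ 2) ≤ 5 * Real.exp (-(c - 1 / 16) * r ^ 2) := by
  have e1 : Real.exp (-(c - 1 / 16) * r ^ 2) = Real.exp (1 / 16 * r ^ 2) * Real.exp (-c * r ^ 2) := by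
    rw [← Real.exp_add]; congr 1; ring
  rw [e1, ← mul_assoc]
  refine mul_le_mul_of_nonneg_right ?_ (Real.exp_pos _).le
  nlinarith [Real.add_one_le_exp (1 / 16 * r ^ 2), sq_nonneg (r / 4 - 2), sq_nonneg r]

/-! ### Bounds on the collision frequency, and two mapping properties of `K`. -/

section Cutoff

variable {B : ℝ → ℝ → ℝ} {γ : ℝ}

theorem IsGradCutoff.exists_freq_lower (hB : IsGradCutoff B γ) (hγ0 : 0 < γ) :
    ∃ ν₀ : ℝ, 0 < ν₀ ∧ ∀ ζ, ν₀ ≤ collisionFreq B ζ := by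
  obtain ⟨ν₀, h0, h⟩ := hB.freq_lower
  refine ⟨ν₀, h0, fun ζ => le_trans ?_ (h ζ)⟩
  exact le_mul_of_one_le_right h0.le
    (Real.one_le_rpow (by linarith [norm_nonneg ζ]) hγ0.le)

theorem measurable_collisionFreq (hB : Measurable (Function.uncurry B)) :
    Measurable (collisionFreq B) := by
  unfold collisionFreq collisionIntegral
  have hc : Measurable fun q : Vel × (Vel × Metric.sphere (0 : Vel) 1) =>
      crossDensity B (q.2.1 - q.1) q.2.2 :=
    (measurable_crossDensity hB).comp
      (f := fun q : Vel × (Vel × Metric.sphere (0 : Vel) 1) =>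
        (q.2.1 - q.1, (q.2.2 : Vel))) (by fun_prop)
  have : StronglyMeasurable fun q : Vel × (Vel × Metric.sphere (0 : Vel) 1) =>
      maxwellian q.2.1 * crossDensity B (q.2.1 - q.1) q.2.2 :=
    Measurable.stronglyMeasurable (by fun_prop)
  exact (StronglyMeasurable.integral_prod_right' (ν := collisionMeasure) this).measurable

theorem IsGradCutoff.exists_freq_upper (hB : IsGradCutoff B γ) (hγ0 : 0 < γ) (hγ1 : γ ≤ 1) :
    ∃ N : ℝ, 0 ≤ N ∧ ∀ ζ, collisionFreq B ζ ≤ N * (1 + ‖ζ‖) := by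
  obtain ⟨C, hCt, hC⟩ := enorm_crossDensity_le hγ0 hγ1 hB
  set S := (volume : Measure Vel).toSphere Set.univ with hS
  have hSt : S < ∞ := measure_lt_top _ _
  have hG := lintegral_gaussian_vel_lt_top (c := 15 / 16) (by norm_num)
  set G := ∫⁻ ζ : Vel, ENNReal.ofReal (Real.exp (-(15 / 16) * ‖ζ‖ ^ 2))
  set D := C * (ENNReal.ofReal 5 * G * S) with hD
  have hDt : D < ∞ := ENNReal.mul_lt_top hCt
    (ENNReal.mul_lt_top (ENNReal.mul_lt_top ENNReal.ofReal_lt_top hG) hSt)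
  refine ⟨D.toReal, ENNReal.toReal_nonneg, fun ζ => ?_⟩
  have hw : ∀ η, maxwellian η ≤ Real.exp (-1 * ‖η‖ ^ 2) := by
    intro η
    have h := sqrt_maxwellian_le η
    calc maxwellian η = √(maxwellian η) * √(maxwellian η) :=
          (Real.mul_self_sqrt (maxwellian_pos η).le).symm
      _ ≤ Real.exp (-‖η‖ ^ 2 / 2) * Real.exp (-‖η‖ ^ 2 / 2) := by gcongr
      _ = _ := by rw [← Real.exp_add]; congr 1; ring
  have hpt : ∀ p : Vel × Metric.sphere (0 : Vel) 1,
      ‖maxwellian p.1 * crossDensity B (p.1 - ζ) p.2‖ₑ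
      ≤ C * (ENNReal.ofReal (1 + ‖ζ‖) * (ENNReal.ofReal 5
        * ENNReal.ofReal (Real.exp (-(15 / 16) * ‖p.1‖ ^ 2)))) := by
    intro p
    rw [enorm_mul, mul_comm, Real.enorm_of_nonneg (maxwellian_pos _).le]
    calc _ ≤ C * (‖p.1 - ζ‖ₑ + 1) * ENNReal.ofReal (maxwellian p.1) := by
          gcongr
          refine (hC _ _ (by simp)).trans ?_
          gcongr
          exact hemiDensity_le _ _ (by simp)
      _ = C * ENNReal.ofReal ((‖p.1 - ζ‖ + 1) * maxwellian p.1) := by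
          rw [← ofReal_norm, ← ENNReal.ofReal_one, ← ENNReal.ofReal_add (norm_nonneg _) one_pos.le,
            mul_assoc, ← ENNReal.ofReal_mul (by positivity)]
      _ ≤ _ := by
          rw [← ENNReal.ofReal_mul (by positivity), ← ENNReal.ofReal_mul (by positivity)]
          refine mul_le_mul_right (ENNReal.ofReal_le_ofReal ?_) _
          have h1 := one_add_norm_add_le (-ζ) p.1
          rw [norm_neg, neg_add_eq_sub] at h1
          have h2 := one_add_mul_exp_le ‖p.1‖ (1)
          calc (‖p.1 - ζ‖ + 1) * maxwellian p.1
              ≤ ((1 + ‖ζ‖) * (1 + ‖p.1‖)) * Real.exp (-1 * ‖p.1‖ ^ 2) := by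
                refine mul_le_mul (by linarith) (hw _) (maxwellian_pos _).le (by positivity)
            _ = (1 + ‖ζ‖) * ((1 + ‖p.1‖) * Real.exp (-1 * ‖p.1‖ ^ 2)) := by ring
            _ ≤ (1 + ‖ζ‖) * (5 * Real.exp (-(1 - 1 / 16) * ‖p.1‖ ^ 2)) := by gcongr
            _ = _ := by norm_num
  have hle : ‖collisionFreq B ζ‖ₑ ≤ D * ENNReal.ofReal (1 + ‖ζ‖) := by
    refine (enorm_integral_le_lintegral_enorm _).trans ((lintegral_mono hpt).trans (le_of_eq ?_))
    have hm : Measurable fun η : Vel => ENNReal.ofReal (Real.exp (-(15 / 16) * ‖η‖ ^ 2)) := by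
      fun_prop
    rw [lintegral_const_mul _ (by fun_prop), lintegral_const_mul _ (by fun_prop),
      lintegral_const_mul _ (by fun_prop)]
    have : ∫⁻ p : Vel × Metric.sphere (0 : Vel) 1,
        ENNReal.ofReal (Real.exp (-(15 / 16) * ‖p.1‖ ^ 2)) ∂collisionMeasure = G * S := by
      rw [lintegral_prod _ (by fun_prop)]
      simp only [lintegral_const, ← hS]
      rw [lintegral_mul_const _ hm]
    rw [this, hD]; ring
  have h3 := ENNReal.toReal_mono (ENNReal.mul_lt_top hDt ENNReal.ofReal_lt_top).ne hle
  rw [toReal_enorm, ENNReal.toReal_mul, ENNReal.toReal_ofReal (by positivity)] at h3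
  exact (le_abs_self _).trans h3

theorem lintegral_mul_le_sqrt (f g : Vel → ℝ≥0∞) (hf : AEMeasurable f) (hg : AEMeasurable g) :
    ∫⁻ u, f u * g u ≤ (∫⁻ u, f u ^ 2) ^ (1 / 2 : ℝ) * (∫⁻ u, g u ^ 2) ^ (1 / 2 : ℝ) := by
  have h := ENNReal.lintegral_mul_le_Lp_mul_Lq (volume : Measure Vel) Real.HolderConjugate.two_two
    hf hg
  simpa using h

/-- Cauchy–Schwarz: the kernel is square integrable, `|u|⁻²` being locally integrable in dimension
three, and `ν ≥ ν₀` bounds the `L²` norm by the weighted one. -/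
theorem abs_collisionK_le_starNorm (hγ0 : 0 < γ) (hγ1 : γ ≤ 1) (hB : IsGradCutoff B γ) :
    ∃ C : ℝ, 0 ≤ C ∧ ∀ g : Vel → ℝ, AEStronglyMeasurable g volume → starNorm B g < ∞ → ∀ ζ,
      Integrable (kIntegrand B g ζ) collisionMeasure ∧
      |collisionK B g ζ| ≤ C * (starNorm B g).toReal := by
  obtain ⟨C, hCt, -, hC⟩ := collisionK_bound hγ0 hγ1 hB
  obtain ⟨ν₀, hν₀, hν⟩ := hB.exists_freq_lower hγ0
  have hI : ∫⁻ u, gradKernel u ^ 2 < ∞ := by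
    refine lt_of_le_of_lt (lintegral_mono fun u => ?_) lintegral_inv_sq_gaussian_lt_top
    rw [gradKernel, mul_pow, pow_two (ENNReal.ofReal _)]
    refine mul_le_mul_right ?_ _
    refine mul_le_of_le_one_left zero_le ?_
    rw [ENNReal.ofReal_le_one, Real.exp_le_one_iff]
    nlinarith [sq_nonneg ‖u‖]
  set I := ∫⁻ u, gradKernel u ^ 2
  set D := C * (I ^ (1 / 2 : ℝ) * (ENNReal.ofReal ν₀⁻¹) ^ (1 / 2 : ℝ)) with hD
  have hDt : D < ∞ := ENNReal.mul_lt_top hCt (ENNReal.mul_lt_top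
    (ENNReal.rpow_lt_top_of_nonneg (by norm_num) hI.ne)
    (ENNReal.rpow_lt_top_of_nonneg (by norm_num) ENNReal.ofReal_ne_top))
  refine ⟨D.toReal, ENNReal.toReal_nonneg, fun g hg hs ζ => ?_⟩
  have hsq : ∫⁻ u, ‖g (ζ + u)‖ₑ ^ 2 ≤ ENNReal.ofReal ν₀⁻¹ *
      ∫⁻ η, ‖g η‖ₑ ^ 2 * ENNReal.ofReal (collisionFreq B η) := by
    rw [lintegral_add_left_eq_self (fun u => ‖g u‖ₑ ^ 2) ζ,
      ← lintegral_const_mul' _ _ ENNReal.ofReal_ne_top]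
    refine lintegral_mono fun η => ?_
    calc ‖g η‖ₑ ^ 2 = ENNReal.ofReal (ν₀⁻¹ * ν₀) * ‖g η‖ₑ ^ 2 := by
          rw [inv_mul_cancel₀ hν₀.ne', ENNReal.ofReal_one, one_mul]
      _ ≤ ENNReal.ofReal (ν₀⁻¹ * collisionFreq B η) * ‖g η‖ₑ ^ 2 := by
          gcongr; exact hν η
      _ = _ := by rw [ENNReal.ofReal_mul (by positivity)]; ring
  have hle : ∫⁻ u, gradKernel u * ‖g (ζ + u)‖ₑ
      ≤ I ^ (1 / 2 : ℝ) * (ENNReal.ofReal ν₀⁻¹) ^ (1 / 2 : ℝ) * starNorm B g := by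
    refine (lintegral_mul_le_sqrt _ _ measurable_gradKernel.aemeasurable ?_).trans ?_
    · exact (hg.comp_measurePreserving (measurePreserving_add_left volume ζ)).enorm
    rw [starNorm, mul_assoc, ← ENNReal.mul_rpow_of_nonneg (ENNReal.ofReal ν₀⁻¹) _ (show (0 : ℝ) ≤ 1 / 2 by norm_num)]
    exact mul_le_mul_right (ENNReal.rpow_le_rpow hsq (show (0 : ℝ) ≤ 1 / 2 by norm_num)) _
  have hfin : I ^ (1 / 2 : ℝ) * (ENNReal.ofReal ν₀⁻¹) ^ (1 / 2 : ℝ) * starNorm B g < ∞ :=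
    ENNReal.mul_lt_top (ENNReal.mul_lt_top
      (ENNReal.rpow_lt_top_of_nonneg (by norm_num) hI.ne)
      (ENNReal.rpow_lt_top_of_nonneg (by norm_num) ENNReal.ofReal_ne_top)) hs
  obtain ⟨h1, h2⟩ := hC g hg (fun η => ‖g η‖ₑ) (Filter.Eventually.of_forall fun _ => le_rfl) ζ
    (lt_of_le_of_lt hle hfin)
  refine ⟨h1, ?_⟩
  have h3 : ‖collisionK B g ζ‖ₑ ≤ D * starNorm B g :=
    h2.trans ((mul_le_mul_right hle _).trans (le_of_eq (by rw [hD]; ring)))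
  have h4 := ENNReal.toReal_mono (ENNReal.mul_lt_top hDt hs).ne h3
  rwa [toReal_enorm, ENNReal.toReal_mul] at h4

/-- The inequality `xy ≤ x² + y²` separates the two singularities `|u|⁻¹` and `(ν/|η₁|)^(1/4)`. The
first square is integrable in dimension three. The second is at most a multiple of `(1 +
|η|)|η₁|^(-1/2)`, integrable in `η₁` against a Gaussian, uniformly in the centre. The growth `1 +
|ζ|` comes from `1 + |ζ + u| ≤ (1 + |ζ|)(1 + |u|)`. -/
theorem abs_collisionK_le_of_le_rpow (hγ0 : 0 < γ) (hγ1 : γ ≤ 1) (hB : IsGradCutoff B γ) :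
    ∃ C : ℝ, 0 ≤ C ∧ ∀ g : Vel → ℝ, AEStronglyMeasurable g volume → ∀ M : ℝ, 0 ≤ M →
      (∀ᵐ η, |g η| ≤ M * (collisionFreq B η / |η 0|) ^ (1 / 4 : ℝ)) → ∀ ζ,
      |collisionK B g ζ| ≤ C * M * (1 + ‖ζ‖) := by
  obtain ⟨C, hCt, -, hC⟩ := collisionK_bound hγ0 hγ1 hB
  obtain ⟨ν₀, hν₀, hν⟩ := hB.exists_freq_lower hγ0
  obtain ⟨N, hN0, hN⟩ := hB.exists_freq_upper hγ0 hγ1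
  obtain ⟨J, hJt, hJ⟩ := exists_gaussian_mul_rpow_bound (c := 1 / 16) (s := 1 / 2) (by norm_num)
    (by norm_num) (by norm_num)
  have hGt := lintegral_gaussian_lt_top (c := 1 / 16) (by norm_num)
  set G := ∫⁻ t : ℝ, ENNReal.ofReal (Real.exp (-(1 / 16) * t ^ 2)) with hG
  set I := ∫⁻ u : Vel, (‖u‖ₑ⁻¹) ^ 2 * ENNReal.ofReal (Real.exp (-(1 / 8) * ‖u‖ ^ 2)) with hI
  have hIt : I < ∞ := lintegral_inv_sq_gaussian_lt_top
  set E := I + ENNReal.ofReal (√N * 5) * (J * G ^ 2) with hE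
  have hEt : E < ∞ := ENNReal.add_lt_top.2 ⟨hIt, ENNReal.mul_lt_top ENNReal.ofReal_lt_top
    (ENNReal.mul_lt_top hJt (ENNReal.pow_lt_top hGt))⟩
  set D := C * E with hD
  have hDt : D < ∞ := ENNReal.mul_lt_top hCt hEt
  refine ⟨D.toReal, ENNReal.toReal_nonneg, fun g hg M hM hgM ζ => ?_⟩
  set k : Vel → ℝ := fun η => collisionFreq B η / |η 0| with hk
  have hk0 : ∀ η, 0 ≤ k η := fun η => div_nonneg (hν₀.le.trans (hν η)) (abs_nonneg _)
  have hsq : ∀ η : Vel, ENNReal.ofReal (k η ^ (1 / 4 : ℝ)) ^ 2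
      ≤ ENNReal.ofReal (√N * (1 + ‖η‖)) * ‖η 0‖ₑ ^ (-(1 / 2) : ℝ) := by
    intro η
    rcases eq_or_ne (η 0) 0 with h0 | h0
    · simp [hk, h0]
    have h0' : 0 < |η 0| := abs_pos.2 h0
    rw [← ENNReal.ofReal_pow (Real.rpow_nonneg (hk0 η) _), ← Real.rpow_natCast, ← Real.rpow_mul (hk0 η),
      ← ofReal_norm, Real.norm_eq_abs, ENNReal.ofReal_rpow_of_pos h0',
      ← ENNReal.ofReal_mul (by positivity)]
    refine ENNReal.ofReal_le_ofReal ?_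
    rw [show (1 / 4 : ℝ) * ((2 : ℕ) : ℝ) = 1 / 2 by norm_num, Real.rpow_neg h0'.le,
      ← Real.sqrt_eq_rpow, ← Real.sqrt_eq_rpow, hk, Real.sqrt_div (hν₀.le.trans (hν η)),
      div_eq_mul_inv]
    refine mul_le_mul_of_nonneg_right ?_ (by positivity)
    calc √(collisionFreq B η) ≤ √(N * (1 + ‖η‖)) := Real.sqrt_le_sqrt (hN η)
      _ = √N * √(1 + ‖η‖) := Real.sqrt_mul hN0 _
      _ ≤ √N * (1 + ‖η‖) := by
          gcongr
          rw [Real.sqrt_le_left (by positivity)]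
          nlinarith [norm_nonneg η]
  have hmul : ∀ x y : ℝ≥0∞, x * y ≤ x ^ 2 + y ^ 2 := by
    intro x y
    rcases le_total x y with h | h
    · exact le_add_left (by rw [pow_two]; gcongr)
    · exact le_add_right (by rw [pow_two]; gcongr)
  have hpt : ∀ u : Vel, gradKernel u * ENNReal.ofReal (k (ζ + u) ^ (1 / 4 : ℝ))
      ≤ ENNReal.ofReal (1 + ‖ζ‖) *
        ((‖u‖ₑ⁻¹) ^ 2 * ENNReal.ofReal (Real.exp (-(1 / 8) * ‖u‖ ^ 2))
        + ENNReal.ofReal (√N * 5) * (ENNReal.ofReal (Real.exp (-(1 / 16) * ‖u‖ ^ 2))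
          * ‖ζ 0 + u 0‖ₑ ^ (-(1 / 2) : ℝ))) := by
    intro u
    set e := ENNReal.ofReal (Real.exp (-(1 / 8) * ‖u‖ ^ 2)) with he
    have h1 : (1 : ℝ≥0∞) ≤ ENNReal.ofReal (1 + ‖ζ‖) := by
      rw [ENNReal.one_le_ofReal]; linarith [norm_nonneg ζ]
    have h2 : ENNReal.ofReal (√N * (1 + ‖ζ + u‖)) * e
        ≤ ENNReal.ofReal (1 + ‖ζ‖) * (ENNReal.ofReal (√N * 5)
          * ENNReal.ofReal (Real.exp (-(1 / 16) * ‖u‖ ^ 2))) := by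
      rw [he, ← ENNReal.ofReal_mul (by positivity), ← ENNReal.ofReal_mul (by positivity),
        ← ENNReal.ofReal_mul (by positivity)]
      refine ENNReal.ofReal_le_ofReal ?_
      have h4 := one_add_mul_exp_le ‖u‖ (1 / 8)
      calc √N * (1 + ‖ζ + u‖) * Real.exp (-(1 / 8) * ‖u‖ ^ 2)
          ≤ √N * ((1 + ‖ζ‖) * (1 + ‖u‖)) * Real.exp (-(1 / 8) * ‖u‖ ^ 2) := by
            gcongr; exact one_add_norm_add_le ζ u
        _ = √N * (1 + ‖ζ‖) * ((1 + ‖u‖) * Real.exp (-(1 / 8) * ‖u‖ ^ 2)) := by ring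
        _ ≤ √N * (1 + ‖ζ‖) * (5 * Real.exp (-(1 / 8 - 1 / 16) * ‖u‖ ^ 2)) := by gcongr
        _ = _ := by norm_num; ring
    calc gradKernel u * ENNReal.ofReal (k (ζ + u) ^ (1 / 4 : ℝ))
        = (‖u‖ₑ⁻¹ * ENNReal.ofReal (k (ζ + u) ^ (1 / 4 : ℝ))) * e := by rw [gradKernel]; ring
      _ ≤ ((‖u‖ₑ⁻¹) ^ 2 + ENNReal.ofReal (√N * (1 + ‖ζ + u‖)) * ‖ζ 0 + u 0‖ₑ ^ (-(1 / 2) : ℝ)) * e := by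
          refine mul_le_mul_left ((hmul _ _).trans (add_le_add_right ?_ _)) _
          exact hsq (ζ + u)
      _ = 1 * ((‖u‖ₑ⁻¹) ^ 2 * e) + (ENNReal.ofReal (√N * (1 + ‖ζ + u‖)) * e)
            * ‖ζ 0 + u 0‖ₑ ^ (-(1 / 2) : ℝ) := by ring
      _ ≤ ENNReal.ofReal (1 + ‖ζ‖) * ((‖u‖ₑ⁻¹) ^ 2 * e) + (ENNReal.ofReal (1 + ‖ζ‖) *
            (ENNReal.ofReal (√N * 5) * ENNReal.ofReal (Real.exp (-(1 / 16) * ‖u‖ ^ 2))))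
            * ‖ζ 0 + u 0‖ₑ ^ (-(1 / 2) : ℝ) :=
          add_le_add (mul_le_mul_left h1 _) (mul_le_mul_left h2 _)
      _ = _ := by ring
  have hint : ∫⁻ u, gradKernel u * ENNReal.ofReal (k (ζ + u) ^ (1 / 4 : ℝ))
      ≤ ENNReal.ofReal (1 + ‖ζ‖) * E := by
    refine (lintegral_mono hpt).trans ?_
    rw [lintegral_const_mul _ (by fun_prop), lintegral_add_left (by fun_prop),
      lintegral_const_mul _ (by fun_prop)]
    refine mul_le_mul_right (add_le_add_right (mul_le_mul_right ?_ _) _) _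
    rw [lintegral_gaussian_mul_coord (1 / 16) (fun t => ‖ζ 0 + t‖ₑ ^ (-(1 / 2) : ℝ)) (by fun_prop)]
    refine mul_le_mul_left ?_ _
    refine le_trans ?_ (hJ (ζ 0))
    rw [← lintegral_add_left_eq_self (fun t => ENNReal.ofReal (Real.exp (-(1 / 16) * (t - ζ 0) ^ 2))
      * (1 + ‖t‖ₑ ^ (-(1 / 2) : ℝ))) (ζ 0)]
    refine lintegral_mono fun t => ?_
    simp only [add_sub_cancel_left]
    exact mul_le_mul_right le_add_self _
  set F : Vel → ℝ≥0∞ := fun η => ENNReal.ofReal M * ENNReal.ofReal (k η ^ (1 / 4 : ℝ)) with hF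
  have hFle : ∫⁻ u, gradKernel u * F (ζ + u) ≤ ENNReal.ofReal M * (ENNReal.ofReal (1 + ‖ζ‖) * E) := by
    simp only [hF]
    simp_rw [mul_left_comm (gradKernel _)]
    rw [lintegral_const_mul' _ _ ENNReal.ofReal_ne_top]
    exact mul_le_mul_right hint _
  have hfin : ENNReal.ofReal M * (ENNReal.ofReal (1 + ‖ζ‖) * E) < ∞ :=
    ENNReal.mul_lt_top ENNReal.ofReal_lt_top (ENNReal.mul_lt_top ENNReal.ofReal_lt_top hEt)
  have h2 := (hC g hg F (by
    filter_upwards [hgM] with η hη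
    simp only [hF]
    rw [← ENNReal.ofReal_mul hM, ← ofReal_norm]
    exact ENNReal.ofReal_le_ofReal hη) ζ (lt_of_le_of_lt hFle hfin)).2
  have h3 := h2.trans (mul_le_mul_right hFle C)
  have h4 := ENNReal.toReal_mono (ENNReal.mul_lt_top hCt hfin).ne h3
  rw [toReal_enorm, Real.norm_eq_abs, ENNReal.toReal_mul, ENNReal.toReal_mul, ENNReal.toReal_mul,
    ENNReal.toReal_ofReal hM, ENNReal.toReal_ofReal (by positivity)] at h4
  refine h4.trans (le_of_eq ?_)
  rw [hD, ENNReal.toReal_mul]; ring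

end Cutoff

/-! ### The scalar equation along a characteristic. -/

/-- The solution of `y' = -κ y + c g`, `y(0) = a`, in integrated form. -/
def charSol (κ c a : ℝ) (g : ℝ → ℝ) (x : ℝ) : ℝ :=
  Real.exp (-κ * x) * a + ∫ s in (0 : ℝ)..x, c * Real.exp (-κ * (x - s)) * g s

theorem integral_exp_decay {k : ℝ} (hk : k ≠ 0) (y x : ℝ) :
    ∫ s in y..x, Real.exp (-k * (x - s)) = (1 - Real.exp (-k * (x - y))) / k := by
  have hd : ∀ s ∈ Set.uIcc y x, HasDerivAt (fun s => Real.exp (-k * (x - s)) / k)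
      (Real.exp (-k * (x - s))) s := by
    intro s _
    have h1 : HasDerivAt (fun s => -k * (x - s)) k s := by
      have := ((hasDerivAt_id s).const_sub x).const_mul (-k)
      simpa using this
    have h2 := h1.exp.div_const k
    rwa [mul_div_assoc, div_self hk, mul_one] at h2
  rw [intervalIntegral.integral_eq_sub_of_hasDerivAt hd
    (Continuous.intervalIntegrable (by fun_prop) _ _)]
  simp only [sub_self, mul_zero, Real.exp_zero]
  ring

theorem abs_integral_decay_le {κ c G y x : ℝ} {g : ℝ → ℝ} (hκ : 0 < κ) (hc : 0 ≤ c) (hyx : y ≤ x)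
    (hg : ∀ s ∈ Set.Icc y x, |g s| ≤ G) :
    |∫ s in y..x, c * Real.exp (-κ * (x - s)) * g s|
      ≤ (1 - Real.exp (-κ * (x - y))) * (c * G / κ) := by
  have h := intervalIntegral.norm_integral_le_of_norm_le hyx
    (f := fun s => c * Real.exp (-κ * (x - s)) * g s)
    (g := fun s => (c * G) * Real.exp (-κ * (x - s))) (μ := volume)
    (Filter.Eventually.of_forall fun s hs => by
      rw [norm_mul, Real.norm_of_nonneg (by positivity), Real.norm_eq_abs]
      calc c * Real.exp (-κ * (x - s)) * |g s| ≤ c * Real.exp (-κ * (x - s)) * G := by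
            gcongr; exact hg s ⟨hs.1.le, hs.2⟩
        _ = _ := by ring) (Continuous.intervalIntegrable (by fun_prop) _ _)
  rw [intervalIntegral.integral_const_mul, integral_exp_decay hκ.ne'] at h
  refine h.trans (le_of_eq (by ring))

theorem abs_charSol_le {κ c a G x : ℝ} {g : ℝ → ℝ} (hκ : 0 < κ) (hc : 0 ≤ c) (hx : 0 ≤ x)
    (hg : ∀ s ∈ Set.Icc 0 x, |g s| ≤ G) : |charSol κ c a g x| ≤ |a| + c * G / κ := by
  have hG : 0 ≤ G := (abs_nonneg _).trans (hg 0 ⟨le_rfl, hx⟩)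
  have h1 : Real.exp (-κ * x) ≤ 1 := by
    rw [Real.exp_le_one_iff]; nlinarith
  have h2 := abs_integral_decay_le hκ hc hx hg
  rw [sub_zero] at h2
  refine (abs_add_le _ _).trans (add_le_add ?_ (h2.trans ?_))
  · rw [abs_mul, abs_of_pos (Real.exp_pos _)]
    exact mul_le_of_le_one_left (abs_nonneg _) h1
  · exact mul_le_of_le_one_left (by positivity) (by linarith [Real.exp_pos (-κ * x)])

/-- This fixes the Hölder exponent. A positive exponent makes `|ζ₁|^(-3/4)` appear in place of
`|ζ₁|⁻¹` in the derivative, and `1/4 < 1/2` keeps the square of the weight `|ζ₁|^(-1/4)` integrable.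
-/
theorem one_sub_exp_neg_le_rpow {t : ℝ} (ht : 0 ≤ t) : 1 - Real.exp (-t) ≤ t ^ (1 / 4 : ℝ) := by
  rcases le_total t 1 with h | h
  · have h1 : t ^ (1 : ℝ) ≤ t ^ (1 / 4 : ℝ) :=
      Real.rpow_le_rpow_of_exponent_ge_of_imp ht h (by norm_num) (by norm_num)
    rw [Real.rpow_one] at h1
    linarith [Real.add_one_le_exp (-t)]
  · have h1 := Real.one_le_rpow h (show (0 : ℝ) ≤ 1 / 4 by norm_num)
    linarith [Real.exp_pos (-t)]

theorem charSol_eq_of_le {κ c a y x : ℝ} {g : ℝ → ℝ} (hy : 0 ≤ y) (hyx : y ≤ x)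
    (hg : IntervalIntegrable g volume 0 x) :
    charSol κ c a g x = Real.exp (-κ * (x - y)) * charSol κ c a g y
      + ∫ s in y..x, c * Real.exp (-κ * (x - s)) * g s := by
  have hi : IntervalIntegrable (fun s => c * Real.exp (-κ * (x - s)) * g s) volume 0 x :=
    hg.continuousOn_mul (Continuous.continuousOn (by fun_prop))
  have h1 : IntervalIntegrable (fun s => c * Real.exp (-κ * (x - s)) * g s) volume 0 y :=
    hi.mono_set (by
      rw [Set.uIcc_of_le hy, Set.uIcc_of_le (hy.trans hyx)]; exact Set.Icc_subset_Icc_right hyx)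
  have h2 : IntervalIntegrable (fun s => c * Real.exp (-κ * (x - s)) * g s) volume y x :=
    hi.mono_set (by
      rw [Set.uIcc_of_le hyx, Set.uIcc_of_le (hy.trans hyx)]; exact Set.Icc_subset_Icc_left hy)
  have e1 : Real.exp (-κ * (x - y)) * ∫ s in (0 : ℝ)..y, c * Real.exp (-κ * (y - s)) * g s
      = ∫ s in (0 : ℝ)..y, c * Real.exp (-κ * (x - s)) * g s := by
    rw [← intervalIntegral.integral_const_mul]
    refine intervalIntegral.integral_congr fun s _ => ?_
    rw [show -κ * (x - s) = -κ * (x - y) + -κ * (y - s) by ring, Real.exp_add]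
    ring
  have e2 : Real.exp (-κ * x) = Real.exp (-κ * (x - y)) * Real.exp (-κ * y) := by
    rw [← Real.exp_add]; congr 1; ring
  unfold charSol
  rw [← intervalIntegral.integral_add_adjacent_intervals h1 h2, ← e1, e2]
  ring

/-- Restarting the equation at `y`, the increment is `-(1 - e)` times the value at `y` plus the
source on `[y, x]`, with `e = exp(-κ(x - y))`. Both parts carry the factor `1 - e`, which is at most
`(κ(x - y))^(1/4)`. -/
theorem abs_charSol_sub_le {κ c a G y x : ℝ} {g : ℝ → ℝ} (hκ : 0 < κ) (hc : 0 ≤ c) (hy : 0 ≤ y)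
    (hyx : y ≤ x) (hgi : IntervalIntegrable g volume 0 x) (hg : ∀ s ∈ Set.Icc 0 x, |g s| ≤ G) :
    |charSol κ c a g x - charSol κ c a g y|
      ≤ (|a| + 2 * (c * G / κ)) * (x - y) ^ (1 / 4 : ℝ) * κ ^ (1 / 4 : ℝ) := by
  have hG : 0 ≤ G := (abs_nonneg _).trans (hg 0 ⟨le_rfl, hy.trans hyx⟩)
  have h1 := abs_charSol_le (a := a) hκ hc hy fun s hs => hg s ⟨hs.1, hs.2.trans hyx⟩
  have h2 := abs_integral_decay_le hκ hc hyx fun s hs => hg s ⟨hy.trans hs.1, hs.2⟩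
  have h3 := one_sub_exp_neg_le_rpow (t := κ * (x - y)) (mul_nonneg hκ.le (by linarith))
  rw [← neg_mul] at h3
  have h4 : 0 ≤ 1 - Real.exp (-κ * (x - y)) := by
    have : Real.exp (-κ * (x - y)) ≤ 1 := by
      rw [Real.exp_le_one_iff]; nlinarith
    linarith
  rw [charSol_eq_of_le hy hyx hgi]
  set e := Real.exp (-κ * (x - y))
  set u := charSol κ c a g y
  set I := ∫ s in y..x, c * Real.exp (-κ * (x - s)) * g s
  calc |e * u + I - u| = |-((1 - e) * u) + I| := by congr 1; ring
    _ ≤ (1 - e) * |u| + |I| := by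
        refine (abs_add_le _ _).trans (le_of_eq ?_)
        rw [abs_neg, abs_mul, abs_of_nonneg h4]
    _ ≤ (1 - e) * (|a| + c * G / κ) + (1 - e) * (c * G / κ) := by gcongr
    _ = (1 - e) * (|a| + 2 * (c * G / κ)) := by ring
    _ ≤ (κ * (x - y)) ^ (1 / 4 : ℝ) * (|a| + 2 * (c * G / κ)) := by gcongr
    _ = _ := by rw [Real.mul_rpow hκ.le (by linarith)]; ring

theorem hasDerivAt_charSol (κ c a : ℝ) {g : ℝ → ℝ} (hg : Continuous g) (x : ℝ) :
    HasDerivAt (charSol κ c a g) (-κ * charSol κ c a g x + c * g x) x := by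
  have heq : charSol κ c a g
      = fun x => Real.exp (-κ * x) * (a + ∫ s in (0 : ℝ)..x, c * Real.exp (κ * s) * g s) := by
    funext x
    unfold charSol
    rw [mul_add, ← intervalIntegral.integral_const_mul]
    congr 1
    refine intervalIntegral.integral_congr fun s _ => ?_
    rw [show -κ * (x - s) = -κ * x + κ * s by ring, Real.exp_add]
    ring
  have hc : Continuous fun s => c * Real.exp (κ * s) * g s := by fun_prop
  have h1 := (hc.integral_hasStrictDerivAt 0 x).hasDerivAt.const_add a
  have h2 : HasDerivAt (fun x => Real.exp (-κ * x)) (Real.exp (-κ * x) * -κ) x := by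
    have : HasDerivAt (fun x => -κ * x) (-κ) x := by
      simpa using (hasDerivAt_id x).const_mul (-κ)
    exact this.exp
  have h3 := h2.mul h1
  rw [heq]
  refine h3.congr_deriv ?_
  have e : Real.exp (-κ * x) * Real.exp (κ * x) = 1 := by
    rw [← Real.exp_add, ← Real.exp_zero]; congr 1; ring
  linear_combination (c * g x) * e

/-- A power of the elapsed distance is paid for with half of the decay rate and gains `κ^(-1/4)`. -/
theorem rpow_quarter_le {κ d : ℝ} (hκ : 0 < κ) (hd : 0 ≤ d) :
    d ^ (1 / 4 : ℝ) ≤ 2 * κ ^ (-(1 / 4) : ℝ) * Real.exp (κ / 2 * d) := by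
  have h1 : (κ * d) ^ (1 / 4 : ℝ) ≤ 2 * Real.exp (κ / 2 * d) := by
    have hkd : 0 ≤ κ * d := by positivity
    have h2 : (κ * d) ^ (1 / 4 : ℝ) ≤ 1 + κ * d := by
      rcases le_total (κ * d) 1 with h | h
      · exact (Real.rpow_le_one hkd h (by norm_num)).trans (by linarith)
      · calc (κ * d) ^ (1 / 4 : ℝ) ≤ (κ * d) ^ (1 : ℝ) :=
              Real.rpow_le_rpow_of_exponent_le h (by norm_num)
          _ ≤ _ := by rw [Real.rpow_one]; linarith
    linarith [Real.add_one_le_exp (κ / 2 * d)]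
  have h3 : d ^ (1 / 4 : ℝ) = κ ^ (-(1 / 4) : ℝ) * (κ * d) ^ (1 / 4 : ℝ) := by
    rw [Real.mul_rpow hκ.le hd, ← mul_assoc, ← Real.rpow_add hκ]; simp
  rw [h3]
  calc _ ≤ κ ^ (-(1 / 4) : ℝ) * (2 * Real.exp (κ / 2 * d)) := by gcongr
    _ = _ := by ring

/-- The decisive cancellation. As `κ exp(-κ(x - s))` has mass `1 - exp(-κx)` on `[0, x]`,
subtracting `κ` times the source integral from `c g(x)` leaves `exp(-κx) c g(x)` and a weighted
integral of `g(x) - g(s)`. Hölder continuity makes the latter of order `c κ^(-1/4)` instead of `c`.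
-/
theorem abs_deriv_charSol_le {κ c a G H x : ℝ} {g : ℝ → ℝ} (hκ : 0 < κ) (hc : 0 ≤ c) (hx : 0 ≤ x)
    (hgc : Continuous g) (hG : |g x| ≤ G)
    (hH : ∀ s ∈ Set.Icc 0 x, |g x - g s| ≤ H * (x - s) ^ (1 / 4 : ℝ)) (hH0 : 0 ≤ H) :
    |-κ * charSol κ c a g x + c * g x|
      ≤ Real.exp (-κ * x) * (κ * |a| + c * G) + 4 * c * H * κ ^ (-(1 / 4) : ℝ) := by
  have e1 : ∫ s in (0 : ℝ)..x, κ * Real.exp (-κ * (x - s)) * (g x - g s)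
      = (1 - Real.exp (-κ * x)) * g x - κ * ∫ s in (0 : ℝ)..x, Real.exp (-κ * (x - s)) * g s := by
    have : ∀ s, κ * Real.exp (-κ * (x - s)) * (g x - g s)
        = (κ * g x) * Real.exp (-κ * (x - s)) - κ * (Real.exp (-κ * (x - s)) * g s) := by
      intro s; ring
    simp_rw [this]
    rw [intervalIntegral.integral_sub (Continuous.intervalIntegrable (by fun_prop) _ _)
      (Continuous.intervalIntegrable (by fun_prop) _ _), intervalIntegral.integral_const_mul,
      intervalIntegral.integral_const_mul, integral_exp_decay hκ.ne', sub_zero]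
    congr 1
    field_simp
  have e2 : -κ * charSol κ c a g x + c * g x = -(Real.exp (-κ * x) * (κ * a))
      + Real.exp (-κ * x) * (c * g x)
      + c * ∫ s in (0 : ℝ)..x, κ * Real.exp (-κ * (x - s)) * (g x - g s) := by
    rw [e1]
    unfold charSol
    simp_rw [mul_assoc c]
    rw [intervalIntegral.integral_const_mul]
    ring
  have h3 : |∫ s in (0 : ℝ)..x, κ * Real.exp (-κ * (x - s)) * (g x - g s)|
      ≤ 4 * H * κ ^ (-(1 / 4) : ℝ) := by
    -- Half of the rate absorbs `(x - s)^(1/4)`; the remaining rate `κ/2` integrates to at most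
    -- `2/κ`, so the factor `2` of `rpow_quarter_le` becomes `4`.
    have h := intervalIntegral.norm_integral_le_of_norm_le hx
      (f := fun s => κ * Real.exp (-κ * (x - s)) * (g x - g s))
      (g := fun s => (2 * H * κ ^ (-(1 / 4) : ℝ) * κ) * Real.exp (-(κ / 2) * (x - s))) (μ := volume)
      (Filter.Eventually.of_forall fun s hs => by
        rw [norm_mul, Real.norm_of_nonneg (by positivity), Real.norm_eq_abs]
        have hs' : s ∈ Set.Icc 0 x := ⟨hs.1.le, hs.2⟩
        have hd : 0 ≤ x - s := by linarith [hs.2]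
        calc κ * Real.exp (-κ * (x - s)) * |g x - g s|
            ≤ κ * Real.exp (-κ * (x - s)) *
              (H * (2 * κ ^ (-(1 / 4) : ℝ) * Real.exp (κ / 2 * (x - s)))) := by
              refine mul_le_mul_of_nonneg_left ((hH s hs').trans ?_) (by positivity)
              exact mul_le_mul_of_nonneg_left (rpow_quarter_le hκ hd) hH0
          _ = (2 * H * κ ^ (-(1 / 4) : ℝ) * κ) *
              (Real.exp (-κ * (x - s)) * Real.exp (κ / 2 * (x - s))) := by ring
          _ = _ := by rw [← Real.exp_add]; congr 2; ring)
      (Continuous.intervalIntegrable (by fun_prop) _ _)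
    rw [intervalIntegral.integral_const_mul, integral_exp_decay (by positivity), sub_zero] at h
    refine h.trans ?_
    calc _ = 4 * H * κ ^ (-(1 / 4) : ℝ) * (1 - Real.exp (-(κ / 2) * x)) := by
          field_simp; ring
      _ ≤ 4 * H * κ ^ (-(1 / 4) : ℝ) * 1 := by
          gcongr; linarith [Real.exp_pos (-(κ / 2) * x)]
      _ = _ := mul_one _
  rw [e2]
  refine (abs_add_le _ _).trans (add_le_add ((abs_add_le _ _).trans ?_) ?_)
  · rw [abs_neg, abs_mul, abs_mul, abs_mul, abs_mul, abs_of_pos (Real.exp_pos _), abs_of_pos hκ,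
      abs_of_nonneg hc, ← mul_add]
    gcongr
  · rw [abs_mul, abs_of_nonneg hc]
    calc _ ≤ c * (4 * H * κ ^ (-(1 / 4) : ℝ)) := by gcongr
      _ = _ := by ring

/-! ### Moment weights, the decay profile, and differentiation of moments. -/

/-- The right-hand side is the maximum of the left, attained at `t² = 2n` when `n > 0`. In that case
it follows from `s ≤ exp(s - 1)` with `s = t²/(2n)`, raised to the power `n/2`. -/
theorem abs_pow_mul_exp_le (n : ℕ) (t : ℝ) :
    |t| ^ n * Real.exp (-(1 / 4) * t ^ 2)
      ≤ (2 * (n : ℝ)) ^ ((n : ℝ) / 2) * Real.exp (-(n : ℝ) / 2) := by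
  rcases Nat.eq_zero_or_pos n with rfl | hn
  · simp only [pow_zero, one_mul, Nat.cast_zero, mul_zero, zero_div, Real.rpow_zero, neg_zero,
      Real.exp_zero, Real.exp_le_one_iff]
    nlinarith [sq_nonneg t]
  have hn' : (0 : ℝ) < n := Nat.cast_pos.2 hn
  have h1 : t ^ 2 ≤ (2 * (n : ℝ)) * Real.exp (t ^ 2 / (2 * n) - 1) := by
    have := Real.add_one_le_exp (t ^ 2 / (2 * n) - 1)
    rw [sub_add_cancel, div_le_iff₀ (by positivity)] at this
    linarith
  have h2 : |t| ^ n = (t ^ 2) ^ ((n : ℝ) / 2) := by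
    rw [← sq_abs, ← Real.rpow_natCast (|t|) 2, ← Real.rpow_mul (abs_nonneg t), ← Real.rpow_natCast]
    congr 1; push_cast; ring
  calc _ ≤ ((2 * (n : ℝ)) * Real.exp (t ^ 2 / (2 * n) - 1)) ^ ((n : ℝ) / 2)
        * Real.exp (-(1 / 4) * t ^ 2) := by rw [h2]; gcongr
    _ = (2 * (n : ℝ)) ^ ((n : ℝ) / 2) * (Real.exp ((t ^ 2 / (2 * n) - 1) * (n / 2))
        * Real.exp (-(1 / 4) * t ^ 2)) := by
        rw [Real.mul_rpow (by positivity) (Real.exp_pos _).le, ← Real.exp_mul, mul_assoc]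
    _ = _ := by
        rw [← Real.exp_add]; congr 2; field_simp; ring

theorem momentConst_nonneg (α : Fin 3 → ℕ) : 0 ≤ momentConst α := by
  unfold momentConst; positivity

/-- Half of the exponent `|ζ|²/2` is spent coordinatewise on the monomial and yields `A_α`; the
other half is kept. -/
theorem abs_momentWeight_le (α : Fin 3 → ℕ) (ζ : Vel) :
    |momentWeight α ζ| ≤ momentConst α * Real.exp (-(1 / 4) * ‖ζ‖ ^ 2) := by
  have hpi : Real.pi ^ (-(3 / 4) : ℝ) ≤ 1 :=
    Real.rpow_le_one_of_one_le_of_nonpos (by linarith [Real.pi_gt_three]) (by norm_num)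
  have hn : ‖ζ‖ ^ 2 = ∑ i, ζ i ^ 2 := EuclideanSpace.real_norm_sq_eq ζ
  have e1 : Real.exp (-‖ζ‖ ^ 2 / 2)
      = (∏ i, Real.exp (-(1 / 4) * ζ i ^ 2)) * Real.exp (-(1 / 4) * ‖ζ‖ ^ 2) := by
    rw [← Real.exp_sum, ← Real.exp_add, ← Finset.mul_sum, ← hn]; congr 1; ring
  have e2 : momentConst α = ∏ i, ((2 * (α i : ℝ)) ^ ((α i : ℝ) / 2) * Real.exp (-(α i : ℝ) / 2)) := by
    rw [Finset.prod_mul_distrib, ← Real.exp_sum, ← Finset.sum_div, Finset.sum_neg_distrib]; rfl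
  rw [momentWeight, abs_mul, abs_mul, abs_of_pos (Real.exp_pos _), e1, Finset.abs_prod,
    abs_of_pos (Real.rpow_pos_of_pos Real.pi_pos _), e2]
  simp_rw [abs_pow]
  calc _ = Real.pi ^ (-(3 / 4) : ℝ) * (∏ i, (|ζ i| ^ α i * Real.exp (-(1 / 4) * ζ i ^ 2)))
        * Real.exp (-(1 / 4) * ‖ζ‖ ^ 2) := by rw [Finset.prod_mul_distrib]; ring
    _ ≤ 1 * (∏ i, ((2 * (α i : ℝ)) ^ ((α i : ℝ) / 2) * Real.exp (-(α i : ℝ) / 2)))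
        * Real.exp (-(1 / 4) * ‖ζ‖ ^ 2) := by
        refine mul_le_mul_of_nonneg_right (mul_le_mul hpi ?_ (by positivity) one_pos.le)
          (Real.exp_pos _).le
        exact Finset.prod_le_prod (fun i _ => by positivity) fun i _ => abs_pow_mul_exp_le _ _
    _ = _ := by rw [one_mul]

/-- The profile in `ζ₁` that dominates the `x`-derivative of a solution at depth `x`. -/
def decayProfile (ν₀ x : ℝ) (z : ℝ) : ℝ :=
  |z|⁻¹ * Real.exp (-(ν₀ / |z|) * x) + |z| ^ (-(3 / 4) : ℝ)

/-- The boundary-layer term gives the logarithm, and `|z|^(-3/4)` contributes a constant. The other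
two coordinates integrate out as Gaussians. -/
theorem exists_lintegral_decayProfile_le {ν₀ : ℝ} (hν : 0 < ν₀) :
    ∃ C : ℝ, 0 ≤ C ∧ ∀ x : ℝ, 0 < x →
      ∫⁻ ζ : Vel, ENNReal.ofReal (Real.exp (-(1 / 8) * ‖ζ‖ ^ 2) * decayProfile ν₀ x (ζ 0))
        ≤ ENNReal.ofReal (C * (|Real.log x| + 1)) := by
  obtain ⟨C, hC0, hC⟩ := exists_log_bound hν
  obtain ⟨J, hJt, hJ⟩ := exists_gaussian_mul_rpow_bound (c := 1 / 8) (s := 3 / 4) (by norm_num)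
    (by norm_num) (by norm_num)
  have hGt := lintegral_gaussian_lt_top (c := 1 / 8) (by norm_num)
  set G := ∫⁻ t : ℝ, ENNReal.ofReal (Real.exp (-(1 / 8) * t ^ 2)) with hG
  refine ⟨(C + J.toReal) * G.toReal ^ 2, by positivity, fun x hx => ?_⟩
  have hm : Measurable (decayProfile ν₀ x) := by unfold decayProfile; fun_prop
  have e1 : ∀ ζ : Vel, ENNReal.ofReal (Real.exp (-(1 / 8) * ‖ζ‖ ^ 2) * decayProfile ν₀ x (ζ 0))
      = ENNReal.ofReal (Real.exp (-(1 / 8) * ‖ζ‖ ^ 2)) * ENNReal.ofReal (decayProfile ν₀ x (ζ 0)) :=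
    fun ζ => ENNReal.ofReal_mul (Real.exp_pos _).le
  simp_rw [e1]
  rw [lintegral_gaussian_mul_coord (1 / 8) (fun z => ENNReal.ofReal (decayProfile ν₀ x z))
    (by fun_prop), ← hG]
  have h1 : ∫⁻ z : ℝ, ENNReal.ofReal (Real.exp (-(1 / 8) * z ^ 2))
        * ENNReal.ofReal (decayProfile ν₀ x z)
      ≤ ENNReal.ofReal (C * (|Real.log x| + 1)) + J := by
    have hpt : ∀ z : ℝ, ENNReal.ofReal (Real.exp (-(1 / 8) * z ^ 2))
        * ENNReal.ofReal (decayProfile ν₀ x z)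
        ≤ ENNReal.ofReal (Real.exp (-(1 / 8) * z ^ 2) * (|z|⁻¹ * Real.exp (-(ν₀ / |z|) * x)))
          + ENNReal.ofReal (Real.exp (-(1 / 8) * (z - 0) ^ 2)) * (1 + ‖z‖ₑ ^ (-(3 / 4) : ℝ)) := by
      intro z
      rw [decayProfile, ENNReal.ofReal_add (by positivity) (by positivity), mul_add, sub_zero,
        ENNReal.ofReal_mul (Real.exp_pos (-(1 / 8) * z ^ 2)).le]
      refine add_le_add_right (mul_le_mul_right (le_add_left ?_) _) _
      rcases eq_or_ne z 0 with rfl | hz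
      · simp [Real.zero_rpow (show (-(3 / 4) : ℝ) ≠ 0 by norm_num)]
      · rw [Real.enorm_eq_ofReal_abs, ENNReal.ofReal_rpow_of_pos (abs_pos.2 hz)]
    refine (lintegral_mono hpt).trans ?_
    rw [lintegral_add_left (by fun_prop)]
    exact add_le_add (hC x hx) (hJ 0)
  have hlog : 1 ≤ |Real.log x| + 1 := by linarith [abs_nonneg (Real.log x)]
  calc _ ≤ (ENNReal.ofReal (C * (|Real.log x| + 1)) + J) * G ^ 2 := mul_le_mul_left h1 _
    _ = ENNReal.ofReal ((C * (|Real.log x| + 1) + J.toReal) * G.toReal ^ 2) := by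
        rw [ENNReal.ofReal_mul (p := C * (|Real.log x| + 1) + J.toReal) (by positivity),
          ENNReal.ofReal_add (p := C * (|Real.log x| + 1)) (by positivity) (by positivity),
          ENNReal.ofReal_toReal hJt.ne, ENNReal.ofReal_pow (by positivity),
          ENNReal.ofReal_toReal hGt.ne]
    _ ≤ _ := by
        refine ENNReal.ofReal_le_ofReal ?_
        have : J.toReal ≤ J.toReal * (|Real.log x| + 1) :=
          le_mul_of_one_le_right ENNReal.toReal_nonneg hlog
        calc _ ≤ (C * (|Real.log x| + 1) + J.toReal * (|Real.log x| + 1)) * G.toReal ^ 2 := by gcongr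
          _ = _ := by ring

/-- With `κ = ν/|z|` and `c = 1/|z|`, `c κ^(-1/4) = ν^(-1/4)|z|^(-3/4)`. The lower bound on `ν`
controls this factor and the exponential, while the upper bound controls the prefactor `κ|a|`. -/
theorem abs_deriv_le_decayProfile {ν₀ N ν M x z r a : ℝ} {g : ℝ → ℝ} (hν₀ : 0 < ν₀) (hN : 0 ≤ N)
    (hν : ν₀ ≤ ν) (hr : 0 ≤ r) (hνr : ν ≤ N * (1 + r)) (hz : z ≠ 0) (hx : 0 ≤ x)
    (hgc : Continuous g) (ha : |a| ≤ M) (hG : |g x| ≤ M)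
    (hH : ∀ s ∈ Set.Icc 0 x, |g x - g s| ≤ M * (1 + r) * (x - s) ^ (1 / 4 : ℝ)) :
    |-(ν / |z|) * charSol (ν / |z|) (1 / |z|) a g x + 1 / |z| * g x|
      ≤ (N + 1 + 4 * ν₀ ^ (-(1 / 4) : ℝ)) * M * (1 + r) * decayProfile ν₀ x z := by
  have hz' : 0 < |z| := abs_pos.2 hz
  have hν' : 0 < ν := hν₀.trans_le hν
  have hM : 0 ≤ M := (abs_nonneg _).trans ha
  have h := abs_deriv_charSol_le (κ := ν / |z|) (c := 1 / |z|) (a := a) (by positivity)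
    (by positivity) hx hgc hG hH (by positivity)
  refine h.trans ?_
  have h1 : Real.exp (-(ν / |z|) * x) ≤ Real.exp (-(ν₀ / |z|) * x) := by gcongr
  have h2 : ν / |z| * |a| + 1 / |z| * M ≤ (N + 1) * M * (1 + r) * |z|⁻¹ := by
    calc ν / |z| * |a| + 1 / |z| * M ≤ (N * (1 + r)) / |z| * M + 1 / |z| * M := by gcongr
      _ = (N * (1 + r) + 1) * M * |z|⁻¹ := by rw [div_eq_mul_inv, one_div]; ring
      _ ≤ ((N + 1) * (1 + r)) * M * |z|⁻¹ := by gcongr; nlinarith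
      _ = _ := by ring
  have h3 : 1 / |z| * (ν / |z|) ^ (-(1 / 4) : ℝ) ≤ ν₀ ^ (-(1 / 4) : ℝ) * |z| ^ (-(3 / 4) : ℝ) := by
    have e1 : 1 / |z| * (ν / |z|) ^ (-(1 / 4) : ℝ) = ν ^ (-(1 / 4) : ℝ) * |z| ^ (-(3 / 4) : ℝ) := by
      rw [Real.div_rpow hν'.le hz'.le, show (-(3 / 4) : ℝ) = -1 - -(1 / 4) by norm_num,
        Real.rpow_sub hz', Real.rpow_neg_one]
      ring
    rw [e1]
    refine mul_le_mul_of_nonneg_right ?_ (by positivity)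
    exact Real.rpow_le_rpow_of_nonpos hν₀ hν (by norm_num)
  set E := Real.exp (-(ν₀ / |z|) * x)
  set P := |z| ^ (-(3 / 4) : ℝ)
  set K := ν₀ ^ (-(1 / 4) : ℝ)
  have hK : 0 ≤ K := by positivity
  have hP : 0 ≤ P := by positivity
  calc Real.exp (-(ν / |z|) * x) * (ν / |z| * |a| + 1 / |z| * M)
        + 4 * (1 / |z|) * (M * (1 + r)) * (ν / |z|) ^ (-(1 / 4) : ℝ)
      = Real.exp (-(ν / |z|) * x) * (ν / |z| * |a| + 1 / |z| * M)
        + 4 * M * (1 + r) * (1 / |z| * (ν / |z|) ^ (-(1 / 4) : ℝ)) := by ring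
    _ ≤ E * ((N + 1) * M * (1 + r) * |z|⁻¹) + 4 * M * (1 + r) * (K * P) := by gcongr
    _ ≤ E * ((N + 1) * M * (1 + r) * |z|⁻¹) + 4 * M * (1 + r) * (K * P)
        + (4 * K * M * (1 + r) * (|z|⁻¹ * E) + (N + 1) * M * (1 + r) * P) :=
        le_add_of_nonneg_right (by positivity)
    _ = _ := by simp only [decayProfile]; ring

/-- Moments of the mild solution of `|ζ₁| ∂ₓ y = -ν y + g` are differentiable for `x > 0`, with a
logarithmic bound at `x = 0`, if `g` is bounded and Hölder continuous in `x`. -/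
theorem exists_moment_deriv_bound {ν : Vel → ℝ} (hνm : Measurable ν) {ν₀ N : ℝ} (hν₀ : 0 < ν₀)
    (hN : 0 ≤ N) (hν : ∀ ζ, ν₀ ≤ ν ζ) (hνN : ∀ ζ, ν ζ ≤ N * (1 + ‖ζ‖)) :
    ∃ C : ℝ, 0 ≤ C ∧ ∀ H : Set Vel, MeasurableSet H → (∀ ζ ∈ H, ζ 0 ≠ 0) →
      ∀ (a : Vel → ℝ) (g : ℝ → Vel → ℝ) (M : ℝ), 0 ≤ M →
      AEStronglyMeasurable a (volume.restrict H) → (∀ᵐ ζ ∂(volume.restrict H), |a ζ| ≤ M) →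
      (∀ s, Measurable (g s)) → (∀ ζ, Continuous fun s => g s ζ) → (∀ s ζ, |g s ζ| ≤ M) →
      (∀ s t ζ, s ≤ t → |g t ζ - g s ζ| ≤ M * (1 + ‖ζ‖) * (t - s) ^ (1 / 4 : ℝ)) →
      ∀ (α : Fin 3 → ℕ) (x : ℝ), 0 < x → ∃ D : ℝ,
        HasDerivAt (fun x => ∫ ζ in H, momentWeight α ζ *
          charSol (ν ζ / |ζ 0|) (1 / |ζ 0|) (a ζ) (fun s => g s ζ) x) D x ∧
        |D| ≤ C * momentConst α * M * (|Real.log x| + 1) := by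
  obtain ⟨C, hC0, hC⟩ := exists_lintegral_decayProfile_le hν₀
  set K := N + 1 + 4 * ν₀ ^ (-(1 / 4) : ℝ) with hK
  have hK0 : 0 ≤ K := by positivity
  refine ⟨5 * K * C, by positivity, fun H hH hH0 a g M hM ham haM hgm hgc hgM hgH α x₀ hx₀ => ?_⟩
  set A := momentConst α
  have hA : 0 ≤ A := momentConst_nonneg α
  set E : ℝ → Vel → ℝ := fun x ζ =>
    charSol (ν ζ / |ζ 0|) (1 / |ζ 0|) (a ζ) (fun s => g s ζ) x with hE
  set E' : ℝ → Vel → ℝ := fun x ζ => -(ν ζ / |ζ 0|) * E x ζ + 1 / |ζ 0| * g x ζ with hE'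
  have hφm : Measurable (momentWeight α) := by unfold momentWeight; fun_prop
  have hgu : Measurable (Function.uncurry g) := measurable_uncurry_of_continuous_of_measurable hgc hgm
  have hEm : ∀ x, 0 ≤ x → AEStronglyMeasurable (E x) (volume.restrict H) := by
    intro x hx
    have h1 : Measurable fun q : Vel × ℝ =>
        1 / |q.1 0| * Real.exp (-(ν q.1 / |q.1 0|) * (x - q.2)) * g q.2 q.1 := by
      have h2 : Measurable fun q : Vel × ℝ => g q.2 q.1 := hgu.comp measurable_swap
      have h3 : Measurable fun q : Vel × ℝ => ν q.1 := hνm.comp measurable_fst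
      fun_prop
    have h4 : StronglyMeasurable fun ζ : Vel => ∫ s in (0 : ℝ)..x,
        1 / |ζ 0| * Real.exp (-(ν ζ / |ζ 0|) * (x - s)) * g s ζ := by
      simp_rw [intervalIntegral.integral_of_le hx]
      exact h1.stronglyMeasurable.integral_prod_right'
    have h5 : Measurable fun ζ : Vel => Real.exp (-(ν ζ / |ζ 0|) * x) := by fun_prop
    exact (h5.aestronglyMeasurable.mul ham).add h4.aestronglyMeasurable
  have hκ : ∀ ζ ∈ H, 0 < ν ζ / |ζ 0| := fun ζ hζ =>
    div_pos (hν₀.trans_le (hν ζ)) (abs_pos.2 (hH0 ζ hζ))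
  -- The growth `1 + |ζ|` is absorbed by lowering the Gaussian exponent from `1/4` to `1/8`, at the
  -- price of the factor `5`.
  set bnd : ℝ → Vel → ℝ := fun x ζ =>
    5 * K * A * M * (Real.exp (-(1 / 8) * ‖ζ‖ ^ 2) * decayProfile ν₀ x (ζ 0)) with hbnd
  have hprof : ∀ x z, 0 ≤ decayProfile ν₀ x z := fun x z => by unfold decayProfile; positivity
  have hbound : ∀ᵐ ζ ∂(volume.restrict H), ∀ x, 0 ≤ x → |momentWeight α ζ * E' x ζ| ≤ bnd x ζ := by
    filter_upwards [haM, ae_restrict_mem hH] with ζ hζ hζH x hx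
    have h1 := abs_deriv_le_decayProfile (g := fun s => g s ζ) hν₀ hN (hν ζ) (norm_nonneg ζ) (hνN ζ)
      (hH0 ζ hζH) hx (hgc ζ) hζ (hgM x ζ) fun s hs => hgH s x ζ hs.2
    rw [abs_mul]
    have h2 := one_add_mul_exp_le ‖ζ‖ (1 / 4)
    have h3 : Real.exp (-(1 / 4 - 1 / 16) * ‖ζ‖ ^ 2) ≤ Real.exp (-(1 / 8) * ‖ζ‖ ^ 2) := by
      rw [Real.exp_le_exp]; nlinarith [sq_nonneg ‖ζ‖]
    have hp := hprof x (ζ 0)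
    calc |momentWeight α ζ| * |E' x ζ|
        ≤ (A * Real.exp (-(1 / 4) * ‖ζ‖ ^ 2)) * (K * M * (1 + ‖ζ‖) * decayProfile ν₀ x (ζ 0)) :=
          mul_le_mul (abs_momentWeight_le α ζ) h1 (abs_nonneg _) (by positivity)
      _ = K * A * M * decayProfile ν₀ x (ζ 0) * ((1 + ‖ζ‖) * Real.exp (-(1 / 4) * ‖ζ‖ ^ 2)) := by ring
      _ ≤ K * A * M * decayProfile ν₀ x (ζ 0) * (5 * Real.exp (-(1 / 8) * ‖ζ‖ ^ 2)) := by
          refine mul_le_mul_of_nonneg_left (h2.trans ?_) (by positivity)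
          gcongr
      _ = _ := by simp only [hbnd]; ring
  have hbm : ∀ x, Measurable (bnd x) := by
    intro x; simp only [hbnd]; unfold decayProfile; fun_prop
  have hbnn : ∀ x ζ, 0 ≤ bnd x ζ := fun x ζ => by
    have := hprof x (ζ 0); simp only [hbnd]; positivity
  have hbl : ∀ x, 0 < x → ∫⁻ ζ in H, ENNReal.ofReal (bnd x ζ)
      ≤ ENNReal.ofReal (5 * K * C * A * M * (|Real.log x| + 1)) := by
    intro x hx
    calc _ ≤ ∫⁻ ζ, ENNReal.ofReal (bnd x ζ) := setLIntegral_le_lintegral _ _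
      _ = ENNReal.ofReal (5 * K * A * M) * ∫⁻ ζ : Vel, ENNReal.ofReal
          (Real.exp (-(1 / 8) * ‖ζ‖ ^ 2) * decayProfile ν₀ x (ζ 0)) := by
          rw [← lintegral_const_mul' _ _ ENNReal.ofReal_ne_top]
          exact lintegral_congr fun ζ => ENNReal.ofReal_mul (by positivity)
      _ ≤ ENNReal.ofReal (5 * K * A * M) * ENNReal.ofReal (C * (|Real.log x| + 1)) :=
          mul_le_mul_right (hC x hx) _
      _ = _ := by rw [← ENNReal.ofReal_mul (by positivity)]; congr 1; ring
  have hbi : ∀ x, 0 < x → Integrable (bnd x) (volume.restrict H) := by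
    intro x hx
    refine ⟨(hbm x).aestronglyMeasurable, ?_⟩
    rw [hasFiniteIntegral_iff_ofReal (Filter.Eventually.of_forall (hbnn x))]
    exact lt_of_le_of_lt (hbl x hx) ENNReal.ofReal_lt_top
  have hanti : ∀ x y ζ, x ≤ y → bnd y ζ ≤ bnd x ζ := by
    intro x y ζ hxy
    simp only [hbnd, decayProfile]
    gcongr ?_ * (?_ * (?_ * Real.exp ?_ + ?_))
    · exact mul_le_mul_of_nonpos_left hxy (by rw [neg_nonpos]; positivity)
    · exact le_rfl
  -- The bound decreases in `x`, so its value at `x₀/2` dominates on a neighbourhood of `x₀`. It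
  -- must stay away from `x = 0`, where the profile contains the non-integrable `|ζ₁|⁻¹`.
  have hs : Set.Ioi (x₀ / 2) ∈ nhds x₀ := Ioi_mem_nhds (by linarith)
  have hEi : Integrable (fun ζ => momentWeight α ζ * E x₀ ζ) (volume.restrict H) := by
    have hGi : Integrable (fun ζ : Vel => A * (M + M / ν₀) * Real.exp (-(1 / 4) * ‖ζ‖ ^ 2))
        (volume.restrict H) := by
      refine Integrable.const_mul ?_ _
      refine ⟨Measurable.aestronglyMeasurable (by fun_prop), ?_⟩
      rw [hasFiniteIntegral_iff_ofReal (Filter.Eventually.of_forall fun _ => (Real.exp_pos _).le)]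
      exact lt_of_le_of_lt (setLIntegral_le_lintegral _ _)
        (lintegral_gaussian_vel_lt_top (c := 1 / 4) (by norm_num))
    refine hGi.mono' (hφm.aestronglyMeasurable.mul (hEm x₀ hx₀.le)) ?_
    filter_upwards [haM, ae_restrict_mem hH] with ζ hζ hζH
    have hz : 0 < |ζ 0| := abs_pos.2 (hH0 ζ hζH)
    have hνp : 0 < ν ζ := hν₀.trans_le (hν ζ)
    have h1 := abs_charSol_le (a := a ζ) (c := 1 / |ζ 0|) (G := M) (g := fun s => g s ζ) (hκ ζ hζH)
      (by positivity) hx₀.le fun s _ => hgM s ζ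
    have h2 : 1 / |ζ 0| * M / (ν ζ / |ζ 0|) ≤ M / ν₀ := by
      have : 1 / |ζ 0| * M / (ν ζ / |ζ 0|) = M / ν ζ := by field_simp
      rw [this]
      exact div_le_div_of_nonneg_left hM hν₀ (hν ζ)
    rw [norm_mul, Real.norm_eq_abs, Real.norm_eq_abs]
    calc |momentWeight α ζ| * |E x₀ ζ|
        ≤ (A * Real.exp (-(1 / 4) * ‖ζ‖ ^ 2)) * (M + M / ν₀) :=
          mul_le_mul (abs_momentWeight_le α ζ) (h1.trans (add_le_add hζ h2)) (abs_nonneg _)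
            (by positivity)
      _ = _ := by ring
  have hE'm : AEStronglyMeasurable (fun ζ => momentWeight α ζ * E' x₀ ζ) (volume.restrict H) := by
    have h1 : Measurable fun ζ : Vel => -(ν ζ / |ζ 0|) := by fun_prop
    have h2 : Measurable fun ζ : Vel => 1 / |ζ 0| * g x₀ ζ := by
      have := hgm x₀; fun_prop
    exact hφm.aestronglyMeasurable.mul
      ((h1.aestronglyMeasurable.mul (hEm x₀ hx₀.le)).add h2.aestronglyMeasurable)
  have key := hasDerivAt_integral_of_dominated_loc_of_deriv_le (μ := volume.restrict H)
    (F := fun x ζ => momentWeight α ζ * E x ζ) (F' := fun x ζ => momentWeight α ζ * E' x ζ)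
    (bound := bnd (x₀ / 2)) hs
    (by
      filter_upwards [hs] with x hx
      have hx' : x₀ / 2 < x := hx
      exact hφm.aestronglyMeasurable.mul (hEm x (by linarith))) hEi hE'm
    (by
      filter_upwards [hbound] with ζ hζ x hx
      have hx' : x₀ / 2 < x := hx
      exact (hζ x (by linarith)).trans (hanti _ _ ζ hx'.le))
    (hbi _ (by linarith))
    (Filter.Eventually.of_forall fun ζ x _ =>
      (hasDerivAt_charSol _ _ _ (hgc ζ) x).const_mul (momentWeight α ζ))
  refine ⟨_, key.2, ?_⟩
  have h1 : ‖∫ ζ in H, momentWeight α ζ * E' x₀ ζ‖ₑ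
      ≤ ENNReal.ofReal (5 * K * C * A * M * (|Real.log x₀| + 1)) := by
    refine (enorm_integral_le_lintegral_enorm _).trans (le_trans ?_ (hbl x₀ hx₀))
    refine lintegral_mono_ae ?_
    filter_upwards [hbound] with ζ hζ
    rw [← ofReal_norm]
    exact ENNReal.ofReal_le_ofReal (hζ x₀ hx₀.le)
  have h2 := ENNReal.toReal_mono ENNReal.ofReal_ne_top h1
  rwa [toReal_enorm, ENNReal.toReal_ofReal (by positivity), Real.norm_eq_abs] at h2

/-! ### Half-spaces, reflection in `x`, and independence of representatives. -/

theorem ae_coord_ne_zero : ∀ᵐ ζ : Vel, ζ 0 ≠ 0 := by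
  have h1 : Measure.QuasiMeasurePreserving (fun x : Fin 3 → ℝ => x 0) volume volume :=
    Measure.quasiMeasurePreserving_eval (fun _ : Fin 3 => (volume : Measure ℝ)) 0
  have h2 := h1.comp (PiLp.volume_preserving_ofLp (Fin 3)).quasiMeasurePreserving
  have h3 : ∀ᵐ t : ℝ, t ≠ 0 := by
    rw [ae_iff]; simp
  exact h2.ae h3

theorem measurableSet_posHalf : MeasurableSet posHalf :=
  measurableSet_lt measurable_const (by fun_prop : Measurable fun ζ : Vel => ζ 0)

theorem measurableSet_negHalf : MeasurableSet negHalf :=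
  measurableSet_lt (by fun_prop : Measurable fun ζ : Vel => ζ 0) measurable_const

theorem continuous_of_abs_sub_le_rpow {h : ℝ → ℝ} {c : ℝ}
    (hh : ∀ s t, s ≤ t → |h t - h s| ≤ c * (t - s) ^ (1 / 4 : ℝ)) : Continuous h := by
  rw [continuous_iff_continuousAt]
  intro s
  have h1 : ∀ t, |h t - h s| ≤ c * |t - s| ^ (1 / 4 : ℝ) := by
    intro t
    rcases le_total s t with hst | hst
    · rw [abs_of_nonneg (sub_nonneg.2 hst)]; exact hh s t hst
    · rw [abs_sub_comm, abs_sub_comm t, abs_of_nonneg (sub_nonneg.2 hst)]; exact hh t s hst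
  have h2 : Filter.Tendsto (fun t => c * |t - s| ^ (1 / 4 : ℝ)) (nhds s) (nhds 0) := by
    have h3 : Continuous fun t : ℝ => c * |t - s| ^ (1 / 4 : ℝ) :=
      continuous_const.mul ((continuous_abs.comp (continuous_id.sub continuous_const)).rpow_const
        fun _ => Or.inr (by norm_num))
    have h4 := h3.tendsto s
    simpa using h4
  rw [ContinuousAt, tendsto_iff_norm_sub_tendsto_zero]
  exact squeeze_zero (fun _ => norm_nonneg _) h1 h2

/-- The reflection `x ↦ l - x` turns the problem with data at `l` into one with data at `0`, so that
velocities `ζ₁ < 0` need no separate estimates. -/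
theorem integral_reflect_eq_charSol (κ c a l x : ℝ) (g : ℝ → ℝ) :
    Real.exp (-κ * (l - x)) * a + ∫ s in x..l, c * Real.exp (-κ * (s - x)) * g s
      = charSol κ c a (fun s => g (l - s)) (l - x) := by
  have h := intervalIntegral.integral_comp_sub_left
    (fun s => c * Real.exp (-κ * (s - x)) * g s) l (a := 0) (b := l - x)
  rw [sub_sub_cancel, sub_zero] at h
  rw [charSol, ← h]
  congr 1
  refine intervalIntegral.integral_congr fun s _ => ?_
  rw [show l - s - x = l - x - s by ring]

theorem charSol_congr {κ c a x : ℝ} {g h : ℝ → ℝ} (hx : 0 ≤ x)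
    (hgh : ∀ s ∈ Set.Icc 0 x, g s = h s) : charSol κ c a g x = charSol κ c a h x := by
  unfold charSol
  congr 1
  refine intervalIntegral.integral_congr fun s hs => ?_
  rw [Set.uIcc_of_le hx] at hs
  rw [hgh s hs]

theorem collisionK_congr_ae {B : ℝ → ℝ → ℝ} {γ : ℝ} (hγ0 : 0 < γ) (hγ1 : γ ≤ 1)
    (hB : IsGradCutoff B γ) {f g : Vel → ℝ} (h : ∀ᵐ η, f η = g η) (ζ : Vel) :
    collisionK B f ζ = collisionK B g ζ := by
  obtain ⟨-, -, hae, -⟩ := collisionK_bound hγ0 hγ1 hB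
  rw [collisionK_eq, collisionK_eq, integral_congr_ae (hae f g h ζ)]

theorem ae_abs_le_of_memLp_top {g : Vel → ℝ} {s : Set Vel} (hs : MeasurableSet s)
    (hg : MemLp g ∞ (volume.restrict s)) :
    ∀ᵐ ζ : Vel, ζ ∈ s → |g ζ| ≤ (eLpNorm g ∞ (volume.restrict s)).toReal := by
  rw [← ae_restrict_iff' hs]
  filter_upwards [ae_le_eLpNormEssSup (f := g) (μ := volume.restrict s)] with ζ hζ
  rw [← eLpNorm_exponent_top] at hζ
  have := ENNReal.toReal_mono hg.2.ne hζ
  rwa [toReal_enorm] at this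

/-! ### Hölder continuity in `x` of a solution and of `K(f)`. -/

section Solution

variable {B : ℝ → ℝ → ℝ} {γ l : ℝ} {f : ℝ → Vel → ℝ}

theorem IsSolution.starNorm_lt_top (hf : IsSolution B l f) {s : ℝ} (hs : s ∈ Set.Icc 0 l) :
    starNorm B (f s) < ∞ :=
  lt_of_le_of_lt (le_iSup₂ (f := fun x (_ : x ∈ Set.Icc 0 l) => starNorm B (f x)) s hs) hf.bounded

theorem dataNorm_eq (hf : IsSolution B l f) (h0 : MemLp (f 0) ∞ (volume.restrict posHalf))
    (hl : MemLp (f l) ∞ (volume.restrict negHalf)) :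
    dataNorm B l f = (tripleNorm B l f).toReal + (eLpNorm (f 0) ∞ (volume.restrict posHalf)).toReal
      + (eLpNorm (f l) ∞ (volume.restrict negHalf)).toReal := by
  rw [dataNorm, ENNReal.toReal_add (ENNReal.add_lt_top.2 ⟨hf.bounded, h0.2⟩).ne hl.2.ne,
    ENNReal.toReal_add hf.bounded.ne h0.2.ne]

/-- Joint measurability of `f` holds only up to null sets. A jointly measurable representative
agrees with `f s` almost everywhere for almost every `s`, and `K` does not see the difference. -/
theorem intervalIntegrable_collisionK (hγ0 : 0 < γ) (hγ1 : γ ≤ 1) (hB : IsGradCutoff B γ)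
    (hl : 0 < l) (hf : IsSolution B l f) {ζ : Vel} {G : ℝ}
    (hG : ∀ s ∈ Set.Icc 0 l, |collisionK B (f s) ζ| ≤ G) :
    IntervalIntegrable (fun s => collisionK B (f s) ζ) volume 0 l := by
  rw [intervalIntegrable_iff_integrableOn_Icc_of_le hl.le]
  set F := hf.measurable_joint.mk with hF
  have hFm : Measurable (Function.uncurry fun s η => F (s, η)) :=
    hf.measurable_joint.stronglyMeasurable_mk.measurable
  have hae : ∀ᵐ s ∂((volume : Measure ℝ).restrict (Set.Icc 0 l)), ∀ᵐ η : Vel, f s η = F (s, η) :=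
    Measure.ae_ae_of_ae_prod hf.measurable_joint.ae_eq_mk
  have hm : Measurable fun s => collisionK B (fun η => F (s, η)) ζ := by
    have h := measurable_collisionK hB.measurable hFm
    exact Measurable.of_uncurry_right (f := fun s ζ => collisionK B (fun η => F (s, η)) ζ) h
  have hcongr : (fun s => collisionK B (fun η => F (s, η)) ζ)
      =ᵐ[(volume : Measure ℝ).restrict (Set.Icc 0 l)] fun s => collisionK B (f s) ζ := by
    filter_upwards [hae] with s hs
    exact (collisionK_congr_ae hγ0 hγ1 hB hs ζ).symm
  refine Integrable.of_bound (hm.aestronglyMeasurable.congr hcongr) G ?_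
  filter_upwards [ae_restrict_mem measurableSet_Icc] with s hs
  exact hG s hs

/-- The increment estimate for the scalar equation, applied on each half-space from its own inflow
boundary. The constant is uniform in `ζ` because `c G/κ = G/ν ≤ G/ν₀`; the singularity in `ζ₁` stays
in the factor `κ^(1/4)`. -/
theorem IsSolution.ae_abs_sub_le (hγ0 : 0 < γ) (hγ1 : γ ≤ 1) (hB : IsGradCutoff B γ)
    (hl : 0 < l) (hf : IsSolution B l f) {ν₀ m G : ℝ} (hν₀ : 0 < ν₀)
    (hν : ∀ ζ, ν₀ ≤ collisionFreq B ζ)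
    (h0 : ∀ᵐ ζ : Vel, ζ ∈ posHalf → |f 0 ζ| ≤ m) (h1 : ∀ᵐ ζ : Vel, ζ ∈ negHalf → |f l ζ| ≤ m)
    (hG : ∀ s ∈ Set.Icc 0 l, ∀ ζ, |collisionK B (f s) ζ| ≤ G) {x y : ℝ} (hy : 0 ≤ y) (hyx : y ≤ x)
    (hxl : x ≤ l) :
    ∀ᵐ ζ : Vel, |f x ζ - f y ζ| ≤ (m + 2 * (G / ν₀)) * (x - y) ^ (1 / 4 : ℝ)
      * (collisionFreq B ζ / |ζ 0|) ^ (1 / 4 : ℝ) := by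
  have hG0 : 0 ≤ G := (abs_nonneg _).trans (hG 0 ⟨le_rfl, hl.le⟩ 0)
  filter_upwards [h0, h1, ae_coord_ne_zero, hf.eq_pos x ⟨hy.trans hyx, hxl⟩,
    hf.eq_pos y ⟨hy, hyx.trans hxl⟩, hf.eq_neg x ⟨hy.trans hyx, hxl⟩,
    hf.eq_neg y ⟨hy, hyx.trans hxl⟩] with ζ hζ0 hζ1 hne hpx hpy hnx hny
  have hz : 0 < |ζ 0| := abs_pos.2 hne
  have hν' : 0 < collisionFreq B ζ := hν₀.trans_le (hν ζ)
  have hκ : 0 < collisionFreq B ζ / |ζ 0| := div_pos hν' hz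
  have hi := intervalIntegrable_collisionK hγ0 hγ1 hB hl hf (fun s hs => hG s hs ζ)
  have hc : 1 / |ζ 0| * G / (collisionFreq B ζ / |ζ 0|) ≤ G / ν₀ := by
    have : 1 / |ζ 0| * G / (collisionFreq B ζ / |ζ 0|) = G / collisionFreq B ζ := by field_simp
    rw [this]
    exact div_le_div_of_nonneg_left hG0 hν₀ (hν ζ)
  have hfin : ∀ a : ℝ, |a| ≤ m → (|a| + 2 * (1 / |ζ 0| * G / (collisionFreq B ζ / |ζ 0|)))
      * (x - y) ^ (1 / 4 : ℝ) * (collisionFreq B ζ / |ζ 0|) ^ (1 / 4 : ℝ)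
      ≤ (m + 2 * (G / ν₀)) * (x - y) ^ (1 / 4 : ℝ)
      * (collisionFreq B ζ / |ζ 0|) ^ (1 / 4 : ℝ) := by
    intro a ha
    have : 0 ≤ x - y := by linarith
    gcongr
  rcases lt_or_gt_of_ne hne with hneg | hpos
  · rw [hnx hneg, hny hneg, integral_reflect_eq_charSol _ _ _ _ _ (fun s => collisionK B (f s) ζ),
      integral_reflect_eq_charSol _ _ _ _ _ (fun s => collisionK B (f s) ζ), abs_sub_comm]
    have hi' : IntervalIntegrable (fun s => collisionK B (f (l - s)) ζ) volume 0 (l - y) := by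
      have h2 := (hi.comp_sub_left l).symm
      rw [sub_self, sub_zero] at h2
      exact h2.mono_set (by
        rw [Set.uIcc_of_le hl.le, Set.uIcc_of_le (by linarith)]
        exact Set.Icc_subset_Icc_right (by linarith))
    have h := abs_charSol_sub_le (a := f l ζ) (c := 1 / |ζ 0|) (G := G) (y := l - x) (x := l - y)
      (g := fun s => collisionK B (f (l - s)) ζ) hκ (by positivity) (by linarith) (by linarith) hi'
      fun s hs => hG _ ⟨by linarith [hs.2], by linarith [hs.1]⟩ ζ
    rw [sub_sub_sub_cancel_left] at h
    exact h.trans (hfin _ (hζ1 hneg))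
  · rw [hpx hpos, hpy hpos]
    have h := abs_charSol_sub_le (a := f 0 ζ) (c := 1 / |ζ 0|) (G := G) (y := y) (x := x)
      (g := fun s => collisionK B (f s) ζ) hκ (by positivity) hy hyx
      (hi.mono_set (by
        rw [Set.uIcc_of_le hl.le, Set.uIcc_of_le (by linarith)]
        exact Set.Icc_subset_Icc_right hxl))
      fun s hs => hG _ ⟨hs.1, hs.2.trans hxl⟩ ζ
    exact h.trans (hfin _ (hζ0 hpos))

/-- Collisions turn the mild equation into Hölder continuity of `K(f)` in `x`. -/
theorem exists_collisionK_holder (hγ0 : 0 < γ) (hγ1 : γ ≤ 1) (hB : IsGradCutoff B γ) :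
    ∃ C : ℝ, 1 ≤ C ∧ ∀ (l : ℝ) (f : ℝ → Vel → ℝ), 0 < l → IsSolution B l f →
      MemLp (f 0) ∞ (volume.restrict posHalf) → MemLp (f l) ∞ (volume.restrict negHalf) →
      (∀ s ∈ Set.Icc 0 l, ∀ ζ, |collisionK B (f s) ζ| ≤ C * dataNorm B l f) ∧
      ∀ x y, 0 ≤ y → y ≤ x → x ≤ l → ∀ ζ, |collisionK B (f x) ζ - collisionK B (f y) ζ|
        ≤ C * dataNorm B l f * (1 + ‖ζ‖) * (x - y) ^ (1 / 4 : ℝ) := by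
  obtain ⟨C₁, hC₁0, hC₁⟩ := abs_collisionK_le_starNorm hγ0 hγ1 hB
  obtain ⟨C₂, hC₂0, hC₂⟩ := abs_collisionK_le_of_le_rpow hγ0 hγ1 hB
  obtain ⟨ν₀, hν₀, hν⟩ := hB.exists_freq_lower hγ0
  -- `D m (x - y)^(1/4)` is `C₂` times the amplitude of the Hölder bound on `f`, whose source bound
  -- is `G = C₁ m`.
  set D := C₂ * (1 + 2 * (C₁ / ν₀)) with hD
  have hD0 : 0 ≤ D := by positivity
  -- The summand `1` makes the constant at least `1`, so that the same multiple of `⟨f⟩` later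
  -- bounds the boundary data too.
  refine ⟨1 + C₁ + D, by linarith, fun l f hl hf hf0 hfl => ?_⟩
  set m := dataNorm B l f with hm
  have hm0 : 0 ≤ m := ENNReal.toReal_nonneg
  have hmeq := dataNorm_eq hf hf0 hfl
  rw [← hm] at hmeq
  have ht0 : 0 ≤ (tripleNorm B l f).toReal := ENNReal.toReal_nonneg
  have hp0 : 0 ≤ (eLpNorm (f 0) ∞ (volume.restrict posHalf)).toReal := ENNReal.toReal_nonneg
  have hn0 : 0 ≤ (eLpNorm (f l) ∞ (volume.restrict negHalf)).toReal := ENNReal.toReal_nonneg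
  have hK : ∀ s ∈ Set.Icc 0 l, ∀ ζ, |collisionK B (f s) ζ| ≤ C₁ * m := by
    intro s hs ζ
    refine ((hC₁ (f s) (hf.measurable_slice s hs) (hf.starNorm_lt_top hs) ζ).2).trans ?_
    refine mul_le_mul_of_nonneg_left ?_ hC₁0
    have : (starNorm B (f s)).toReal ≤ (tripleNorm B l f).toReal :=
      ENNReal.toReal_mono hf.bounded.ne
        (le_iSup₂ (f := fun x (_ : x ∈ Set.Icc 0 l) => starNorm B (f x)) s hs)
    linarith
  refine ⟨fun s hs ζ => (hK s hs ζ).trans ?_, fun x y hy hyx hxl ζ => ?_⟩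
  · gcongr; linarith
  have hd : 0 ≤ (x - y) ^ (1 / 4 : ℝ) := Real.rpow_nonneg (by linarith) _
  have hx : x ∈ Set.Icc 0 l := ⟨hy.trans hyx, hxl⟩
  have hy' : y ∈ Set.Icc 0 l := ⟨hy, hyx.trans hxl⟩
  have hdiff := hf.ae_abs_sub_le (m := m) (G := C₁ * m) hγ0 hγ1 hB hl hν₀ hν
    (by filter_upwards [ae_abs_le_of_memLp_top measurableSet_posHalf hf0] with η hη h
        linarith [hη h])
    (by filter_upwards [ae_abs_le_of_memLp_top measurableSet_negHalf hfl] with η hη h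
        linarith [hη h]) hK hy hyx hxl
  have hmx := hf.measurable_slice x hx
  have hmy := hf.measurable_slice y hy'
  have h1 := hC₂ (fun η => f x η - f y η) (hmx.sub hmy) _ (by positivity) hdiff ζ
  -- Linearity of the Bochner integral needs both integrands integrable, which the finite weighted
  -- norms of the slices provide.
  have hsub : collisionK B (fun η => f x η - f y η) ζ
      = collisionK B (f x) ζ - collisionK B (f y) ζ := by
    rw [collisionK_eq, collisionK_eq, collisionK_eq, ← integral_sub
      (hC₁ _ hmx (hf.starNorm_lt_top hx) ζ).1 (hC₁ _ hmy (hf.starNorm_lt_top hy') ζ).1]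
    exact integral_congr_ae (Filter.Eventually.of_forall fun p => kIntegrand_sub B _ _ ζ p)
  rw [hsub] at h1
  refine h1.trans ?_
  calc C₂ * ((m + 2 * (C₁ * m / ν₀)) * (x - y) ^ (1 / 4 : ℝ)) * (1 + ‖ζ‖)
      = D * m * (1 + ‖ζ‖) * (x - y) ^ (1 / 4 : ℝ) := by rw [hD]; field_simp
    _ ≤ _ := by gcongr; linarith

theorem measurable_collisionK_slice (hγ0 : 0 < γ) (hγ1 : γ ≤ 1) (hB : IsGradCutoff B γ)
    {g : Vel → ℝ} (hg : AEStronglyMeasurable g volume) : Measurable (collisionK B g) := by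
  have h1 : collisionK B g = collisionK B (hg.mk g) :=
    funext fun ζ => collisionK_congr_ae hγ0 hγ1 hB hg.ae_eq_mk ζ
  rw [h1]
  have hm : Measurable (Function.uncurry fun (_ : Unit) => hg.mk g) :=
    hg.stronglyMeasurable_mk.measurable.comp measurable_snd
  have h := measurable_collisionK hB.measurable hm
  exact Measurable.of_uncurry_left (f := fun _ ζ => collisionK B (hg.mk g) ζ) h (x := ())

end Solution

end Boltzmann

end

/-! ### Assembly of the two half-space estimates. -/

open Boltzmann in
theorem lemma2p3 (γ : ℝ) (hγ0 : 0 < γ) (hγ1 : γ ≤ 1) (B : ℝ → ℝ → ℝ)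
    (hB : Boltzmann.IsGradCutoff B γ) (l : ℝ) (hl : 0 < l) :
    ∃ C : ℝ, ∀ f : ℝ → Boltzmann.Vel → ℝ, Boltzmann.IsSolution B l f →
      MemLp (f 0) ∞ (volume.restrict Boltzmann.posHalf) →
      MemLp (f l) ∞ (volume.restrict Boltzmann.negHalf) →
      ∀ α : Fin 3 → ℕ,
        (∀ x ∈ Set.Ioc (0 : ℝ) l,
          DifferentiableWithinAt ℝ (Boltzmann.sigmaPlus f α) (Set.Icc 0 l) x ∧
          |derivWithin (Boltzmann.sigmaPlus f α) (Set.Icc 0 l) x|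
            ≤ C * Boltzmann.momentConst α * Boltzmann.dataNorm B l f * (|Real.log x| + 1)) ∧
        (∀ x ∈ Set.Ico (0 : ℝ) l,
          DifferentiableWithinAt ℝ (Boltzmann.sigmaMinus f α) (Set.Icc 0 l) x ∧
          |derivWithin (Boltzmann.sigmaMinus f α) (Set.Icc 0 l) x|
            ≤ C * Boltzmann.momentConst α * Boltzmann.dataNorm B l f
                * (|Real.log (l - x)| + 1)) := by
  obtain ⟨C₁, hC₁1, hC₁⟩ := exists_collisionK_holder hγ0 hγ1 hB
  obtain ⟨ν₀, hν₀, hν⟩ := hB.exists_freq_lower hγ0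
  obtain ⟨N, hN0, hN⟩ := hB.exists_freq_upper hγ0 hγ1
  obtain ⟨C₂, hC₂0, hC₂⟩ :=
    exists_moment_deriv_bound (measurable_collisionFreq hB.measurable) hν₀ hN0 hν hN
  refine ⟨C₂ * C₁, fun f hf hf0 hfl α => ?_⟩
  obtain ⟨hK, hKd⟩ := hC₁ l f hl hf hf0 hfl
  have hmeq := dataNorm_eq hf hf0 hfl
  have hm0 : 0 ≤ dataNorm B l f := ENNReal.toReal_nonneg
  have ht0 : 0 ≤ (tripleNorm B l f).toReal := ENNReal.toReal_nonneg
  have hp0 : 0 ≤ (eLpNorm (f 0) ∞ (volume.restrict posHalf)).toReal := ENNReal.toReal_nonneg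
  have hn0 : 0 ≤ (eLpNorm (f l) ∞ (volume.restrict negHalf)).toReal := ENNReal.toReal_nonneg
  set m := dataNorm B l f
  have hmC : m ≤ C₁ * m := le_mul_of_one_le_left hm0 hC₁1
  -- One constant `M` bounds the boundary data, `K(f)` and its Hölder amplitude.
  set M := C₁ * m with hM
  have hM0 : 0 ≤ M := by positivity
  -- extension of `K(f)` beyond `[0, l]`, constant in `x`
  set c : ℝ → ℝ := fun s => Set.projIcc 0 l hl.le s with hc
  have hcm : ∀ s, c s ∈ Set.Icc 0 l := fun s => (Set.projIcc 0 l hl.le s).2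
  have hcid : ∀ s ∈ Set.Icc 0 l, c s = s := fun s hs => by
    simp only [hc]; rw [Set.projIcc_of_mem hl.le hs]
  have hcmono : ∀ s t, s ≤ t → c s ≤ c t := fun s t h => Set.monotone_projIcc hl.le h
  have hclip : ∀ s t, s ≤ t → c t - c s ≤ t - s := by
    intro s t hst
    have h1 := (LipschitzWith.projIcc hl.le).dist_le_mul t s
    rw [NNReal.coe_one, one_mul, Real.dist_eq, abs_of_nonneg (sub_nonneg.2 hst)] at h1
    exact (le_abs_self _).trans h1
  have hholder : ∀ s t ζ, s ≤ t → |collisionK B (f (c t)) ζ - collisionK B (f (c s)) ζ|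
      ≤ M * (1 + ‖ζ‖) * (t - s) ^ (1 / 4 : ℝ) := by
    intro s t ζ hst
    refine (hKd _ _ (hcm s).1 (hcmono s t hst) (hcm t).2 ζ).trans ?_
    have h1 : 0 ≤ c t - c s := sub_nonneg.2 (hcmono s t hst)
    have h2 := hclip s t hst
    gcongr
  have hmeas : ∀ s, Measurable (collisionK B (f (c s))) := fun s =>
    measurable_collisionK_slice hγ0 hγ1 hB (hf.measurable_slice _ (hcm s))
  have hcont : ∀ ζ, Continuous fun s => collisionK B (f (c s)) ζ := fun ζ =>
    continuous_of_abs_sub_le_rpow fun s t hst => hholder s t ζ hst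
  constructor
  · intro x hx
    obtain ⟨D, hD, hDle⟩ := hC₂ posHalf measurableSet_posHalf (fun ζ hζ => (ne_of_gt hζ))
      (f 0) (fun s ζ => collisionK B (f (c s)) ζ) M hM0 hf0.1
      (by
        rw [ae_restrict_iff' measurableSet_posHalf]
        filter_upwards [ae_abs_le_of_memLp_top measurableSet_posHalf hf0] with ζ hζ h
        linarith [hζ h])
      hmeas hcont (fun s ζ => hK _ (hcm s) ζ) hholder α x hx.1
    have heq : ∀ y ∈ Set.Icc 0 l, sigmaPlus f α y = ∫ ζ in posHalf, momentWeight α ζ *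
        charSol (collisionFreq B ζ / |ζ 0|) (1 / |ζ 0|) (f 0 ζ)
          (fun s => collisionK B (f (c s)) ζ) y := by
      intro y hy
      refine setIntegral_congr_ae measurableSet_posHalf ?_
      filter_upwards [hf.eq_pos y hy] with ζ hζ hpos
      rw [hζ hpos]
      congr 1
      refine charSol_congr (g := fun s => collisionK B (f s) ζ) hy.1 fun s hs => ?_
      rw [hcid s ⟨hs.1, hs.2.trans hy.2⟩]
    have hx' : x ∈ Set.Icc 0 l := ⟨hx.1.le, hx.2⟩
    -- The extended source gives a two-sided derivative even at `x = l`; agreement with the moment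
    -- on `[0, l]` yields the derivative within the interval.
    have hder : HasDerivWithinAt (sigmaPlus f α) D (Set.Icc 0 l) x :=
      hD.hasDerivWithinAt.congr heq (heq x hx')
    refine ⟨hder.differentiableWithinAt, ?_⟩
    rw [hder.derivWithin (uniqueDiffOn_Icc hl x hx')]
    exact hDle.trans (le_of_eq (by rw [hM]; ring))
  · intro x hx
    -- The same estimate at depth `l - x`, with data at `l` and reflected source; the Hölder bound
    -- is symmetric under the reflection.
    obtain ⟨D, hD, hDle⟩ := hC₂ negHalf measurableSet_negHalf (fun ζ hζ => (ne_of_lt hζ))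
      (f l) (fun s ζ => collisionK B (f (c (l - s))) ζ) M hM0 hfl.1
      (by
        rw [ae_restrict_iff' measurableSet_negHalf]
        filter_upwards [ae_abs_le_of_memLp_top measurableSet_negHalf hfl] with ζ hζ h
        linarith [hζ h])
      (fun s => hmeas _) (fun ζ => (hcont ζ).comp (continuous_const.sub continuous_id))
      (fun s ζ => hK _ (hcm _) ζ)
      (fun s t ζ hst => by
        rw [abs_sub_comm]
        have := hholder (l - t) (l - s) ζ (by linarith)
        rwa [sub_sub_sub_cancel_left] at this)
      α (l - x) (by linarith [hx.2])
    have heq : ∀ y ∈ Set.Icc 0 l, sigmaMinus f α y = ∫ ζ in negHalf, momentWeight α ζ *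
        charSol (collisionFreq B ζ / |ζ 0|) (1 / |ζ 0|) (f l ζ)
          (fun s => collisionK B (f (c (l - s))) ζ) (l - y) := by
      intro y hy
      refine setIntegral_congr_ae measurableSet_negHalf ?_
      filter_upwards [hf.eq_neg y hy] with ζ hζ hneg
      rw [hζ hneg, integral_reflect_eq_charSol _ _ _ _ _ (fun s => collisionK B (f s) ζ)]
      congr 1
      refine charSol_congr (by linarith [hy.2]) fun s hs => ?_
      rw [hcid (l - s) ⟨by linarith [hs.2, hy.1], by linarith [hs.1]⟩]
    have hx' : x ∈ Set.Icc 0 l := ⟨hx.1, hx.2.le⟩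
    -- The chain rule for `l - x` reverses the sign.
    have hder : HasDerivWithinAt (sigmaMinus f α) (-D) (Set.Icc 0 l) x :=
      (hD.comp_const_sub l x).hasDerivWithinAt.congr heq (heq x hx')
    refine ⟨hder.differentiableWithinAt, ?_⟩
    rw [hder.derivWithin (uniqueDiffOn_Icc hl x hx'), abs_neg]
    exact hDle.trans (le_of_eq (by rw [hM]; ring))
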